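/- Let $d\ge 1$, $D\ge 0$ be integers, let $A=(A^{ij})_{1\le i,j\le d}$ be a family of complex $D\times D$ matrices and let $l,r\in\mathbb C^D$. For $N\ge 1$ let $U_N$ be the operator on $(\mathbb C^d)^{\otimes N}$ with matrix elements $$\langle i_1\dots i_N|U_N|j_1\dots j_N\rangle = l^T A^{i_1j_1}A^{i_2j_2}\cdots A^{i_Nj_N}\,r .$$ Suppose that $(A,l,r)$ defines a uniform-bulk matrix-product unitary (MPU), i.e. $U_N$ is unitary for every $N\ge 1$, and that the two $d^2\times D$ matrices with entries $(l^TA^{ij})_a$ and $(A^{ij}r)_a$ (rows $(i,j)$, column $a$) both have rank $D$ (Assumption 1). For $m\ge 0$ and a density operator $\sigma$ on $m$ qudits of dimension $d$ let $L(\sigma)$ and $R(\sigma)$ be the $D\times D$ matrices $$L(\sigma)_{a'a}=\sum_{x,y,y'}\sigma_{yy'}\,\overline{(l^TA^{x_1y'_1}\cdots A^{x_my'_m})_{a'}}\,(l^TA^{x_1y_1}\cdots A^{x_my_m})_{a},$$ $$R(\sigma)_{a'a}=\sum_{x,y,y'}\sigma_{yy'}\,\overline{(A^{x_1y'_1}\cdots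 A^{x_my'_m}r)_{a'}}\,(A^{x_1y_1}\cdots A^{x_my_m}r)_{a},$$ where $x,y,y'$ range over $\{1,\dots,d\}^m$. Let $\mathcal L$ (resp. $\mathcal R$) be the set of all $L(\sigma)$ (resp. $R(\sigma)$), over all $m$ and $\sigma$, that are positive definite, and put $$q_{\mathrm{unif}}=\inf_{L^2\in\mathcal L,\;R^2\in\mathcal R}\sqrt{\operatorname{tr}\!\left[R^{-2}(L^{-2})^T\right]} .$$ A quantum circuit consists of layers of arbitrary unitary gates, each acting on at most two qudits, the gates of one layer acting on disjoint sets of qudits; its depth is its number of layers. It implements $U_N$ with $a$ auxiliary qudits (also of dimension $d$) if it maps $|\psi\rangle\otimes|0\rangle^{\otimes a}$ to $U_N|\psi\rangle\otimes|0\rangle^{\otimes a}$ for all $|\psi\rangle\in(\mathbb C^d)^{\otimes N}$. Then, with constants that depend only on $(A,l,r)$: 1. For all $N\ge 1$, $U_N$ can be implemented by a quantum circuit of depth $O(\operatorname{poly}N)$ with $O(N)$ auxiliary qudits. 2. The sets $\mathcal L$ and $\mathcal R$ are nonempty, so that $q_{\mathrm{unif}}$ is a finite constant independent of $N$, and for all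 $N\ge 1$, $U_N$ can be implemented by a quantum circuit of depth $O(N^{1+\log_2 q_{\mathrm{unif}}})$ with $O(N)$ auxiliary qudits. -/

import Mathlib

open scoped ComplexOrder

/-! ### Quantum circuits of two-qudit gates -/

/-- A gate on qudits of dimension `d` labelled by `ι`: an arbitrary unitary acting on
at most two of the qudits. -/
structure QuditGate (ι : Type) [DecidableEq ι] (d : ℕ) where
  support : Finset ι
  card_le : support.card ≤ 2
  mat : Matrix (support → Fin d) (support → Fin d) ℂ
  unitary : mat ∈ Matrix.unitaryGroup (support → Fin d) ℂ

/-- The operator of a gate on the whole register: `mat` on the support, tensored with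
the identity on all other qudits. -/
def QuditGate.op {ι : Type} [Fintype ι] [DecidableEq ι] {d : ℕ} (g : QuditGate ι d) :
    Matrix (ι → Fin d) (ι → Fin d) ℂ :=
  fun x y =>
    if ∀ k, k ∉ g.support → x k = y k then
      g.mat (fun k => x k) (fun k => y k)
    else 0

/-- A layer of a circuit: finitely many gates with pairwise disjoint supports. -/
structure CircuitLayer (ι : Type) [DecidableEq ι] (d : ℕ) where
  gates : List (QuditGate ι d)
  disjoint : gates.Pairwise (fun g h => Disjoint g.support h.support)

/-- The operator of a layer (the gates commute, so their order is irrelevant). -/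
def CircuitLayer.op {ι : Type} [Fintype ι] [DecidableEq ι] {d : ℕ} (L : CircuitLayer ι d) :
    Matrix (ι → Fin d) (ι → Fin d) ℂ :=
  (L.gates.map QuditGate.op).prod

/-- A quantum circuit: a list of layers, the head being applied first. -/
structure QuditCircuit (ι : Type) [DecidableEq ι] (d : ℕ) where
  layers : List (CircuitLayer ι d)

/-- The depth of a circuit is its number of layers. -/
def QuditCircuit.depth {ι : Type} [DecidableEq ι] {d : ℕ} (C : QuditCircuit ι d) : ℕ :=
  C.layers.length

/-- The operator of a circuit. -/
def QuditCircuit.op {ι : Type} [Fintype ι] [DecidableEq ι] {d : ℕ} (C : QuditCircuit ι d) :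
    Matrix (ι → Fin d) (ι → Fin d) ℂ :=
  (C.layers.map CircuitLayer.op).reverse.prod

/-- A circuit on `N` system qudits and `a` auxiliary qudits implements the operator `U`
if it maps `|ψ⟩ ⊗ |0…0⟩` to `U|ψ⟩ ⊗ |0…0⟩` for every state `|ψ⟩` of the system. -/
def QuditCircuit.Implements {N a d : ℕ} [NeZero d] (C : QuditCircuit (Fin N ⊕ Fin a) d)
    (U : Matrix (Fin N → Fin d) (Fin N → Fin d) ℂ) : Prop :=
  ∀ (x y : Fin N → Fin d) (b : Fin a → Fin d),
    C.op (Sum.elim x b) (Sum.elim y (fun _ => 0)) = if b = (fun _ => 0) then U x y else 0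

/-! ### Uniform-bulk matrix-product unitaries

The bulk tensor is `A : Fin d → Fin d → Matrix (Fin D) (Fin D) ℂ`: `A i j` is the matrix on
the bond space attached to the output `i` and the input `j` of a site. -/

/-- The product `A (x 0) (y 0) * ⋯ * A (x (m-1)) (y (m-1))` of bond matrices. -/
def bondProd {d D : ℕ} (A : Fin d → Fin d → Matrix (Fin D) (Fin D) ℂ) {m : ℕ}
    (x y : Fin m → Fin d) : Matrix (Fin D) (Fin D) ℂ :=
  (List.ofFn (fun k => A (x k) (y k))).prod

/-- The `N`-site matrix-product operator with bulk tensor `A` and boundary vectors `l`, `r`. -/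
def mpo {d D : ℕ} (A : Fin d → Fin d → Matrix (Fin D) (Fin D) ℂ) (l r : Fin D → ℂ) (N : ℕ) :
    Matrix (Fin N → Fin d) (Fin N → Fin d) ℂ :=
  fun x y => l ⬝ᵥ (Matrix.mulVec (bondProd A x y) r)

/-- `A`, `l`, `r` define a uniform-bulk MPU: the operator on `N` sites is unitary for all
`N ≥ 1`. -/
def IsUniformBulkMPU {d D : ℕ} (A : Fin d → Fin d → Matrix (Fin D) (Fin D) ℂ)
    (l r : Fin D → ℂ) : Prop :=
  ∀ N : ℕ, 1 ≤ N → mpo A l r N ∈ Matrix.unitaryGroup (Fin N → Fin d) ℂ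

/-- The tensor `A` contracted with the left boundary vector, as a matrix from the bond space
to the two physical indices. -/
def leftBoundaryTensor {d D : ℕ} (A : Fin d → Fin d → Matrix (Fin D) (Fin D) ℂ)
    (l : Fin D → ℂ) : Matrix (Fin d × Fin d) (Fin D) ℂ :=
  fun p a => Matrix.vecMul l (A p.1 p.2) a

/-- The tensor `A` contracted with the right boundary vector, as a matrix from the bond space
to the two physical indices. -/
def rightBoundaryTensor {d D : ℕ} (A : Fin d → Fin d → Matrix (Fin D) (Fin D) ℂ)
    (r : Fin D → ℂ) : Matrix (Fin d × Fin d) (Fin D) ℂ :=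
  fun p a => Matrix.mulVec (A p.1 p.2) r a

/-- The boundary-contracted tensors have full rank `D`. -/
def FullRankBoundaries {d D : ℕ} (A : Fin d → Fin d → Matrix (Fin D) (Fin D) ℂ)
    (l r : Fin D → ℂ) : Prop :=
  (leftBoundaryTensor A l).rank = D ∧ (rightBoundaryTensor A r).rank = D

/-- `σ` is a density operator on `m` qudits. -/
def IsDensity {d m : ℕ} (σ : Matrix (Fin m → Fin d) (Fin m → Fin d) ℂ) : Prop :=
  σ.PosSemidef ∧ σ.trace = 1

/-- The bond-space operator obtained from the left boundary and `m` sites of the doubled tensor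
network `A†A` by contracting the outputs and tracing the inputs against `σ`. The first index
belongs to the conjugate tensor. -/
noncomputable def leftEnv {d D : ℕ} (A : Fin d → Fin d → Matrix (Fin D) (Fin D) ℂ)
    (l : Fin D → ℂ) {m : ℕ} (σ : Matrix (Fin m → Fin d) (Fin m → Fin d) ℂ) :
    Matrix (Fin D) (Fin D) ℂ :=
  fun a' a => ∑ x : Fin m → Fin d, ∑ y : Fin m → Fin d, ∑ y' : Fin m → Fin d,
    σ y y' * (starRingEnd ℂ) (Matrix.vecMul l (bondProd A x y') a') *
      Matrix.vecMul l (bondProd A x y) a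

/-- The mirror image of `leftEnv`, with the right boundary vector. -/
noncomputable def rightEnv {d D : ℕ} (A : Fin d → Fin d → Matrix (Fin D) (Fin D) ℂ)
    (r : Fin D → ℂ) {m : ℕ} (τ : Matrix (Fin m → Fin d) (Fin m → Fin d) ℂ) :
    Matrix (Fin D) (Fin D) ℂ :=
  fun a' a => ∑ x : Fin m → Fin d, ∑ y : Fin m → Fin d, ∑ y' : Fin m → Fin d,
    τ y y' * (starRingEnd ℂ) (Matrix.mulVec (bondProd A x y') r a') *
      Matrix.mulVec (bondProd A x y) r a

/-- The set `𝓛` of admissible `L²`: positive-definite left environments, over all numbers of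
sites and all density operators. -/
def leftSet {d D : ℕ} (A : Fin d → Fin d → Matrix (Fin D) (Fin D) ℂ) (l : Fin D → ℂ) :
    Set (Matrix (Fin D) (Fin D) ℂ) :=
  {P | P.PosDef ∧ ∃ (m : ℕ) (σ : Matrix (Fin m → Fin d) (Fin m → Fin d) ℂ),
    IsDensity σ ∧ P = leftEnv A l σ}

/-- The set `𝓡` of admissible `R²`. -/
def rightSet {d D : ℕ} (A : Fin d → Fin d → Matrix (Fin D) (Fin D) ℂ) (r : Fin D → ℂ) :
    Set (Matrix (Fin D) (Fin D) ℂ) :=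
  {Q | Q.PosDef ∧ ∃ (m : ℕ) (τ : Matrix (Fin m → Fin d) (Fin m → Fin d) ℂ),
    IsDensity τ ∧ Q = rightEnv A r τ}

/-- All values `√(tr[R⁻² (L⁻²)ᵀ])` with `P = L² ∈ 𝓛` and `Q = R² ∈ 𝓡` (the trace is a
nonnegative real number). -/
def condValues {d D : ℕ} (A : Fin d → Fin d → Matrix (Fin D) (Fin D) ℂ) (l r : Fin D → ℂ) :
    Set ℝ :=
  {q | ∃ P ∈ leftSet A l, ∃ Q ∈ rightSet A r,
    q = Real.sqrt (Matrix.trace (Q⁻¹ * (P⁻¹).transpose)).re}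

/-- The conditioning number `q_unif` of a uniform-bulk MPU. -/
noncomputable def qUnif {d D : ℕ} (A : Fin d → Fin d → Matrix (Fin D) (Fin D) ℂ)
    (l r : Fin D → ℂ) : ℝ :=
  sInf (condValues A l r)

/-! The circuit is built by divide and conquer. Cutting the chain between two sites leaves a bond
index that runs over `D` values and must be summed. Instead, both halves are implemented as complete
unitaries of the same kind: the left half gets `m` extra sites at its right end, the right half gets
`m'` extra sites at its left end. The inputs of the extra sites are fed with purifications of `τ`
and `σ`. Their outputs, together with the purifiers, then carry vectors `ρ a` and `μ b` labelled by
the two open bonds, and the Gram matrices of these vectors are the environments `R²` and `L²`. If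
these are invertible, there is a vector `φ` with overlaps `δ a b` with `ρ a ⊗ μ b`
(`exists_dualVector`). Projecting onto the normalised `φ` reconnects the bond, with amplitude `q⁻¹`
where `q² = tr[R⁻²(L⁻²)ᵀ]` (`merge_sum_eq`, `Encodes.merge`, `exists_merge_cost`).

The projection is not deterministic, so everything is phrased through block encodings `s • U`, the
success condition being that certain flag qudits return to zero. As `U` is unitary and the amplitude
does not depend on the input state, amplitude amplification turns `sin θ` into `sin ((2k+1)θ)` using
`2k+1` calls (`amplify_pow_mul`, `Encodes.amplify`). An additional flag lowers an amplitude to any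
smaller value (`HasEncoding.dilute`), so that amplitude exactly one can be reached. An encoding of
amplitude one returns its flags to zero (`Encodes.apply_of_unitary`), so they may be treated as
clean from then on; the number of flags to be reflected about therefore stays bounded.

The exponent `1 + log₂ q_unif` allows a factor `2 q_unif` for each doubling of the size. The number
of calls is an odd integer and the infimum need not be attained, so a single level may exceed this
allowance. Two levels are therefore treated together: the inner merges are amplified without
reaching amplitude one, only the outer merge is completed, and the product of the two odd numbers is
at most `4 q_unif²` (`exists_rounds`, `exists_quadruple`). This uses `q_unif ≥ D ≥ 2`, which is
Cauchy–Schwarz applied to `φ` and the unit vector `∑ ρ a ⊗ μ a` (`card_le_of_overlap`). Solving the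
resulting four-part recursion (`exists_bound_of_recursion`) gives the depth and the linear number of
auxiliary qudits. For `D = 1` merging already has amplitude one, and the sites are attached one by
one.

Operations of fixed size, and the base cases, use the universality of two-qudit gates
(`implementable_of_unitary`), proved by Givens elimination together with commutators of controlled
gates. -/

set_option linter.unusedSectionVars false

/-! ### Operators acting on a sub-register -/

/-- Operators on a register of qudits labelled by `ι`. -/
abbrev RegOp (ι : Type) (d : ℕ) := Matrix (ι → Fin d) (ι → Fin d) ℂ

open Classical in
/-- The operator `M` on the sub-register `e : κ ↪ ι`, tensored with the identity elsewhere. -/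
noncomputable def embedOp {ι κ : Type} {d : ℕ} (e : κ ↪ ι) (M : RegOp κ d) : RegOp ι d :=
  fun x y => if ∀ i, i ∉ Set.range e → x i = y i then M (x ∘ e) (y ∘ e) else 0

section EmbedOp

variable {ι κ μ : Type} {d : ℕ}

open Classical in
lemma embedOp_apply (e : κ ↪ ι) (M : RegOp κ d) (x y : ι → Fin d) :
    embedOp e M x y =
      if ∀ i, i ∉ Set.range e → x i = y i then M (x ∘ e) (y ∘ e) else 0 := rfl

lemma extend_comp_embedding (e : κ ↪ ι) (k : κ → Fin d) (x : ι → Fin d) :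
    Function.extend e k x ∘ e = k :=
  funext fun i => e.injective.extend_apply k x i

lemma extend_injective (e : κ ↪ ι) (x : ι → Fin d) :
    Function.Injective fun k : κ → Fin d => Function.extend e k x := fun k k' h => by
  have := congrArg (· ∘ e) h
  simpa [extend_comp_embedding] using this

lemma extend_eq_of_agree (e : κ ↪ ι) {x y : ι → Fin d}
    (h : ∀ i, i ∉ Set.range e → x i = y i) : Function.extend e (y ∘ e) x = y := by
  funext i
  by_cases hi : i ∈ Set.range e
  · obtain ⟨k, rfl⟩ := hi
    simp [e.injective.extend_apply]
  · rw [Function.extend_apply' _ _ _ (by simpa using hi), h i hi]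

lemma embedOp_extend (e : κ ↪ ι) (M : RegOp κ d) (x : ι → Fin d) (k : κ → Fin d) :
    embedOp e M x (Function.extend e k x) = M (x ∘ e) k := by
  unfold embedOp
  rw [if_pos, extend_comp_embedding]
  intro i hi
  rw [Function.extend_apply' _ _ _ (by simpa using hi)]

lemma embedOp_conjTranspose (e : κ ↪ ι) (M : RegOp κ d) :
    (embedOp e M).conjTranspose = embedOp e M.conjTranspose := by
  ext x y
  have : (∀ i, i ∉ Set.range e → x i = y i) ↔ (∀ i, i ∉ Set.range e → y i = x i) :=
    forall₂_congr fun _ _ => eq_comm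
  rw [Matrix.conjTranspose_apply, embedOp_apply, embedOp_apply, Matrix.conjTranspose_apply]
  by_cases h : ∀ i, i ∉ Set.range e → x i = y i
  · rw [if_pos h, if_pos (this.1 h)]
  · rw [if_neg h, if_neg (mt this.2 h), star_zero]

variable [Fintype ι] [DecidableEq ι] [Fintype κ] [DecidableEq κ] [Fintype μ] [DecidableEq μ]

/-- Row `x` of `embedOp e M` is supported on the configurations `Function.extend e k x`, so the sum
over the large register collapses to one over the small register. -/
lemma embedOp_mul_apply (e : κ ↪ ι) (M : RegOp κ d) (B : RegOp ι d) (x y : ι → Fin d) :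
    (embedOp e M * B) x y = ∑ k, M (x ∘ e) k * B (Function.extend e k x) y := by
  rw [Matrix.mul_apply]
  symm
  refine Fintype.sum_of_injective _ (extend_injective e x) _ _ ?_ ?_
  · intro w hw
    unfold embedOp
    rw [if_neg, zero_mul]
    intro h
    exact hw ⟨w ∘ e, extend_eq_of_agree e h⟩
  · intro k
    simp only [embedOp_extend]

lemma mul_embedOp_apply (e : κ ↪ ι) (M : RegOp κ d) (B : RegOp ι d) (x y : ι → Fin d) :
    (B * embedOp e M) x y = ∑ k, B x (Function.extend e k y) * M k (y ∘ e) := by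
  have h := congrArg star (embedOp_mul_apply e M.conjTranspose B.conjTranspose y x)
  rw [← embedOp_conjTranspose, ← Matrix.conjTranspose_mul] at h
  simpa [mul_comm] using h

lemma embedOp_mul (e : κ ↪ ι) (M N : RegOp κ d) :
    embedOp e M * embedOp e N = embedOp e (M * N) := by
  ext x y
  rw [embedOp_mul_apply]
  simp only [embedOp_apply, extend_comp_embedding]
  have : ∀ k : κ → Fin d, (∀ i, i ∉ Set.range e → Function.extend e k x i = y i) ↔
      (∀ i, i ∉ Set.range e → x i = y i) := fun k =>
    forall₂_congr fun i hi => by rw [Function.extend_apply' _ _ _ (by simpa using hi)]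
  simp only [this]
  split_ifs
  · rw [Matrix.mul_apply]
  · simp

omit [Fintype ι] [DecidableEq ι] [Fintype κ] [DecidableEq κ] in
lemma agree_iff (e : κ ↪ ι) (x y : ι → Fin d) :
    x = y ↔ (∀ i, i ∉ Set.range e → x i = y i) ∧ x ∘ e = y ∘ e := by
  constructor
  · rintro rfl
    simp
  · rintro ⟨h1, h2⟩
    funext i
    by_cases hi : i ∈ Set.range e
    · obtain ⟨k, rfl⟩ := hi
      exact congrFun h2 k
    · exact h1 i hi

lemma embedOp_one (e : κ ↪ ι) : embedOp e (1 : RegOp κ d) = 1 := by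
  ext x y
  rw [embedOp_apply, Matrix.one_apply, Matrix.one_apply]
  by_cases h : ∀ i, i ∉ Set.range e → x i = y i
  · rw [if_pos h]
    by_cases h' : x ∘ e = y ∘ e
    · rw [if_pos h', if_pos ((agree_iff e x y).2 ⟨h, h'⟩)]
    · rw [if_neg h', if_neg fun h'' => h' ((agree_iff e x y).1 h'').2]
  · rw [if_neg h, if_neg fun h' => h ((agree_iff e x y).1 h').1]

omit [Fintype ι] [DecidableEq ι] [Fintype κ] [DecidableEq κ] [Fintype μ] [DecidableEq μ] in
lemma embedOp_embedOp (e : κ ↪ ι) (f : μ ↪ κ) (M : RegOp μ d) :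
    embedOp e (embedOp f M) = embedOp (f.trans e) M := by
  ext x y
  simp only [embedOp_apply]
  by_cases h : ∀ i, i ∉ Set.range (f.trans e) → x i = y i
  · rw [if_pos h, if_pos, if_pos]
    · rfl
    · intro i hi
      refine h (e i) ?_
      rintro ⟨j, hj⟩
      exact hi ⟨j, e.injective hj⟩
    · intro i hi
      refine h i ?_
      rintro ⟨j, hj⟩
      exact hi ⟨f j, hj⟩
  · rw [if_neg h]
    split_ifs with h1 h2
    · exfalso
      apply h
      intro i hi
      by_cases hi' : i ∈ Set.range e
      · obtain ⟨k, rfl⟩ := hi'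
        refine h2 k ?_
        rintro ⟨j, rfl⟩
        exact hi ⟨j, rfl⟩
      · exact h1 i hi'
    · rfl
    · rfl

open Classical in
omit [DecidableEq μ] in
lemma embedOp_mul_embedOp_apply (e : κ ↪ ι) (f : μ ↪ ι)
    (hef : Disjoint (Set.range e) (Set.range f)) (M : RegOp κ d) (N : RegOp μ d)
    (x y : ι → Fin d) :
    (embedOp e M * embedOp f N) x y =
      if ∀ i, i ∉ Set.range e → i ∉ Set.range f → x i = y i then
        M (x ∘ e) (y ∘ e) * N (x ∘ f) (y ∘ f) else 0 := by
  rw [embedOp_mul_apply]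
  have hf : ∀ k, Function.extend e k x ∘ f = x ∘ f := fun k => funext fun j =>
    Function.extend_apply' _ _ _ (by
      rintro ⟨i, hi⟩
      exact Set.disjoint_left.1 hef ⟨i, rfl⟩ ⟨j, hi.symm⟩)
  -- The second factor leaves the range of `e` untouched, so the intermediate configuration must
  -- already agree with `y` there.
  rw [Finset.sum_eq_single (y ∘ e)]
  · simp only [embedOp_apply, hf]
    rw [mul_ite, mul_zero]
    refine if_congr ⟨fun h i hi hi' => ?_, fun h i hi => ?_⟩ rfl rfl
    · rw [← h i hi', Function.extend_apply' _ _ _ (by simpa using hi)]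
    · by_cases hi' : i ∈ Set.range e
      · obtain ⟨k, rfl⟩ := hi'
        rw [e.injective.extend_apply]
        rfl
      · rw [Function.extend_apply' _ _ _ (by simpa using hi'), h i hi' hi]
  · intro k _ hk
    rw [embedOp, if_neg, mul_zero]
    intro h
    apply hk
    funext i
    have := h (e i) (fun hi => Set.disjoint_left.1 hef ⟨i, rfl⟩ hi)
    rwa [e.injective.extend_apply] at this
  · simp

lemma embedOp_commute (e : κ ↪ ι) (f : μ ↪ ι)
    (hef : Disjoint (Set.range e) (Set.range f)) (M : RegOp κ d) (N : RegOp μ d) :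
    Commute (embedOp e M) (embedOp f N) := by
  ext x y
  rw [embedOp_mul_embedOp_apply e f hef, embedOp_mul_embedOp_apply f e hef.symm]
  have : (∀ i, i ∉ Set.range e → i ∉ Set.range f → x i = y i) ↔
      (∀ i, i ∉ Set.range f → i ∉ Set.range e → x i = y i) :=
    ⟨fun h i a b => h i b a, fun h i a b => h i b a⟩
  simp only [this, mul_comm]

lemma embedOp_unitary (e : κ ↪ ι) {M : RegOp κ d}
    (h : M ∈ Matrix.unitaryGroup (κ → Fin d) ℂ) :
    embedOp e M ∈ Matrix.unitaryGroup (ι → Fin d) ℂ := by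
  rw [Matrix.mem_unitaryGroup_iff'] at h ⊢
  rw [Matrix.star_eq_conjTranspose] at h ⊢
  rw [embedOp_conjTranspose, embedOp_mul, h, embedOp_one]

end EmbedOp

/-! ### Gates, layers and circuits -/

section Circuits

variable {ι κ μ : Type} {d : ℕ}
  [Fintype ι] [DecidableEq ι] [Fintype κ] [DecidableEq κ] [Fintype μ] [DecidableEq μ]

lemma QuditGate.op_eq_embedOp (g : QuditGate ι d) :
    g.op = embedOp (Function.Embedding.subtype (· ∈ g.support)) g.mat := by
  ext x y
  rw [embedOp_apply]
  by_cases h : ∀ k, k ∉ g.support → x k = y k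
  · rw [QuditGate.op, if_pos h, if_pos (by simpa using h)]
    rfl
  · rw [QuditGate.op, if_neg h, if_neg (by simpa using h)]

lemma exists_gate (e : κ ↪ ι) (hκ : Fintype.card κ ≤ 2) {M : RegOp κ d}
    (hM : M ∈ Matrix.unitaryGroup (κ → Fin d) ℂ) :
    ∃ g : QuditGate ι d, g.op = embedOp e M ∧ g.support = Finset.univ.map e := by
  let E : κ ≃ (Finset.univ.map e : Finset ι) :=
    Equiv.ofBijective (fun k => ⟨e k, by simp⟩)
      ⟨fun a b h => e.injective (by simpa using h), fun ⟨i, hi⟩ => by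
        obtain ⟨k, -, hk⟩ := Finset.mem_map.1 hi
        exact ⟨k, Subtype.ext hk⟩⟩
  refine ⟨⟨Finset.univ.map e, by simpa using hκ, embedOp E.toEmbedding M,
    embedOp_unitary _ hM⟩, ?_, rfl⟩
  rw [QuditGate.op_eq_embedOp, embedOp_embedOp]
  rfl

lemma QuditGate.exists_embed (e : κ ↪ ι) (g : QuditGate κ d) :
    ∃ g' : QuditGate ι d, g'.op = embedOp e g.op ∧ g'.support = g.support.map e := by
  obtain ⟨g', h1, h2⟩ := exists_gate
    ((Function.Embedding.subtype (· ∈ g.support)).trans e) (by simpa using g.card_le) g.unitary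
  refine ⟨g', ?_, ?_⟩
  · rw [h1, QuditGate.op_eq_embedOp, embedOp_embedOp]
  · rw [h2]
    ext i
    simp

/-- `M` is the operator of a single circuit layer whose gates act inside `S`. -/
def IsLayerOn (S : Set ι) (M : RegOp ι d) : Prop :=
  ∃ L : CircuitLayer ι d, L.op = M ∧ ∀ g ∈ L.gates, (g.support : Set ι) ⊆ S

lemma IsLayerOn.one (S : Set ι) : IsLayerOn S (1 : RegOp ι d) :=
  ⟨⟨[], List.Pairwise.nil⟩, by simp [CircuitLayer.op], by simp⟩

lemma exists_gates_embed (e : κ ↪ ι) (l : List (QuditGate κ d))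
    (hl : l.Pairwise fun g h => Disjoint g.support h.support) :
    ∃ l' : List (QuditGate ι d), l'.Pairwise (fun g h => Disjoint g.support h.support) ∧
      (l'.map QuditGate.op).prod = embedOp e (l.map QuditGate.op).prod ∧
      ∀ g' ∈ l', ∃ g ∈ l, g'.support = g.support.map e := by
  induction l with
  | nil => exact ⟨[], by simp, by simp [embedOp_one], by simp⟩
  | cons g l ih =>
    obtain ⟨h1, h2⟩ := List.pairwise_cons.1 hl
    obtain ⟨l', hp, ho, hs⟩ := ih h2
    obtain ⟨g', hg1, hg2⟩ := g.exists_embed e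
    refine ⟨g' :: l', List.pairwise_cons.2 ⟨fun k hk => ?_, hp⟩, ?_, ?_⟩
    · obtain ⟨k', hk', hk2⟩ := hs k hk
      rw [hg2, hk2, Finset.disjoint_map]
      exact h1 k' hk'
    · rw [List.map_cons, List.prod_cons, List.map_cons, List.prod_cons, ho, hg1, embedOp_mul]
    · intro k hk
      rcases List.mem_cons.1 hk with rfl | hk
      · exact ⟨g, by simp, hg2⟩
      · obtain ⟨k', hk', hk2⟩ := hs k hk
        exact ⟨k', by simp [hk'], hk2⟩

lemma IsLayerOn.embed (e : κ ↪ ι) {M : RegOp κ d} (h : IsLayerOn Set.univ M) :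
    IsLayerOn (Set.range e) (embedOp e M) := by
  obtain ⟨⟨l, hl⟩, rfl, -⟩ := h
  obtain ⟨l', hp, ho, hs⟩ := exists_gates_embed e l hl
  refine ⟨⟨l', hp⟩, ho, fun g hg => ?_⟩
  obtain ⟨g', -, h⟩ := hs g hg
  rw [h]
  simp

lemma IsLayerOn.mul {S S' : Set ι} (hS : Disjoint S S') {M M' : RegOp ι d}
    (h : IsLayerOn S M) (h' : IsLayerOn S' M') : IsLayerOn Set.univ (M * M') := by
  obtain ⟨L, rfl, hL⟩ := h
  obtain ⟨L', rfl, hL'⟩ := h'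
  refine ⟨⟨L.gates ++ L'.gates, List.pairwise_append.2 ⟨L.disjoint, L'.disjoint, ?_⟩⟩,
    by simp [CircuitLayer.op], by simp⟩
  intro g hg g' hg'
  rw [← Finset.disjoint_coe]
  exact Set.disjoint_of_subset (hL g hg) (hL' g' hg') hS

lemma IsLayerOn.of_gate (g : QuditGate ι d) : IsLayerOn Set.univ g.op :=
  ⟨⟨[g], by simp⟩, by simp [CircuitLayer.op], by simp⟩

lemma QuditGate.exists_star (g : QuditGate ι d) :
    ∃ g' : QuditGate ι d, g'.op = g.op.conjTranspose ∧ g'.support = g.support := by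
  refine ⟨⟨g.support, g.card_le, g.mat.conjTranspose, ?_⟩, ?_, rfl⟩
  · exact Unitary.star_mem g.unitary
  · rw [QuditGate.op_eq_embedOp, QuditGate.op_eq_embedOp, embedOp_conjTranspose]

lemma exists_gates_star (l : List (QuditGate ι d))
    (hl : l.Pairwise fun g h => Disjoint g.support h.support) :
    ∃ l' : List (QuditGate ι d), l'.Pairwise (fun g h => Disjoint g.support h.support) ∧
      (l'.map QuditGate.op).prod = (l.map QuditGate.op).prod.conjTranspose ∧
      ∀ g' ∈ l', ∃ g ∈ l, g'.support = g.support := by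
  induction l with
  | nil => exact ⟨[], by simp, by simp, by simp⟩
  | cons g l ih =>
    obtain ⟨h1, h2⟩ := List.pairwise_cons.1 hl
    obtain ⟨l', hp, ho, hs⟩ := ih h2
    obtain ⟨g', hg1, hg2⟩ := g.exists_star
    refine ⟨l' ++ [g'], List.pairwise_append.2 ⟨hp, by simp, fun k hk k' hk' => ?_⟩, ?_, ?_⟩
    · obtain rfl := List.mem_singleton.1 hk'
      obtain ⟨k', hk', hk2⟩ := hs k hk
      rw [hg2, hk2]
      exact (h1 k' hk').symm
    · simp [ho, hg1, Matrix.conjTranspose_mul]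
    · intro k hk
      rcases List.mem_append.1 hk with hk | hk
      · obtain ⟨k', hk', hk2⟩ := hs k hk
        exact ⟨k', by simp [hk'], hk2⟩
      · obtain rfl := List.mem_singleton.1 hk
        exact ⟨g, by simp, hg2⟩

lemma IsLayerOn.star {M : RegOp ι d} (h : IsLayerOn Set.univ M) :
    IsLayerOn Set.univ M.conjTranspose := by
  obtain ⟨⟨l, hl⟩, rfl, -⟩ := h
  obtain ⟨l', hp, ho, hs⟩ := exists_gates_star l hl
  exact ⟨⟨l', hp⟩, ho, by simp⟩

lemma IsLayerOn.unitary {S : Set ι} {M : RegOp ι d} (h : IsLayerOn S M) :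
    M ∈ Matrix.unitaryGroup (ι → Fin d) ℂ := by
  obtain ⟨⟨l, hl⟩, rfl, -⟩ := h
  refine Submonoid.list_prod_mem _ fun M hM => ?_
  obtain ⟨g, -, rfl⟩ := List.mem_map.1 hM
  rw [QuditGate.op_eq_embedOp]
  exact embedOp_unitary _ g.unitary

/-- `M` is the operator of a circuit of depth `T`. -/
inductive CircuitOp : ℕ → RegOp ι d → Prop
  | one : CircuitOp 0 1
  | step {T : ℕ} {L M : RegOp ι d} (hL : IsLayerOn Set.univ L) (hM : CircuitOp T M) :
      CircuitOp (T + 1) (L * M)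

namespace CircuitOp

lemma exists_circuit {T : ℕ} {M : RegOp ι d} (h : CircuitOp T M) :
    ∃ C : QuditCircuit ι d, C.op = M ∧ C.depth = T := by
  induction h with
  | one => exact ⟨⟨[]⟩, by simp [QuditCircuit.op], rfl⟩
  | step hL _ ih =>
    obtain ⟨⟨Ls⟩, rfl, rfl⟩ := ih
    obtain ⟨L, rfl, -⟩ := hL
    exact ⟨⟨Ls ++ [L]⟩, by simp [QuditCircuit.op], by simp [QuditCircuit.depth]⟩

lemma mul {T T' : ℕ} {M M' : RegOp ι d} (h : CircuitOp T M) (h' : CircuitOp T' M') :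
    CircuitOp (T + T') (M * M') := by
  induction h with
  | one => simpa using h'
  | step hL _ ih =>
    rw [mul_assoc, Nat.succ_add]
    exact step hL ih

lemma of_layer {M : RegOp ι d} (h : IsLayerOn Set.univ M) : CircuitOp 1 M := by
  simpa using step h one

lemma of_embedOp (e : κ ↪ ι) (hκ : Fintype.card κ ≤ 2) {M : RegOp κ d}
    (hM : M ∈ Matrix.unitaryGroup (κ → Fin d) ℂ) : CircuitOp 1 (embedOp e M) := by
  obtain ⟨g, hg, -⟩ := exists_gate e hκ hM
  rw [← hg]
  exact of_layer (IsLayerOn.of_gate g)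

/-- Empty layers pad a circuit. This lets depth bounds be treated as depths, and equalises two
depths before `par`. -/
lemma mono {T T' : ℕ} {M : RegOp ι d} (h : CircuitOp T M) (hT : T ≤ T') : CircuitOp T' M := by
  induction hT with
  | refl => exact h
  | step _ ih => simpa using step (IsLayerOn.one _) ih

lemma star {T : ℕ} {M : RegOp ι d} (h : CircuitOp T M) : CircuitOp T M.conjTranspose := by
  induction h with
  | one => simpa using one
  | step hL _ ih =>
    rw [Matrix.conjTranspose_mul]
    exact ih.mul (of_layer hL.star)

lemma unitary {T : ℕ} {M : RegOp ι d} (h : CircuitOp T M) :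
    M ∈ Matrix.unitaryGroup (ι → Fin d) ℂ := by
  induction h with
  | one => exact one_mem _
  | step hL _ ih => exact mul_mem hL.unitary ih

lemma isLayerOn_univ_of {S : Set ι} {M : RegOp ι d} (h : IsLayerOn S M) :
    IsLayerOn Set.univ M := by
  obtain ⟨L, rfl, -⟩ := h
  exact ⟨L, rfl, by simp⟩

lemma embed (e : κ ↪ ι) {T : ℕ} {M : RegOp κ d} (h : CircuitOp T M) :
    CircuitOp T (embedOp e M) := by
  induction h with
  | one => simpa [embedOp_one] using one
  | step hL _ ih =>
    rw [← embedOp_mul]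
    exact step (isLayerOn_univ_of (hL.embed e)) ih

/-- Operators on disjoint registers commute, so the two circuits can be interleaved and their layers
united in pairs. Depth is thus shared and not added, which is what makes divide and conquer pay off.
-/
lemma par (e : κ ↪ ι) (f : μ ↪ ι) (hef : Disjoint (Set.range e) (Set.range f)) {T : ℕ}
    {M : RegOp κ d} {N : RegOp μ d} (hM : CircuitOp T M) (hN : CircuitOp T N) :
    CircuitOp T (embedOp e M * embedOp f N) := by
  induction hM generalizing N with
  | one =>
    rw [embedOp_one, one_mul]
    exact hN.embed f
  | @step T L M hL hM ih =>
    cases hN with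
    | @step _ L' N' hL' hN' =>
      rw [← embedOp_mul, ← embedOp_mul, mul_assoc, ← mul_assoc (embedOp e M),
        (embedOp_commute e f hef M L').eq, mul_assoc, ← mul_assoc]
      exact step ((hL.embed e).mul hef (hL'.embed f)) (ih hN')

lemma pow {T : ℕ} {M : RegOp ι d} (h : CircuitOp T M) (k : ℕ) : CircuitOp (k * T) (M ^ k) := by
  induction k with
  | zero => simpa using one
  | succ k ih =>
    rw [pow_succ, Nat.succ_mul]
    exact ih.mul h

end CircuitOp

end Circuits

/-! ### Two-level unitaries -/


section TwoLevel

variable {X : Type} [Fintype X] [DecidableEq X]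

/-- The element of `SU(2)` with first column `(a, b)`. -/
noncomputable def suMat (a b : ℂ) : Matrix (Fin 2) (Fin 2) ℂ :=
  !![a, -star b; b, star a]

lemma suMat_mul (a b a' b' : ℂ) :
    suMat a b * suMat a' b' = suMat (a * a' - star b * b') (b * a' + star a * b') := by
  ext i j
  fin_cases i <;> fin_cases j <;> simp [suMat, Matrix.mul_apply, Fin.sum_univ_two] <;> ring

lemma suMat_conjTranspose (a b : ℂ) : (suMat a b).conjTranspose = suMat (star a) (-b) := by
  ext i j
  fin_cases i <;> fin_cases j <;> simp [suMat]

lemma suMat_one : suMat 1 0 = 1 := by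
  ext i j
  fin_cases i <;> fin_cases j <;> simp [suMat]

lemma suMat_mul_conjTranspose {a b : ℂ} (h : star a * a + star b * b = 1) :
    suMat a b * (suMat a b).conjTranspose = 1 := by
  rw [suMat_conjTranspose, suMat_mul, ← suMat_one]
  congr 1
  · rw [← h]; ring
  · ring

/-- The operator `M` on the range of the isometry `V`, extended by the identity. -/
noncomputable def isoExtend (V : Matrix X (Fin 2) ℂ) (M : Matrix (Fin 2) (Fin 2) ℂ) :
    Matrix X X ℂ := 1 + V * (M - 1) * V.conjTranspose

lemma isoExtend_mul {V : Matrix X (Fin 2) ℂ} (hV : V.conjTranspose * V = 1)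
    (M N : Matrix (Fin 2) (Fin 2) ℂ) :
    isoExtend V M * isoExtend V N = isoExtend V (M * N) := by
  have h : V * (M - 1) * V.conjTranspose * (V * (N - 1) * V.conjTranspose) =
      V * ((M - 1) * (N - 1)) * V.conjTranspose := by
    calc _ = V * (M - 1) * (V.conjTranspose * V) * (N - 1) * V.conjTranspose := by
          simp only [Matrix.mul_assoc]
      _ = _ := by rw [hV]; simp only [Matrix.mul_assoc, Matrix.one_mul]
  simp only [isoExtend]
  rw [mul_add, add_mul, add_mul, h, one_mul, mul_one, one_mul, add_assoc, ← Matrix.add_mul,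
    ← Matrix.add_mul, ← Matrix.mul_add, ← Matrix.mul_add]
  congr 4
  noncomm_ring

lemma isoExtend_conjTranspose (V : Matrix X (Fin 2) ℂ) (M : Matrix (Fin 2) (Fin 2) ℂ) :
    (isoExtend V M).conjTranspose = isoExtend V M.conjTranspose := by
  simp [isoExtend, Matrix.mul_assoc]

lemma isoExtend_one (V : Matrix X (Fin 2) ℂ) : isoExtend V 1 = 1 := by
  simp [isoExtend]

lemma conj_isoExtend {g : Matrix X X ℂ} (hg : g * g.conjTranspose = 1)
    (V : Matrix X (Fin 2) ℂ) (M : Matrix (Fin 2) (Fin 2) ℂ) :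
    g * isoExtend V M * g.conjTranspose = isoExtend (g * V) M := by
  simp [isoExtend, mul_add, add_mul, hg, Matrix.mul_assoc]

/-- The isometry onto the span of two basis vectors. -/
def pairIso (x y : X) : Matrix X (Fin 2) ℂ :=
  Matrix.of fun z i => if z = ![x, y] i then 1 else 0

lemma pairIso_isometry {x y : X} (h : x ≠ y) :
    (pairIso x y).conjTranspose * pairIso x y = 1 := by
  have h0 : ∀ z, pairIso x y z 0 = if z = x then 1 else 0 := fun _ => rfl
  have h1 : ∀ z, pairIso x y z 1 = if z = y then 1 else 0 := fun _ => rfl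
  ext i j
  rw [Matrix.mul_apply]
  revert i j
  simp [Fin.forall_fin_two, h0, h1, h, h.symm]

lemma isoExtend_pairIso_apply (x y : X) (M : Matrix (Fin 2) (Fin 2) ℂ) (z w : X) :
    isoExtend (pairIso x y) M z w = (1 : Matrix X X ℂ) z w +
      ∑ i, ∑ j, pairIso x y z i * (M - 1) i j * pairIso x y w j := by
  have hr : ∀ j, star (pairIso x y w j) = pairIso x y w j := fun j => by
    simp only [pairIso, Matrix.of_apply]; split_ifs <;> simp
  rw [isoExtend, Matrix.add_apply, Matrix.mul_apply]
  simp only [Matrix.mul_apply, Matrix.conjTranspose_apply, hr, Finset.sum_mul]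
  rw [Finset.sum_comm]

lemma isoExtend_pairIso_mul_apply {x y : X} (h : x ≠ y) (M : Matrix (Fin 2) (Fin 2) ℂ)
    {Y : Type} (U : Matrix X Y ℂ) (z : X) (w : Y) :
    (isoExtend (pairIso x y) M * U) z w =
      if z = x then M 0 0 * U x w + M 0 1 * U y w
      else if z = y then M 1 0 * U x w + M 1 1 * U y w else U z w := by
  have key : (isoExtend (pairIso x y) M * U) z w = U z w +
      ∑ i, ∑ j, pairIso x y z i * (M - 1) i j * U (![x, y] j) w := by
    rw [Matrix.mul_apply]
    simp only [isoExtend_pairIso_apply, add_mul, Finset.sum_add_distrib]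
    congr 1
    · simp [Matrix.one_apply]
    · simp only [Finset.sum_mul]
      rw [Finset.sum_comm]
      refine Finset.sum_congr rfl fun i _ => ?_
      rw [Finset.sum_comm]
      refine Finset.sum_congr rfl fun j _ => ?_
      simp [pairIso]
  rw [key]
  simp only [Fin.sum_univ_two, pairIso, Matrix.of_apply, Matrix.sub_apply, Matrix.cons_val_zero,
    Matrix.cons_val_one]
  by_cases h1 : z = x
  · subst h1
    simp [h]; ring
  · by_cases h2 : z = y
    · subst h2
      simp [h1]; ring
    · simp [h1, h2]

/-- A family of unitaries closed under products and adjoints. -/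
structure IsStarClosed (G : Matrix X X ℂ → Prop) : Prop where
  unitary : ∀ {M}, G M → M.conjTranspose * M = 1
  mul : ∀ {M N}, G M → G N → G (M * N)
  adj : ∀ {M}, G M → G M.conjTranspose
  scalar : ∀ {ζ : ℂ}, star ζ * ζ = 1 → G (ζ • (1 : Matrix X X ℂ))

/-- All `SU(2)` operators on the span of the basis vectors `x`, `y` belong to `G`. -/
def ContainsPair (G : Matrix X X ℂ → Prop) (x y : X) : Prop :=
  ∀ a b : ℂ, star a * a + star b * b = 1 → G (isoExtend (pairIso x y) (suMat a b))

lemma IsStarClosed.one {G : Matrix X X ℂ → Prop} (hG : IsStarClosed G) : G 1 := by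
  simpa using hG.scalar (ζ := 1) (by simp)

lemma IsStarClosed.unitary' {G : Matrix X X ℂ → Prop} (hG : IsStarClosed G) {M : Matrix X X ℂ}
    (h : G M) : M * M.conjTranspose = 1 := by
  simpa using hG.unitary (hG.adj h)

/-- The rotation `suMat 0 1` on the pair `y`, `z` sends the basis vector `y` to `z` and fixes `x`;
conjugating with it carries the pair `x`, `y` to the pair `x`, `z`. -/
lemma ContainsPair.trans {G : Matrix X X ℂ → Prop} (hG : IsStarClosed G) {x y z : X}
    (hxy : ContainsPair G x y) (hyz : ContainsPair G y z) (h1 : x ≠ y) (h2 : y ≠ z)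
    (h3 : x ≠ z) : ContainsPair G x z := by
  intro a b hab
  have hg := hyz 0 1 (by simp)
  have : pairIso x z = isoExtend (pairIso y z) (suMat 0 1) * pairIso x y := by
    ext w i
    rw [isoExtend_pairIso_mul_apply h2]
    by_cases hw : w = y
    · subst hw
      fin_cases i <;> simp [pairIso, suMat, h1.symm, h2, h2.symm, h3.symm]
    · by_cases hw' : w = z
      · subst hw'
        fin_cases i <;> simp [pairIso, suMat, h1.symm, hw, h3.symm]
      · rw [if_neg hw, if_neg hw']
        fin_cases i
        · rfl
        · simp [pairIso, hw, hw']
  rw [this, ← conj_isoExtend (hG.unitary' hg)]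
  exact hG.mul (hG.mul hg (hxy a b hab)) (hG.adj hg)

variable {G : Matrix X X ℂ → Prop}

lemma isoExtend_pairIso_diagonal {x y : X} (h : x ≠ y) (ζ : ℂ) :
    isoExtend (pairIso x y) (suMat ζ 0) =
      Matrix.diagonal (Pi.mulSingle x ζ * Pi.mulSingle y (star ζ)) := by
  have := isoExtend_pairIso_mul_apply h (suMat ζ 0) (1 : Matrix X X ℂ)
  ext z w
  rw [mul_one] at this
  rw [this]
  by_cases h1 : z = x
  · subst h1
    by_cases h2 : z = w
    · subst h2
      simp [suMat, Pi.mulSingle_eq_of_ne h]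
    · simp [suMat, h2]
  · by_cases h3 : z = y
    · subst h3
      by_cases h2 : z = w
      · subst h2
        simp [suMat, h1]
      · simp [suMat, h1, h2]
    · simp [h1, h3, Matrix.diagonal, Matrix.one_apply, Pi.mulSingle_eq_of_ne]

lemma exists_root_of_unit {ω : ℂ} (h : star ω * ω = 1) {n : ℕ} (hn : n ≠ 0) :
    ∃ ζ : ℂ, ζ ^ n = ω ∧ star ζ * ζ = 1 := by
  have hw : ‖ω‖ = 1 := by
    have h1 : ‖star ω * ω‖ = 1 := by rw [h]; simp
    rw [norm_mul, norm_star] at h1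
    nlinarith [norm_nonneg ω]
  refine ⟨Complex.exp ((ω.arg / n : ℝ) * Complex.I), ?_, ?_⟩
  · rw [← Complex.exp_nat_mul]
    have : (n : ℂ) * (((ω.arg / n : ℝ) : ℂ) * Complex.I) = ω.arg * Complex.I := by
      have : (n : ℂ) ≠ 0 := by exact_mod_cast hn
      push_cast
      field_simp
    rw [this]
    have := Complex.norm_mul_exp_arg_mul_I ω
    rwa [hw, Complex.ofReal_one, one_mul] at this
  · have := Complex.norm_exp_ofReal_mul_I (ω.arg / n)
    rw [Complex.star_def, mul_comm, Complex.mul_conj, Complex.normSq_eq_norm_sq, this]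
    simp

/-- The two-level operators have determinant one, so the determinant has to come from a global
phase. With `n` the cardinality of `X` and `ζ ^ n = ω`, multiply the scalar `ζ` by the operators
with `ζ` at `x` and `star ζ` at `y`, for all `y ≠ x`: the entry at `x` becomes `ζ ^ n` and all
others become one. -/
lemma diagonal_mulSingle_mem (hG : IsStarClosed G) (hp : ∀ x y, x ≠ y → ContainsPair G x y)
    (x : X) {ω : ℂ} (hω : star ω * ω = 1) : G (Matrix.diagonal (Pi.mulSingle x ω)) := by
  have hn : Fintype.card X ≠ 0 := (Fintype.card_pos_iff.2 ⟨x⟩).ne'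
  obtain ⟨ζ, hζ, hu⟩ := exists_root_of_unit hω hn
  let H : Submonoid (X → ℂ) :=
    { carrier := {f | G (Matrix.diagonal f)}
      one_mem' := by
        change G (Matrix.diagonal 1)
        have := hG.one
        rwa [← Matrix.diagonal_one] at this
      mul_mem' := fun {f g} hf hg => by
        change G (Matrix.diagonal (f * g))
        have := hG.mul hf hg
        rw [Matrix.diagonal_mul_diagonal] at this
        exact this }
  have hprod : (∏ y ∈ Finset.univ.erase x, (Pi.mulSingle x ζ * Pi.mulSingle y (star ζ) : X → ℂ))
      ∈ H := by
    refine Submonoid.prod_mem _ fun y hy => ?_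
    have hxy : x ≠ y := (Finset.ne_of_mem_erase hy).symm
    change G _
    rw [← isoExtend_pairIso_diagonal hxy]
    exact hp x y hxy ζ 0 (by simpa using hu)
  have hconst : (fun _ => ζ : X → ℂ) ∈ H := by
    change G _
    have := hG.scalar hu
    rwa [Matrix.smul_one_eq_diagonal] at this
  have h := H.mul_mem hconst hprod
  have heq : (Pi.mulSingle x ω : X → ℂ) = (fun _ => ζ) *
      ∏ y ∈ Finset.univ.erase x, (Pi.mulSingle x ζ * Pi.mulSingle y (star ζ) : X → ℂ) := by
    funext z
    rw [Pi.mul_apply, Finset.prod_apply]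
    simp only [Pi.mul_apply, Finset.prod_mul_distrib, Finset.prod_const]
    rw [Finset.card_erase_of_mem (Finset.mem_univ _), Finset.card_univ]
    by_cases hz : z = x
    · subst hz
      rw [Finset.prod_eq_one]
      · simp only [Pi.mulSingle_eq_same, mul_one]
        rw [← pow_succ', Nat.sub_add_cancel (Nat.one_le_iff_ne_zero.2 hn), hζ]
      · intro y hy
        exact Pi.mulSingle_eq_of_ne (Finset.ne_of_mem_erase hy).symm _
    · rw [Finset.prod_eq_single z]
      · simp only [Pi.mulSingle_eq_same, Pi.mulSingle_eq_of_ne hz, one_pow, one_mul]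
        rw [mul_comm, hu]
      · intro y _ hy
        exact Pi.mulSingle_eq_of_ne hy.symm _
      · simp [hz]
  rw [heq]
  exact h

/-- A Givens rotation: `b * u + star a * v` is the second entry of `suMat a b` applied to `(u, v)`.
-/
lemma exists_rotation (u v : ℂ) :
    ∃ a b : ℂ, star a * a + star b * b = 1 ∧ b * u + star a * v = 0 := by
  by_cases h : ‖u‖ ^ 2 + ‖v‖ ^ 2 = 0
  · have hu : u = 0 := by
      have : ‖u‖ = 0 := by nlinarith [norm_nonneg u, norm_nonneg v, sq_nonneg ‖u‖, sq_nonneg ‖v‖]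
      simpa using this
    have hv : v = 0 := by
      have : ‖v‖ = 0 := by nlinarith [norm_nonneg u, norm_nonneg v, sq_nonneg ‖u‖, sq_nonneg ‖v‖]
      simpa using this
    exact ⟨1, 0, by simp, by simp [hu, hv]⟩
  · set r : ℝ := Real.sqrt (‖u‖ ^ 2 + ‖v‖ ^ 2) with hr
    have hr2 : r * r = ‖u‖ ^ 2 + ‖v‖ ^ 2 := Real.mul_self_sqrt (by positivity)
    have hr0 : (r : ℂ) ≠ 0 := by
      intro h0
      have : r = 0 := by exact_mod_cast h0
      rw [this] at hr2
      exact h (by linarith)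
    have hu : star u * u = ((‖u‖ ^ 2 : ℝ) : ℂ) := by
      rw [Complex.star_def, mul_comm, Complex.mul_conj, Complex.normSq_eq_norm_sq]
    have hv : star v * v = ((‖v‖ ^ 2 : ℝ) : ℂ) := by
      rw [Complex.star_def, mul_comm, Complex.mul_conj, Complex.normSq_eq_norm_sq]
    have hsr : star (r : ℂ) = r := Complex.conj_ofReal r
    refine ⟨star u / r, -v / r, ?_, ?_⟩
    · rw [star_div₀, star_star, star_div₀, star_neg, hsr]
      have : u / r * (star u / r) + -star v / r * (-v / r) = (star u * u + star v * v) / (r * r) := by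
        field_simp
      rw [this, hu, hv, ← Complex.ofReal_add, ← hr2]
      push_cast
      field_simp
    · rw [star_div₀, star_star, hsr]
      ring

/-- Givens rotations against the pivot `x` remove the entries in `S` one by one. The columns outside
`insert x S` are controlled as well, so that columns already reduced survive in `mem_of_unitary`. -/
lemma exists_eliminate (hG : IsStarClosed G) (hp : ∀ x y, x ≠ y → ContainsPair G x y)
    (x : X) (v : X → ℂ) (S : Finset X) (hx : x ∉ S) :
    ∃ g, G g ∧ (∀ y ∈ S, (g.mulVec v) y = 0) ∧
      (∀ y, y ∉ insert x S → (g.mulVec v) y = v y ∧ ∀ z, g z y = (1 : Matrix X X ℂ) z y) := by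
  induction S using Finset.induction_on with
  | empty => exact ⟨1, hG.one, by simp, by simp⟩
  | insert s S hs ih =>
    obtain ⟨g, hg, h1, h2⟩ := ih fun h => hx (Finset.mem_insert_of_mem h)
    have hxs : x ≠ s := fun h => hx (by simp [h])
    have hxS : x ∉ S := fun h => hx (Finset.mem_insert_of_mem h)
    obtain ⟨a, b, hab, h0⟩ := exists_rotation ((g.mulVec v) x) ((g.mulVec v) s)
    have hmv : ∀ z, ((isoExtend (pairIso x s) (suMat a b) * g).mulVec v) z =
        if z = x then a * (g.mulVec v) x + -star b * (g.mulVec v) s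
        else if z = s then 0 else (g.mulVec v) z := fun z => by
      have := isoExtend_pairIso_mul_apply hxs (suMat a b)
        (Matrix.of fun z (_ : Unit) => (g.mulVec v) z) z ()
      rw [← h0, ← Matrix.mulVec_mulVec]
      simpa [suMat, Matrix.mul_apply, Matrix.mulVec, dotProduct] using this
    refine ⟨_, hG.mul (hp x s hxs a b hab) hg, fun y hy => ?_, fun y hy => ?_⟩
    · rw [hmv]
      have hyx : y ≠ x := by rintro rfl; exact hx hy
      rw [if_neg hyx]
      split_ifs with hys
      · rfl
      · exact h1 y ((Finset.mem_insert.1 hy).resolve_left hys)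
    · simp only [Finset.mem_insert, not_or] at hy
      obtain ⟨h3, h4⟩ := h2 y (by simp [hy.1, hy.2.2])
      refine ⟨by rw [hmv, if_neg hy.1, if_neg hy.2.1, h3], fun z => ?_⟩
      rw [isoExtend_pairIso_mul_apply hxs]
      simp only [h4, Matrix.one_apply_ne (Ne.symm hy.1), Matrix.one_apply_ne (Ne.symm hy.2.1)]
      split_ifs with h5 h6
      · rw [h5, Matrix.one_apply_ne (Ne.symm hy.1)]; simp
      · rw [h6, Matrix.one_apply_ne (Ne.symm hy.2.1)]; simp
      · rfl

lemma exists_mulVec_eq_single (hG : IsStarClosed G) (hp : ∀ x y, x ≠ y → ContainsPair G x y)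
    (x : X) (v : X → ℂ) (hv : star v ⬝ᵥ v = 1) (S : Finset X) (hx : x ∉ S)
    (hS : ∀ y, y ∉ insert x S → v y = 0) :
    ∃ g, G g ∧ g.mulVec v = Pi.single x 1 ∧
      (∀ y, y ∉ insert x S → ∀ z, g z y = (1 : Matrix X X ℂ) z y) := by
  obtain ⟨g, hg, h1, h2⟩ := exists_eliminate hG hp x v S hx
  set ω := (g.mulVec v) x with hω
  have hgv : g.mulVec v = Pi.single x ω := by
    funext y
    by_cases hy : y = x
    · subst hy; simp [hω]
    · rw [Pi.single_eq_of_ne hy]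
      by_cases hyS : y ∈ S
      · exact h1 y hyS
      · have := h2 y (by simp [hy, hyS])
        rw [this.1, hS y (by simp [hy, hyS])]
  have hω1 : star ω * ω = 1 := by
    have : star (g.mulVec v) ⬝ᵥ g.mulVec v = 1 := by
      rw [Matrix.star_mulVec, ← Matrix.dotProduct_mulVec, Matrix.mulVec_mulVec, hG.unitary hg,
        Matrix.one_mulVec, hv]
    rw [hgv] at this
    simpa using this
  refine ⟨Matrix.diagonal (Pi.mulSingle x (star ω)) * g, hG.mul (diagonal_mulSingle_mem hG hp x
    (by rw [star_star, mul_comm]; exact hω1)) hg, ?_, fun y hy z => ?_⟩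
  · rw [← Matrix.mulVec_mulVec, hgv]
    funext y
    rw [Matrix.mulVec_diagonal]
    by_cases hy : y = x
    · subst hy; simpa using hω1
    · simp [hy]
  · rw [Matrix.diagonal_mul, (h2 y hy).2]
    by_cases hzy : z = y
    · subst hzy
      rw [Pi.mulSingle_eq_of_ne, one_mul]
      rintro rfl
      exact hy (by simp)
    · simp [hzy]

/-- Every unit vector is a column of an element of `G`. -/
lemma exists_column (hG : IsStarClosed G) (hp : ∀ x y, x ≠ y → ContainsPair G x y)
    (x : X) (v : X → ℂ) (hv : star v ⬝ᵥ v = 1) : ∃ g, G g ∧ ∀ z, g z x = v z := by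
  obtain ⟨g, hg, h1, -⟩ := exists_mulVec_eq_single hG hp x v hv (Finset.univ.erase x) (by simp)
    (by simp [Finset.insert_erase])
  refine ⟨g.conjTranspose, hG.adj hg, fun z => ?_⟩
  have : g.conjTranspose.mulVec (g.mulVec v) = v := by
    rw [Matrix.mulVec_mulVec, hG.unitary hg, Matrix.one_mulVec]
  rw [h1] at this
  conv_rhs => rw [← this]
  simp

/-- The two-level special unitaries and the phases generate the unitary group. -/
lemma mem_of_unitary (hG : IsStarClosed G) (hp : ∀ x y, x ≠ y → ContainsPair G x y)
    {U : Matrix X X ℂ} (hU : U.conjTranspose * U = 1) : G U := by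
  suffices H : ∀ S : Finset X, ∀ U : Matrix X X ℂ, U.conjTranspose * U = 1 →
      (∀ y, y ∉ S → ∀ z, U z y = (1 : Matrix X X ℂ) z y) → G U from
    H Finset.univ U hU (by simp)
  intro S
  induction S using Finset.induction_on with
  | empty =>
    intro U _ h
    have : U = 1 := by ext z y; exact h y (by simp) z
    rw [this]
    exact hG.one
  | insert x S hx ih =>
    intro U hU h
    -- Where a column of a unitary is a basis vector, so is the corresponding row; hence column `x`
    -- is supported in `insert x S` and can be eliminated without touching finished columns.
    have hrow : ∀ y, y ∉ insert x S → ∀ z, U y z = (1 : Matrix X X ℂ) y z := fun y hy z => by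
      have h' := congrFun (congrFun hU y) z
      rw [Matrix.mul_apply] at h'
      simp only [Matrix.conjTranspose_apply, h y hy, Matrix.one_apply] at h'
      simpa [Matrix.one_apply] using h'
    obtain ⟨g, hg, h1, h2⟩ := exists_mulVec_eq_single hG hp x (U.col x) (by
      have h' := congrFun (congrFun hU x) x
      rw [Matrix.mul_apply, Matrix.one_apply_eq] at h'
      exact h') S hx (fun y hy => by
        rw [Matrix.col_apply, hrow y hy, Matrix.one_apply_ne]
        rintro rfl
        exact hy (by simp))
    have hgU : G (g * U) := by
      refine ih _ ?_ fun y hy z => ?_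
      · rw [Matrix.conjTranspose_mul, Matrix.mul_assoc, ← Matrix.mul_assoc _ g,
          hG.unitary hg, Matrix.one_mul, hU]
      · by_cases hyx : y = x
        · subst hyx
          have := congrFun h1 z
          rw [Matrix.one_apply]
          simpa [Matrix.mulVec, dotProduct, Matrix.mul_apply, Pi.single_apply] using this
        · have hy' : y ∉ insert x S := by simp [hyx, hy]
          rw [Matrix.mul_apply]
          simp only [h y hy', Matrix.one_apply]
          simpa [Matrix.one_apply] using h2 y hy' z
    have := hG.mul (hG.adj hg) hgU
    rwa [← Matrix.mul_assoc, hG.unitary hg, Matrix.one_mul] at this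

end TwoLevel

/-! ### Universality of two-qudit gates -/

section Universality

variable {ι κ : Type} [Fintype ι] [DecidableEq ι] [Fintype κ] [DecidableEq κ] {d : ℕ}

/-- `M` is the operator of some circuit. -/
def Implementable (M : RegOp ι d) : Prop := ∃ T, CircuitOp T M

lemma Implementable.mul {M N : RegOp ι d} (hM : Implementable M) (hN : Implementable N) :
    Implementable (M * N) := by
  obtain ⟨T, h⟩ := hM
  obtain ⟨T', h'⟩ := hN
  exact ⟨_, h.mul h'⟩

lemma Implementable.adj {M : RegOp ι d} (hM : Implementable M) :
    Implementable M.conjTranspose := by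
  obtain ⟨T, h⟩ := hM
  exact ⟨_, h.star⟩

/-- A gate with empty support is a global phase. -/
lemma circuitOp_scalar {ζ : ℂ} (hζ : star ζ * ζ = 1) :
    CircuitOp 1 (ζ • (1 : RegOp ι d)) := by
  have := CircuitOp.of_embedOp (ι := ι) (d := d) (Function.Embedding.ofIsEmpty (α := Empty))
    (by simp) (M := ζ • 1) (by
      rw [Matrix.mem_unitaryGroup_iff', Matrix.star_eq_conjTranspose]
      simp [Matrix.conjTranspose_smul, smul_smul] at *
      rw [mul_comm, hζ, one_smul])
  convert this using 1
  ext x y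
  rw [embedOp_apply, Matrix.smul_apply, Matrix.smul_apply, Matrix.one_apply, Matrix.one_apply,
    if_pos (Subsingleton.elim (x ∘ (Function.Embedding.ofIsEmpty : Empty ↪ ι)) _)]
  by_cases h : x = y
  · subst h; simp
  · rw [if_neg h, if_neg, smul_zero]
    intro h'
    exact h (funext fun i => h' i (by simp))

lemma isStarClosed_implementable :
    IsStarClosed (fun M : RegOp ι d => Implementable M) where
  unitary := fun ⟨T, h⟩ => by
    have := h.unitary
    rwa [Matrix.mem_unitaryGroup_iff', Matrix.star_eq_conjTranspose] at this
  mul := Implementable.mul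
  adj := Implementable.adj
  scalar := fun hζ => ⟨1, circuitOp_scalar hζ⟩

/-- The operator acting on the qudit `k` by a matrix that depends on the state of the
other qudits. -/
def ctrlOp (k : ι) (f : (ι → Fin d) → Matrix (Fin d) (Fin d) ℂ) : RegOp ι d :=
  fun z w => if ∀ j, j ≠ k → z j = w j then f z (z k) (w k) else 0

lemma ctrlOp_mul (k : ι) (f g : (ι → Fin d) → Matrix (Fin d) (Fin d) ℂ)
    (hg : ∀ z i, g (Function.update z k i) = g z) :
    ctrlOp k f * ctrlOp k g = ctrlOp k (fun z => f z * g z) := by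
  ext z w
  rw [Matrix.mul_apply]
  have : ∑ i, f z (z k) i * ctrlOp k g (Function.update z k i) w =
      ∑ v, ctrlOp k f z v * ctrlOp k g v w := by
    refine Fintype.sum_of_injective _ (Function.update_injective z k) _ _ ?_ ?_
    · intro v hv
      rw [ctrlOp, if_neg, zero_mul]
      intro h
      refine hv ⟨v k, ?_⟩
      funext j
      by_cases hj : j = k
      · subst hj; simp
      · rw [Function.update_of_ne hj, h j hj]
    · intro i
      simp only [ctrlOp]
      rw [if_pos fun j hj => (Function.update_of_ne hj _ _).symm, Function.update_self]
  rw [← this]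
  simp only [ctrlOp, hg, Function.update_self]
  by_cases h : ∀ j, j ≠ k → z j = w j
  · rw [if_pos h, Matrix.mul_apply]
    refine Finset.sum_congr rfl fun i _ => ?_
    rw [if_pos fun j hj => by rw [Function.update_of_ne hj, h j hj]]
  · rw [if_neg h]
    refine Finset.sum_eq_zero fun i _ => ?_
    rw [if_neg, mul_zero]
    intro h'
    exact h fun j hj => by rw [← h' j hj, Function.update_of_ne hj]

lemma ctrlOp_conjTranspose (k : ι) (f : (ι → Fin d) → Matrix (Fin d) (Fin d) ℂ)
    (hf : ∀ z i, f (Function.update z k i) = f z) :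
    (ctrlOp k f).conjTranspose = ctrlOp k (fun z => (f z).conjTranspose) := by
  ext z w
  rw [Matrix.conjTranspose_apply]
  simp only [ctrlOp]
  by_cases h : ∀ j, j ≠ k → z j = w j
  · have : f w = f z := by
      rw [← hf z (w k)]
      congr 1
      funext j
      by_cases hj : j = k
      · subst hj; simp
      · rw [Function.update_of_ne hj, h j hj]
    rw [if_pos h, if_pos fun j hj => (h j hj).symm, this]
    rfl
  · rw [if_neg h, if_neg fun h' => h fun j hj => (h' j hj).symm, star_zero]

lemma ctrlOp_one (k : ι) : ctrlOp k (fun _ => 1) = (1 : RegOp ι d) := by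
  ext z w
  simp only [ctrlOp]
  by_cases h : z = w
  · subst h; simp
  · rw [Matrix.one_apply_ne h]
    split_ifs with h'
    · rw [Matrix.one_apply_ne]
      intro hk
      refine h (funext fun j => ?_)
      by_cases hj : j = k
      · rw [hj, hk]
      · exact h' j hj
    · rfl

lemma ctrlOp_unitary (k : ι) {f : (ι → Fin d) → Matrix (Fin d) (Fin d) ℂ}
    (hf : ∀ z i, f (Function.update z k i) = f z) (hu : ∀ z, (f z).conjTranspose * f z = 1) :
    ctrlOp k f ∈ Matrix.unitaryGroup (ι → Fin d) ℂ := by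
  rw [Matrix.mem_unitaryGroup_iff', Matrix.star_eq_conjTranspose, ctrlOp_conjTranspose k f hf,
    ctrlOp_mul k _ _ hf]
  simp only [hu, ctrlOp_one]

lemma embedOp_ctrlOp (e : κ ↪ ι) (k : κ) (f : (κ → Fin d) → Matrix (Fin d) (Fin d) ℂ) :
    embedOp e (ctrlOp k f) = ctrlOp (e k) (fun z => f (z ∘ e)) := by
  ext z w
  rw [embedOp_apply]
  simp only [ctrlOp]
  by_cases h : ∀ j, j ≠ e k → z j = w j
  · rw [if_pos h, if_pos, if_pos]
    · rfl
    · exact fun j hj => h _ (e.injective.ne hj)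
    · intro i hi
      exact h i fun h' => hi ⟨k, h'.symm⟩
  · rw [if_neg h]
    split_ifs with h1 h2
    · exfalso
      refine h fun j hj => ?_
      by_cases hj' : j ∈ Set.range e
      · obtain ⟨i, rfl⟩ := hj'
        exact h2 i fun h' => hj (by rw [h'])
      · exact h1 j hj'
    · rfl
    · rfl

/-- The operator `V` on the qudit `k`, controlled on the qudits in `S` being in the
state `c`. -/
def ctrlOn (k : ι) (c : ι → Fin d) (S : Finset ι) (V : Matrix (Fin d) (Fin d) ℂ) : RegOp ι d :=
  ctrlOp k fun z => if ∀ j ∈ S, z j = c j then V else 1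

lemma forall_update_iff {k : ι} {S : Finset ι} (hk : k ∉ S) (c z : ι → Fin d) (i : Fin d) :
    (∀ j ∈ S, Function.update z k i j = c j) ↔ ∀ j ∈ S, z j = c j :=
  forall₂_congr fun j hj => by
    rw [Function.update_of_ne]
    rintro rfl
    exact hk hj

lemma ctrlOn_mul {k : ι} {S : Finset ι} (hk : k ∉ S) (c : ι → Fin d)
    (V W : Matrix (Fin d) (Fin d) ℂ) :
    ctrlOn k c S V * ctrlOn k c S W = ctrlOn k c S (V * W) := by
  unfold ctrlOn
  rw [ctrlOp_mul]
  · congr 1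
    funext z
    split_ifs <;> simp
  · intro z i
    simp only [forall_update_iff hk]

lemma ctrlOn_conjTranspose {k : ι} {S : Finset ι} (hk : k ∉ S) (c : ι → Fin d)
    (V : Matrix (Fin d) (Fin d) ℂ) :
    (ctrlOn k c S V).conjTranspose = ctrlOn k c S V.conjTranspose := by
  unfold ctrlOn
  rw [ctrlOp_conjTranspose]
  · congr 1
    funext z
    split_ifs <;> simp
  · intro z i
    simp only [forall_update_iff hk]

/-- If either control fails, one of the two operators is the identity and the commutator cancels. A
commutator thus acquires the union of the controls, and no auxiliary qudits are needed. -/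
lemma ctrlOn_commutator {k j : ι} {S : Finset ι} (hk : k ∉ S) (hj : k ≠ j) (c : ι → Fin d)
    {V W : Matrix (Fin d) (Fin d) ℂ} (hV : V * V.conjTranspose = 1)
    (hW : W * W.conjTranspose = 1) :
    ctrlOn k c S V * ctrlOn k c {j} W * (ctrlOn k c S V).conjTranspose *
      (ctrlOn k c {j} W).conjTranspose =
      ctrlOn k c (insert j S) (V * W * V.conjTranspose * W.conjTranspose) := by
  have hk' : k ∉ ({j} : Finset ι) := by simpa using hj
  rw [ctrlOn_conjTranspose hk, ctrlOn_conjTranspose hk']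
  unfold ctrlOn
  rw [ctrlOp_mul, ctrlOp_mul, ctrlOp_mul]
  · congr 1
    funext z
    simp only [Finset.mem_insert, forall_eq_or_imp, Finset.mem_singleton, forall_eq]
    by_cases h1 : z j = c j <;> by_cases h2 : ∀ i ∈ S, z i = c i
    · simp only [h1, if_true, if_pos h2, true_and]
    · simp [h1, h2, hW]
    · simp only [h1, if_false, if_pos h2, false_and, mul_one, hV]
    · simp only [h1, if_false, if_neg h2, false_and, mul_one]
  all_goals
    intro z i
    simp only [forall_update_iff hk, forall_update_iff hk']

lemma ctrlOn_empty_implementable (k : ι) (c : ι → Fin d) {V : Matrix (Fin d) (Fin d) ℂ}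
    (hV : V.conjTranspose * V = 1) : Implementable (ctrlOn k c ∅ V) := by
  refine ⟨1, ?_⟩
  have := CircuitOp.of_embedOp (ι := ι) (d := d)
    (⟨fun _ => k, fun _ _ _ => Subsingleton.elim _ _⟩ : Fin 1 ↪ ι) (by simp)
    (ctrlOp_unitary (0 : Fin 1) (f := fun _ => V) (fun _ _ => rfl) (fun _ => hV))
  rw [embedOp_ctrlOp] at this
  simp only [ctrlOn, Finset.notMem_empty, false_implies, implies_true, if_true]
  exact this

lemma ctrlOn_singleton_implementable {k j : ι} (hj : k ≠ j) (c : ι → Fin d)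
    {V : Matrix (Fin d) (Fin d) ℂ} (hV : V.conjTranspose * V = 1) :
    Implementable (ctrlOn k c {j} V) := by
  refine ⟨1, ?_⟩
  have := CircuitOp.of_embedOp (ι := ι) (d := d)
    (⟨![k, j], by
      intro a b
      fin_cases a <;> fin_cases b <;> simp [hj, hj.symm]⟩ : Fin 2 ↪ ι) (by simp)
    (ctrlOp_unitary (0 : Fin 2) (f := fun z => if z 1 = c j then V else 1)
      (fun z i => by simp) (fun z => by split_ifs <;> simp [hV]))
  rw [embedOp_ctrlOp] at this
  simp only [ctrlOn, Finset.mem_singleton, forall_eq]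
  exact this

/-- The `SU(2)` matrix with first column `(a, b)` on two levels of a qudit. -/
noncomputable abbrev levelMat (p q : Fin d) (a b : ℂ) : Matrix (Fin d) (Fin d) ℂ :=
  isoExtend (pairIso p q) (suMat a b)

lemma levelMat_unitary {p q : Fin d} (hpq : p ≠ q) {a b : ℂ}
    (h : star a * a + star b * b = 1) :
    levelMat p q a b * (levelMat p q a b).conjTranspose = 1 := by
  rw [isoExtend_conjTranspose, isoExtend_mul (pairIso_isometry hpq), suMat_mul_conjTranspose h,
    isoExtend_one]

lemma levelMat_commutator {p q : Fin d} (hpq : p ≠ q) (a b a' b' : ℂ) :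
    levelMat p q a b * levelMat p q a' b' * (levelMat p q a b).conjTranspose *
      (levelMat p q a' b').conjTranspose =
    isoExtend (pairIso p q) (suMat a b * suMat a' b' * suMat (star a) (-b) *
      suMat (star a') (-b')) := by
  rw [isoExtend_conjTranspose, isoExtend_conjTranspose, isoExtend_mul (pairIso_isometry hpq),
    isoExtend_mul (pairIso_isometry hpq), isoExtend_mul (pairIso_isometry hpq),
    suMat_conjTranspose, suMat_conjTranspose]

lemma exists_sqrt_unit {z : ℂ} (h : star z * z = 1) : ∃ w, w * w = z ∧ star w * w = 1 := by
  obtain ⟨w, h1, h2⟩ := exists_root_of_unit h two_ne_zero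
  exact ⟨w, by rw [← h1, sq], h2⟩

lemma exists_polar (a : ℂ) : ∃ u : ℂ, star u * u = 1 ∧ a = ‖a‖ * u := by
  refine ⟨Complex.exp (a.arg * Complex.I), ?_, (Complex.norm_mul_exp_arg_mul_I a).symm⟩
  rw [Complex.star_def, mul_comm, Complex.mul_conj, Complex.normSq_eq_norm_sq,
    Complex.norm_exp_ofReal_mul_I]
  simp

/-- Each additional control is gained by a commutator, so it suffices to generate `SU(2)` by
commutators. The commutator of `suMat w 0` with `suMat 0 1` is the square of the former, which gives
all diagonal elements; that of a real rotation with `suMat I 0` is the square of the rotation, which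
gives all real rotations. An Euler decomposition supplies the rest. -/
lemma ctrlOn_levelMat_implementable {p q : Fin d} (hpq : p ≠ q) (k : ι) (c : ι → Fin d)
    (S : Finset ι) (hk : k ∉ S) : ∀ a b : ℂ, star a * a + star b * b = 1 →
      Implementable (ctrlOn k c S (levelMat p q a b)) := by
  induction S using Finset.induction_on with
  | empty =>
    intro a b h
    refine ctrlOn_empty_implementable k c ?_
    exact mul_eq_one_comm.1 (levelMat_unitary hpq h)
  | insert j S _ ih =>
    have hkS : k ∉ S := fun h => hk (Finset.mem_insert_of_mem h)
    have hkj : k ≠ j := fun h => hk (by simp [h])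
    have hcomm : ∀ a b a' b' : ℂ, star a * a + star b * b = 1 → star a' * a' + star b' * b' = 1 →
        Implementable (ctrlOn k c (insert j S) (isoExtend (pairIso p q)
          (suMat a b * suMat a' b' * suMat (star a) (-b) * suMat (star a') (-b')))) := by
      intro a b a' b' h h'
      rw [← levelMat_commutator hpq,
        ← ctrlOn_commutator hkS hkj c (levelMat_unitary hpq h) (levelMat_unitary hpq h')]
      have h1 := ih hkS a b h
      have h2 := ctrlOn_singleton_implementable hkj c
        (mul_eq_one_comm.1 (levelMat_unitary hpq h'))
      exact ((h1.mul h2).mul h1.adj).mul h2.adj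
    have hphase : ∀ ζ : ℂ, star ζ * ζ = 1 →
        Implementable (ctrlOn k c (insert j S) (levelMat p q ζ 0)) := by
      intro ζ hζ
      obtain ⟨w, rfl, hw⟩ := exists_sqrt_unit hζ
      have := hcomm w 0 0 1 (by simpa using hw) (by simp)
      rw [suMat_mul, suMat_mul, suMat_mul] at this
      simpa using this
    have hrot : ∀ φ : ℝ, Implementable (ctrlOn k c (insert j S)
        (levelMat p q (Real.cos (2 * φ) : ℝ) (Real.sin (2 * φ) : ℝ))) := by
      intro φ
      have := hcomm (Real.cos φ : ℝ) (Real.sin φ : ℝ) Complex.I 0 (by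
        simp only [Complex.star_def, Complex.conj_ofReal]
        rw [← Complex.ofReal_mul, ← Complex.ofReal_mul, ← Complex.ofReal_add, ← sq, ← sq,
          Real.cos_sq_add_sin_sq, Complex.ofReal_one]) (by simp)
      rw [suMat_mul, suMat_mul, suMat_mul] at this
      have hI : star Complex.I = -Complex.I := Complex.conj_I
      have hr : ∀ x : ℝ, star (x : ℂ) = x := Complex.conj_ofReal
      convert this using 3
      · rw [Real.cos_two_mul']
        simp only [star_sub, star_add, star_mul', hI, hr, star_zero]
        push_cast
        linear_combination ((Complex.cos φ)^2 - (Complex.sin φ)^2) * Complex.I_mul_I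
      · rw [Real.sin_two_mul]
        simp only [star_sub, star_add, star_mul', hI, hr, star_zero]
        push_cast
        linear_combination (2 * Complex.cos φ * Complex.sin φ) * Complex.I_mul_I
    intro a b hab
    obtain ⟨u, hu, ha⟩ := exists_polar a
    obtain ⟨v, hv, hb⟩ := exists_polar b
    have hnorm : ‖a‖ ^ 2 + ‖b‖ ^ 2 = 1 := by
      have h1 : ∀ a : ℂ, star a * a = ((‖a‖ ^ 2 : ℝ) : ℂ) := fun a => by
        rw [Complex.star_def, mul_comm, Complex.mul_conj, Complex.normSq_eq_norm_sq]
      rw [h1, h1, ← Complex.ofReal_add] at hab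
      exact_mod_cast hab
    -- Outer phases `ζ`, `ξ` around a real rotation give the first column `(ζ * ξ * ‖a‖, star ζ * ξ
    -- * ‖b‖)`. Matching it with `(a, b)` forces `ξ * ξ = u * v` and `ζ = u * star ξ`.
    obtain ⟨ξ, hξ, hξu⟩ := exists_sqrt_unit (z := u * v) (by
      rw [star_mul']; linear_combination star v * v * hu + hv)
    have hζu : star (u * star ξ) * (u * star ξ) = 1 := by
      rw [star_mul', star_star]; linear_combination star ξ * ξ * hu + hξu
    have h3 := ((hphase _ hζu).mul (hrot (Real.arccos ‖a‖ / 2))).mul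
      (hphase ξ hξu)
    rw [ctrlOn_mul hk, ctrlOn_mul hk, isoExtend_mul (pairIso_isometry hpq),
      isoExtend_mul (pairIso_isometry hpq), suMat_mul, suMat_mul] at h3
    have hc : Real.cos (2 * (Real.arccos ‖a‖ / 2)) = ‖a‖ := by
      rw [mul_div_cancel₀ _ two_ne_zero, Real.cos_arccos (by linarith [norm_nonneg a])
        (by nlinarith [norm_nonneg a, sq_nonneg ‖b‖])]
    have hs : Real.sin (2 * (Real.arccos ‖a‖ / 2)) = ‖b‖ := by
      rw [mul_div_cancel₀ _ two_ne_zero, Real.sin_arccos,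
        show 1 - ‖a‖ ^ 2 = ‖b‖ ^ 2 by linarith, Real.sqrt_sq (norm_nonneg _)]
    rw [hc, hs] at h3
    convert h3 using 3
    · simp only [star_zero, zero_mul, sub_zero, mul_zero]
      conv_lhs => rw [ha]
      linear_combination -(‖a‖ : ℂ) * u * hξu
    · simp only [star_zero, zero_mul, mul_zero, add_zero, zero_add, star_mul', star_star]
      conv_lhs => rw [hb]
      linear_combination (-(‖b‖ : ℂ) * star u) * hξ - (‖b‖ : ℂ) * v * hu

/-- This links the two pictures: a gate controlled by all other qudits is a two-level operator on
two configurations that differ at `k` only. -/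
lemma ctrlOn_eq_isoExtend (p q : Fin d) (k : ι) (c : ι → Fin d)
    (M : Matrix (Fin 2) (Fin 2) ℂ) :
    ctrlOn k c (Finset.univ.erase k) (isoExtend (pairIso p q) M) =
      isoExtend (pairIso (Function.update c k p) (Function.update c k q)) M := by
  have hin : ∀ z : ι → Fin d, (∀ j, j ≠ k → z j = c j) → ∀ i,
      pairIso (Function.update c k p) (Function.update c k q) z i = pairIso p q (z k) i := by
    intro z hz i
    have : ∀ p, z = Function.update c k p ↔ z k = p := fun p => by
      constructor
      · intro h; rw [h]; simp
      · intro h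
        funext j
        by_cases hj : j = k
        · subst hj; simp [h]
        · rw [Function.update_of_ne hj, hz j hj]
    fin_cases i
    · exact if_congr (this p) rfl rfl
    · exact if_congr (this q) rfl rfl
  have hout : ∀ z : ι → Fin d, (¬ ∀ j, j ≠ k → z j = c j) → ∀ i,
      pairIso (Function.update c k p) (Function.update c k q) z i = 0 := by
    intro z hz i
    have : ∀ p, z ≠ Function.update c k p := by
      rintro p rfl
      exact hz fun j hj => Function.update_of_ne hj _ _
    fin_cases i
    · exact if_neg (this p)
    · exact if_neg (this q)
  have hone : ∀ z w : ι → Fin d, (∀ j, j ≠ k → z j = w j) →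
      (1 : RegOp ι d) z w = (1 : Matrix (Fin d) (Fin d) ℂ) (z k) (w k) := by
    intro z w h
    have := congrFun (congrFun (ctrlOp_one (d := d) k) z) w
    rw [← this, ctrlOp, if_pos h]
  ext z w
  rw [isoExtend_pairIso_apply]
  simp only [ctrlOn, ctrlOp, Finset.mem_erase, Finset.mem_univ, and_true]
  by_cases hz : ∀ j, j ≠ k → z j = c j
  · rw [if_pos hz]
    by_cases hw : ∀ j, j ≠ k → w j = c j
    · have hzw : ∀ j, j ≠ k → z j = w j := fun j hj => by rw [hz j hj, hw j hj]
      rw [if_pos hzw, isoExtend_pairIso_apply, hone z w hzw]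
      simp only [hin z hz, hin w hw]
    · rw [if_neg fun h => hw fun j hj => by rw [← h j hj, hz j hj]]
      rw [Matrix.one_apply_ne]
      · simp [hout w hw]
      · rintro rfl
        exact hw hz
  · rw [if_neg hz]
    simp only [hout z hz, zero_mul, Finset.sum_const_zero, add_zero]
    split_ifs with h
    · exact (hone z w h).symm
    · rw [Matrix.one_apply_ne]
      rintro rfl
      exact h fun _ _ => rfl

/-- Walk from `x` to `y` by changing one qudit at a time. Each step is a fully controlled gate, and
`ContainsPair.trans` composes the steps. -/
lemma containsPair_implementable (x y : ι → Fin d) (hxy : x ≠ y) :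
    ContainsPair (fun M : RegOp ι d => Implementable M) x y := by
  have hedge : ∀ (k : ι) (c : ι → Fin d) (q : Fin d), c k ≠ q →
      ContainsPair (fun M : RegOp ι d => Implementable M) c (Function.update c k q) := by
    intro k c q hq a b hab
    have := ctrlOn_levelMat_implementable hq k c (Finset.univ.erase k) (by simp) a b hab
    rwa [ctrlOn_eq_isoExtend, Function.update_eq_self] at this
  have hall : ∀ S : Finset ι, x ≠ S.piecewise y x →
      ContainsPair (fun M : RegOp ι d => Implementable M) x (S.piecewise y x) := by
    intro S
    induction S using Finset.induction_on with
    | empty => simp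
    | insert j S _ ih =>
      intro h
      rw [Finset.piecewise_insert] at h ⊢
      by_cases hj : S.piecewise y x j = y j
      · rw [← hj, Function.update_eq_self] at h ⊢
        exact ih h
      · by_cases h' : x = S.piecewise y x
        · have := hedge j (S.piecewise y x) (y j) hj
          rwa [← h'] at this ⊢
        · refine (ih h').trans isStarClosed_implementable (hedge j _ _ hj) h' ?_ h
          intro h''
          have := congrFun h'' j
          rw [Function.update_self] at this
          exact hj this
  have := hall Finset.univ
  rw [Finset.piecewise_univ] at this
  exact this hxy

/-- Two-qudit gates are universal. -/
theorem implementable_of_unitary {U : RegOp ι d} (hU : U.conjTranspose * U = 1) :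
    Implementable U :=
  mem_of_unitary isStarClosed_implementable containsPair_implementable hU

lemma exists_statePreparation (x : ι → Fin d) (v : (ι → Fin d) → ℂ) (hv : star v ⬝ᵥ v = 1) :
    ∃ T V, CircuitOp T V ∧ ∀ z, V z x = v z := by
  obtain ⟨V, ⟨T, h⟩, hV⟩ := exists_column isStarClosed_implementable containsPair_implementable
    x v hv
  exact ⟨T, V, h, hV⟩

end Universality

/-! ### Block encodings -/

section Encodings

variable {σ F Q : Type} [Fintype σ] [DecidableEq σ] [Fintype F] [DecidableEq F]
  [Fintype Q] [DecidableEq Q] {d : ℕ} [NeZero d]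

/-- `M`, acting on the system `σ`, the flags `F` and the clean qudits `Q`, is a block encoding
of `s • U`: whenever input and output flags are zero and the input or the output clean qudits
are zero, it acts as `s • U` on the system and trivially on the clean qudits. -/
def Encodes (U : RegOp σ d) (s : ℝ) (M : RegOp (σ ⊕ (F ⊕ Q)) d) : Prop :=
  ∀ z w : σ ⊕ (F ⊕ Q) → Fin d, (∀ f, z (.inr (.inl f)) = 0) → (∀ f, w (.inr (.inl f)) = 0) →
    ((∀ q, z (.inr (.inr q)) = 0) ∨ (∀ q, w (.inr (.inr q)) = 0)) →
    M z w = if ∀ q, z (.inr (.inr q)) = w (.inr (.inr q)) then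
      s * U (z ∘ Sum.inl) (w ∘ Sum.inl) else 0

/-- The isometry adding flags and clean qudits in the state zero. -/
def addZeros (σ κ : Type) [Fintype κ] [Fintype σ] [DecidableEq σ] [DecidableEq κ] (d : ℕ)
    [NeZero d] : Matrix (σ ⊕ κ → Fin d) (σ → Fin d) ℂ :=
  Matrix.of fun z x => if z = Sum.elim x (fun _ => 0) then 1 else 0

/-- The projection onto flags in the state zero. -/
def flagProj (σ F Q : Type) [Fintype F] [DecidableEq F] [Fintype σ] [DecidableEq σ]
    [Fintype Q] [DecidableEq Q] (d : ℕ) [NeZero d] : RegOp (σ ⊕ (F ⊕ Q)) d :=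
  Matrix.diagonal fun z => if ∀ f, z (.inr (.inl f)) = 0 then 1 else 0

lemma mul_addZeros_apply {κ : Type} [Fintype κ] [DecidableEq κ] {Y : Type}
    (M : Matrix Y (σ ⊕ κ → Fin d) ℂ) (y : Y) (x : σ → Fin d) :
    (M * addZeros σ κ d) y x = M y (Sum.elim x fun _ => 0) := by
  simp [Matrix.mul_apply, addZeros]

lemma addZeros_mul_apply {κ : Type} [Fintype κ] [DecidableEq κ] {Y : Type}
    (U : Matrix (σ → Fin d) Y ℂ) (z : σ ⊕ κ → Fin d) (y : Y) :
    (addZeros σ κ d * U) z y = if ∀ k, z (.inr k) = 0 then U (z ∘ Sum.inl) y else 0 := by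
  have : ∀ x : σ → Fin d, z = Sum.elim x (fun _ => 0) ↔ (∀ k, z (.inr k) = 0) ∧ x = z ∘ Sum.inl := by
    intro x
    constructor
    · rintro rfl
      simp
    · rintro ⟨h, rfl⟩
      funext i
      rcases i with i | i <;> simp [h]
  rw [Matrix.mul_apply]
  simp only [addZeros, Matrix.of_apply, this]
  by_cases h : ∀ k, z (.inr k) = 0
  · simp [h]
  · simp [h]

lemma flagProj_mul_apply {Y : Type} (M : Matrix (σ ⊕ (F ⊕ Q) → Fin d) Y ℂ)
    (z : σ ⊕ (F ⊕ Q) → Fin d) (y : Y) :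
    (flagProj σ F Q d * M) z y = if ∀ f, z (.inr (.inl f)) = 0 then M z y else 0 := by
  rw [flagProj, Matrix.diagonal_mul]
  split_ifs <;> simp

lemma elim_comp_inl_zero {κ : Type} {w : σ ⊕ κ → Fin d} (h : ∀ k, w (.inr k) = 0) :
    Sum.elim (w ∘ Sum.inl) (fun _ => 0) = w := by
  funext i
  rcases i with i | i <;> simp [h]

lemma flagProj_mul_addZeros : flagProj σ F Q d * addZeros σ (F ⊕ Q) d = addZeros σ (F ⊕ Q) d := by
  ext z x
  rw [flagProj_mul_apply]
  split_ifs with h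
  · rfl
  · rw [addZeros, Matrix.of_apply, if_neg]
    rintro rfl
    exact h (by simp)

/-- The two alternatives for the clean qudits, zero at the output or zero at the input, correspond
to the statements for `M.conjTranspose` and for `M`. Amplification alternates the two operators and
needs both. -/
lemma encodes_iff (U : RegOp σ d) (s : ℝ) (M : RegOp (σ ⊕ (F ⊕ Q)) d) :
    Encodes U s M ↔
      flagProj σ F Q d * (M * addZeros σ (F ⊕ Q) d) = (s : ℂ) • (addZeros σ (F ⊕ Q) d * U) ∧
      flagProj σ F Q d * (M.conjTranspose * addZeros σ (F ⊕ Q) d) =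
        (s : ℂ) • (addZeros σ (F ⊕ Q) d * U.conjTranspose) := by
  constructor
  · intro h
    constructor
    · ext z x
      rw [flagProj_mul_apply, mul_addZeros_apply, Matrix.smul_apply, addZeros_mul_apply]
      by_cases hf : ∀ f, z (.inr (.inl f)) = 0
      · rw [if_pos hf, h z _ hf (by simp) (Or.inr (by simp))]
        by_cases hq : ∀ q, z (.inr (.inr q)) = 0
        · rw [if_pos (by simpa using hq), if_pos (by simp [Sum.forall, hf, hq]),
            Sum.elim_comp_inl, smul_eq_mul]
        · rw [if_neg (by simpa using hq), if_neg (fun h => hq fun q => h (.inr q)), smul_zero]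
      · simp [Sum.forall, hf]
    · ext z x
      rw [flagProj_mul_apply, mul_addZeros_apply, Matrix.smul_apply, addZeros_mul_apply,
        Matrix.conjTranspose_apply, Matrix.conjTranspose_apply]
      by_cases hf : ∀ f, z (.inr (.inl f)) = 0
      · rw [if_pos hf, h _ z (by simp) hf (Or.inl (by simp))]
        simp only [Sum.forall, hf, implies_true, true_and, Sum.elim_inr, Sum.elim_comp_inl,
          eq_comm (a := (0 : Fin d))]
        split_ifs <;> simp
      · simp [Sum.forall, hf]
  · rintro ⟨h1, h2⟩ z w hz hw (hq | hq)
    · have h := congrFun (congrFun h2 w) (z ∘ Sum.inl)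
      rw [flagProj_mul_apply, mul_addZeros_apply, Matrix.smul_apply, addZeros_mul_apply,
        Matrix.conjTranspose_apply, Matrix.conjTranspose_apply, if_pos hw,
        elim_comp_inl_zero (by simp [Sum.forall, hz, hq])] at h
      rw [← star_star (M z w), h]
      simp only [Sum.forall, hw, hq, implies_true, true_and, eq_comm (a := (0 : Fin d))]
      split_ifs <;> simp
    · have h := congrFun (congrFun h1 z) (w ∘ Sum.inl)
      rw [flagProj_mul_apply, mul_addZeros_apply, Matrix.smul_apply, addZeros_mul_apply,
        if_pos hz, elim_comp_inl_zero (by simp [Sum.forall, hw, hq])] at h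
      rw [h]
      simp [Sum.forall, hz, hq]

end Encodings

/-! ### Amplitude amplification -/

section Amplification

variable {m n : Type} [Fintype m] [DecidableEq m] [Fintype n] [DecidableEq n]

/-- The span of `J * U` and `M * J` is invariant under the iterate, because `U` is unitary and `h2`
controls the way back. On it the iterate is a rotation by `2 * θ`: `a + sin θ * b` is the amplitude
along `J * U`, and `cos θ * b` the one orthogonal to it. Both are carried through the induction
since they mix under the rotation. -/
lemma amplify_pow_mul {M P : Matrix m m ℂ} {J : Matrix m n ℂ} {U : Matrix n n ℂ} {θ : ℝ}
    (hM : M.conjTranspose * M = 1) (hU : U.conjTranspose * U = 1) (hJ : P * J = J)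
    (h1 : P * (M * J) = (Real.sin θ : ℂ) • (J * U))
    (h2 : P * (M.conjTranspose * J) = (Real.sin θ : ℂ) • (J * U.conjTranspose)) (k : ℕ) :
    ∃ a b : ℝ, (M * (-(1 - (2 : ℂ) • P)) * M.conjTranspose * (1 - (2 : ℂ) • P)) ^ k * (M * J) =
        (a : ℂ) • (J * U) + (b : ℂ) • (M * J) ∧
      a + Real.sin θ * b = Real.sin ((2 * k + 1) * θ) ∧
      Real.cos θ * b = Real.cos ((2 * k + 1) * θ) := by
  have hM' : M * M.conjTranspose = 1 := mul_eq_one_comm.1 hM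
  have hcancel : ∀ X : Matrix m n ℂ, M * (M.conjTranspose * X) = X := fun X => by
    rw [← Matrix.mul_assoc, hM', Matrix.one_mul]
  have hcancel' : ∀ X : Matrix m n ℂ, M.conjTranspose * (M * X) = X := fun X => by
    rw [← Matrix.mul_assoc, hM, Matrix.one_mul]
  have hPJU : P * (J * U) = J * U := by rw [← Matrix.mul_assoc, hJ]
  have h2' : P * (M.conjTranspose * (J * U)) = (Real.sin θ : ℂ) • J := by
    rw [← Matrix.mul_assoc M.conjTranspose, ← Matrix.mul_assoc, h2, Matrix.smul_mul,
      Matrix.mul_assoc, hU, Matrix.mul_one]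
  set s : ℂ := (Real.sin θ : ℂ) with hs
  set G := M * (-(1 - (2 : ℂ) • P)) * M.conjTranspose * (1 - (2 : ℂ) • P) with hG
  have e1 : G * (J * U) = J * U - (2 * s) • (M * J) := by
    rw [hG]
    simp only [Matrix.mul_assoc, Matrix.sub_mul, Matrix.one_mul, Matrix.smul_mul, Matrix.neg_mul,
      Matrix.mul_sub, Matrix.mul_neg, Matrix.mul_smul, hPJU, h2', hcancel]
    module
  have e2 : G * (M * J) = (2 * s) • (J * U) + (1 - 4 * s ^ 2) • (M * J) := by
    rw [hG]
    simp only [Matrix.mul_assoc, Matrix.sub_mul, Matrix.one_mul, Matrix.smul_mul, Matrix.neg_mul,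
      Matrix.mul_sub, Matrix.mul_neg, Matrix.mul_smul, h1, h2', hcancel, hcancel', hJ]
    module
  induction k with
  | zero => exact ⟨0, 1, by simp, by simp, by simp⟩
  | succ k ih =>
    obtain ⟨a, b, h, ha, hb⟩ := ih
    refine ⟨a + 2 * Real.sin θ * b, -2 * Real.sin θ * a + (1 - 4 * Real.sin θ ^ 2) * b, ?_, ?_, ?_⟩
    · rw [pow_succ', Matrix.mul_assoc, h, Matrix.mul_add, Matrix.mul_smul, Matrix.mul_smul, e1, e2,
        hs]
      push_cast
      module
    · have e : (2 * ((k + 1 : ℕ) : ℝ) + 1) * θ = (2 * k + 1) * θ + 2 * θ := by push_cast; ring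
      rw [e, Real.sin_add, ← ha, ← hb, Real.sin_two_mul, Real.cos_two_mul]
      have := Real.sin_sq_add_cos_sq θ
      have hc : Real.cos θ ^ 2 = 1 - Real.sin θ ^ 2 := by linarith
      linear_combination (-2 * a - 4 * Real.sin θ * b) * hc
    · have e : (2 * ((k + 1 : ℕ) : ℝ) + 1) * θ = (2 * k + 1) * θ + 2 * θ := by push_cast; ring
      rw [e, Real.cos_add, ← ha, ← hb, Real.sin_two_mul, Real.cos_two_mul]
      have := Real.sin_sq_add_cos_sq θ
      have hc : Real.cos θ ^ 2 = 1 - Real.sin θ ^ 2 := by linarith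
      linear_combination (-2 * Real.cos θ * b) * hc

end Amplification

/-! ### Amplification of block encodings -/

section EncodingOperations

variable {σ F Q : Type} [Fintype σ] [DecidableEq σ] [Fintype F] [DecidableEq F]
  [Fintype Q] [DecidableEq Q] {d : ℕ} [NeZero d]

/-- The reflection about flags in the state zero. -/
noncomputable def flagRefl (σ F Q : Type) [Fintype F] [DecidableEq F] [Fintype σ] [DecidableEq σ]
    [Fintype Q] [DecidableEq Q] (d : ℕ) [NeZero d] : RegOp (σ ⊕ (F ⊕ Q)) d :=
  1 - (2 : ℂ) • flagProj σ F Q d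

lemma flagRefl_conjTranspose : (flagRefl σ F Q d).conjTranspose = flagRefl σ F Q d := by
  rw [flagRefl, flagProj, Matrix.conjTranspose_sub, Matrix.conjTranspose_smul,
    Matrix.conjTranspose_one, Matrix.diagonal_conjTranspose]
  congr 2
  · simp
  · congr 1
    funext z
    simp [apply_ite]

/-- One round of amplitude amplification. -/
noncomputable def groverStep (M : RegOp (σ ⊕ (F ⊕ Q)) d) : RegOp (σ ⊕ (F ⊕ Q)) d :=
  M * (-flagRefl σ F Q d) * M.conjTranspose * flagRefl σ F Q d

/-- The adjoint of the amplified operator is the amplification of the adjoint, so the second half of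
`encodes_iff` reduces to the first. -/
lemma conjTranspose_groverStep_pow_mul (M : RegOp (σ ⊕ (F ⊕ Q)) d) (k : ℕ) :
    (groverStep M ^ k * M).conjTranspose = groverStep M.conjTranspose ^ k * M.conjTranspose := by
  rw [Matrix.conjTranspose_mul, Matrix.conjTranspose_pow]
  have : SemiconjBy M.conjTranspose (groverStep M).conjTranspose
      (groverStep M.conjTranspose) := by
    change _ * _ = _ * _
    simp only [groverStep, Matrix.conjTranspose_mul, Matrix.conjTranspose_neg,
      flagRefl_conjTranspose, Matrix.conjTranspose_conjTranspose]
    noncomm_ring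
  exact (this.pow_right k)

lemma Encodes.adj {U : RegOp σ d} {s : ℝ} {M : RegOp (σ ⊕ (F ⊕ Q)) d} (h : Encodes U s M) :
    Encodes U.conjTranspose s M.conjTranspose := by
  rw [encodes_iff] at h ⊢
  simpa using h.symm

lemma Encodes.amplify {U : RegOp σ d} {θ : ℝ} {M : RegOp (σ ⊕ (F ⊕ Q)) d}
    (h : Encodes U (Real.sin θ) M) (hM : M.conjTranspose * M = 1) (hU : U.conjTranspose * U = 1)
    (k : ℕ) : Encodes U (Real.sin ((2 * k + 1) * θ)) (groverStep M ^ k * M) := by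
  have key : ∀ {U : RegOp σ d} {M : RegOp (σ ⊕ (F ⊕ Q)) d}, Encodes U (Real.sin θ) M →
      M.conjTranspose * M = 1 → U.conjTranspose * U = 1 →
      flagProj σ F Q d * (groverStep M ^ k * M * addZeros σ (F ⊕ Q) d) =
        ((Real.sin ((2 * k + 1) * θ) : ℝ) : ℂ) • (addZeros σ (F ⊕ Q) d * U) := by
    intro U M h hM hU
    rw [encodes_iff] at h
    obtain ⟨a, b, h1, h2, -⟩ := amplify_pow_mul hM hU flagProj_mul_addZeros h.1 h.2 k
    rw [Matrix.mul_assoc (groverStep M ^ k)]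
    unfold groverStep flagRefl
    rw [h1, Matrix.mul_add, Matrix.mul_smul, Matrix.mul_smul, h.1, ← Matrix.mul_assoc,
      flagProj_mul_addZeros, smul_smul, ← add_smul, ← h2]
    push_cast
    ring_nf
  rw [encodes_iff]
  refine ⟨key h hM hU, ?_⟩
  rw [conjTranspose_groverStep_pow_mul]
  refine key h.adj ?_ ?_
  · rw [Matrix.conjTranspose_conjTranspose]; exact mul_eq_one_comm.1 hM
  · rw [Matrix.conjTranspose_conjTranspose]; exact mul_eq_one_comm.1 hU

/-- The embedding of the flags in the whole register. -/
def flagEmb (σ F Q : Type) : F ↪ σ ⊕ (F ⊕ Q) :=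
  ⟨fun f => .inr (.inl f), fun _ _ h => by simpa using h⟩

lemma flagRefl_eq_embedOp : flagRefl σ F Q d =
    embedOp (flagEmb σ F Q) (Matrix.diagonal fun f => if f = fun _ => 0 then -1 else 1) := by
  ext z w
  rw [embedOp_apply]
  simp only [flagRefl, flagProj, Matrix.sub_apply, Matrix.smul_apply]
  by_cases h : z = w
  · subst h
    have : (z ∘ flagEmb σ F Q = fun _ => 0) ↔ ∀ f, z (.inr (.inl f)) = 0 := funext_iff
    simp only [Matrix.one_apply_eq, Matrix.diagonal_apply_eq, implies_true, if_true, this]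
    split_ifs <;> norm_num
  · rw [Matrix.one_apply_ne h, Matrix.diagonal_apply_ne _ h]
    split_ifs with h1
    · rw [Matrix.diagonal_apply_ne]
      · simp
      · intro h2
        exact h ((agree_iff _ z w).2 ⟨h1, h2⟩)
    · simp

/-- The reflection about the zero state of the flags has a circuit whose depth depends on the
flags only. -/
lemma exists_circuitOp_flagRefl (F : Type) [Fintype F] [DecidableEq F] (d : ℕ) [NeZero d] :
    ∃ ρ, ∀ (σ Q : Type) [Fintype σ] [DecidableEq σ] [Fintype Q] [DecidableEq Q],
      CircuitOp ρ (flagRefl σ F Q d) ∧ CircuitOp ρ (-flagRefl σ F Q d) := by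
  obtain ⟨ρ, h⟩ := implementable_of_unitary (d := d) (ι := F)
    (U := Matrix.diagonal fun f => if f = fun _ => 0 then -1 else 1) (by
      rw [Matrix.diagonal_conjTranspose, Matrix.diagonal_mul_diagonal, ← Matrix.diagonal_one]
      congr 1
      funext f
      by_cases h : f = fun _ => 0 <;> simp [h])
  refine ⟨1 + ρ, fun σ Q _ _ _ _ => ?_⟩
  have h1 : CircuitOp ρ (flagRefl σ F Q d) := by
    rw [flagRefl_eq_embedOp]
    exact h.embed _
  refine ⟨h1.mono (by omega), ?_⟩
  simpa using (circuitOp_scalar (ζ := -1) (by simp)).mul h1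

end EncodingOperations

/-! ### Operations on block encodings -/

section EncodingCircuits

variable {d : ℕ} [NeZero d]

lemma ite_decidable_irrel {p : Prop} {α : Type} (i j : Decidable p) (a b : α) :
    @ite α p i a b = @ite α p j a b := by
  congr

lemma embedOp_equiv_apply {ι κ : Type} (e : κ ≃ ι) (M : RegOp κ d) (x y : ι → Fin d) :
    embedOp e.toEmbedding M x y = M (x ∘ e) (y ∘ e) := by
  rw [embedOp_apply, if_pos]
  · rfl
  · intro i hi
    exact absurd ⟨e.symm i, by simp⟩ hi

lemma Encodes.relabel {σ σ' F F' Q Q' : Type} {U : RegOp σ d} {s : ℝ}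
    {M : RegOp (σ ⊕ (F ⊕ Q)) d} [Fintype σ] [DecidableEq σ] [Fintype F] [DecidableEq F]
    [Fintype Q] [DecidableEq Q] [Fintype σ'] [DecidableEq σ'] [Fintype F'] [DecidableEq F']
    [Fintype Q'] [DecidableEq Q']
    (h : Encodes U s M) (e : σ ≃ σ') (eF : F ≃ F') (eQ : Q ≃ Q') {U' : RegOp σ' d}
    (hU : ∀ x y, U' x y = U (x ∘ e) (y ∘ e)) :
    Encodes U' s (embedOp (Equiv.sumCongr e (Equiv.sumCongr eF eQ)).toEmbedding M) := by
  intro z w hz hw hq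
  rw [embedOp_equiv_apply, h _ _ (fun f => hz (eF f)) (fun f => hw (eF f))
    (hq.imp (fun h q => h (eQ q)) (fun h q => h (eQ q))), hU]
  have : (∀ q, z (.inr (.inr q)) = w (.inr (.inr q))) ↔
      ∀ q, z (.inr (.inr (eQ q))) = w (.inr (.inr (eQ q))) := eQ.forall_congr_right.symm
  by_cases hc : ∀ q, z (.inr (.inr q)) = w (.inr (.inr q))
  · rw [if_pos hc]
    exact if_pos (this.1 hc)
  · rw [if_neg hc]
    exact if_neg (mt this.2 hc)

/-- `U` has a block encoding `s • U` with `f` flags, `a` clean qudits and depth `T`. -/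
def HasEncoding {N : ℕ} (U : RegOp (Fin N) d) (s : ℝ) (f a T : ℕ) : Prop :=
  ∃ M : RegOp (Fin N ⊕ (Fin f ⊕ Fin a)) d, CircuitOp T M ∧ Encodes U s M

lemma HasEncoding.mono {N : ℕ} {U : RegOp (Fin N) d} {s : ℝ} {f a T T' : ℕ}
    (h : HasEncoding U s f a T) (hT : T ≤ T') : HasEncoding U s f a T' := by
  obtain ⟨M, hM, h⟩ := h
  exact ⟨M, hM.mono hT, h⟩

lemma HasEncoding.of_encodes {σ F Q : Type} [Fintype σ] [DecidableEq σ] [Fintype F]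
    [DecidableEq F] [Fintype Q] [DecidableEq Q] {N f a T : ℕ} {U : RegOp σ d} {s : ℝ}
    {U' : RegOp (Fin N) d} {M : RegOp (σ ⊕ (F ⊕ Q)) d} (hM : CircuitOp T M) (h : Encodes U s M)
    (e : σ ≃ Fin N) (hF : Fintype.card F = f) (hQ : Fintype.card Q = a)
    (hU : ∀ x y, U' x y = U (x ∘ e) (y ∘ e)) : HasEncoding U' s f a T :=
  ⟨_, hM.embed _, h.relabel e (Fintype.equivFinOfCardEq hF) (Fintype.equivFinOfCardEq hQ) hU⟩

lemma exists_diluting_unitary (hd : 2 ≤ d) {t : ℝ} (h0 : 0 ≤ t) (h1 : t ≤ 1) :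
    ∃ g : RegOp (Fin 1) d, g ∈ Matrix.unitaryGroup (Fin 1 → Fin d) ℂ ∧
      g (fun _ => 0) (fun _ => 0) = t := by
  have hne : (fun _ => ⟨1, hd⟩ : Fin 1 → Fin d) ≠ fun _ => 0 := fun h => by
    have := congrArg Fin.val (congrFun h 0)
    simp at this
  obtain ⟨T, V, hV, h⟩ := exists_statePreparation (d := d) (ι := Fin 1) (fun _ => 0)
    (Pi.single (fun _ => 0) (t : ℂ) + Pi.single (fun _ => ⟨1, hd⟩) ((√(1 - t ^ 2) : ℝ) : ℂ)) (by
      rw [dotProduct_add, dotProduct_single, dotProduct_single]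
      simp only [Pi.star_apply, Pi.add_apply, Pi.single_eq_same, Pi.single_eq_of_ne hne,
        Pi.single_eq_of_ne hne.symm, add_zero, zero_add, Complex.star_def, Complex.conj_ofReal]
      rw [← Complex.ofReal_mul, ← Complex.ofReal_mul, ← Complex.ofReal_add,
        Real.mul_self_sqrt (by nlinarith)]
      norm_cast
      ring)
  refine ⟨V, hV.unitary, ?_⟩
  rw [h, Pi.add_apply, Pi.single_eq_same, Pi.single_eq_of_ne hne.symm, add_zero]

/-- A fresh flag, rotated to have overlap `t` with its zero state, multiplies the amplitude by `t`.
It serves to tune an amplitude to an exact sine, so that later amplification ends at a prescribed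
value. -/
lemma HasEncoding.dilute {N : ℕ} {U : RegOp (Fin N) d} {s : ℝ} {f a T : ℕ}
    (h : HasEncoding U s f a T) (hd : 2 ≤ d) {t : ℝ} (h0 : 0 ≤ t) (h1 : t ≤ 1) :
    HasEncoding U (t * s) (f + 1) a (T + 1) := by
  obtain ⟨M, hM, h⟩ := h
  obtain ⟨g, hg, hgt⟩ := exists_diluting_unitary hd h0 h1
  let e1 : Fin N ⊕ (Fin f ⊕ Fin a) ↪ Fin N ⊕ ((Fin f ⊕ Fin 1) ⊕ Fin a) :=
    Function.Embedding.sumMap (Function.Embedding.refl _)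
      (Function.Embedding.sumMap Function.Embedding.inl (Function.Embedding.refl _))
  let e2 : Fin 1 ↪ Fin N ⊕ ((Fin f ⊕ Fin 1) ⊕ Fin a) :=
    ⟨fun i => .inr (.inl (.inr i)), fun _ _ _ => Subsingleton.elim _ _⟩
  have hdisj : Disjoint (Set.range e1) (Set.range e2) := by
    rw [Set.disjoint_left]
    rintro _ ⟨i, rfl⟩ ⟨j, hj⟩
    rcases i with i | i | i <;> cases hj
  refine HasEncoding.of_encodes (σ := Fin N) (F := Fin f ⊕ Fin 1) (Q := Fin a) (U := U)
    (M := embedOp e1 M * embedOp e2 g) ?_ ?_ (Equiv.refl _) (by simp) (by simp) (fun _ _ => rfl)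
  · exact (hM.embed e1).mul (CircuitOp.of_embedOp e2 (by simp) hg)
  · intro z w hz hw hq
    have h1 : M (z ∘ e1) (w ∘ e1) = if ∀ q, z (.inr (.inr q)) = w (.inr (.inr q)) then
        (s : ℂ) * U (z ∘ Sum.inl) (w ∘ Sum.inl) else 0 :=
      (h (z ∘ e1) (w ∘ e1) (fun f => hz (.inl f)) (fun f => hw (.inl f)) hq).trans
        (ite_decidable_irrel _ _ _ _)
    have h2 : g (z ∘ e2) (w ∘ e2) = t := by
      rw [← hgt]
      congr 1
      · funext i; exact hz (.inr i)
      · funext i; exact hw (.inr i)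
    rw [embedOp_mul_embedOp_apply e1 e2 hdisj, if_pos, h1, h2]
    · split_ifs
      · push_cast; ring
      · simp
    · rintro (i | (i | i) | i) hi1 hi2
      · exact absurd ⟨.inl i, rfl⟩ hi1
      · exact absurd ⟨.inr (.inl i), rfl⟩ hi1
      · exact absurd ⟨i, rfl⟩ hi2
      · exact absurd ⟨.inr (.inr i), rfl⟩ hi1

/-- The reflections touch the flags only, so their cost `ρ` is fixed before the system size, the
number of clean qudits and the operator. -/
lemma exists_amplify_cost (d : ℕ) [NeZero d] (f : ℕ) :
    ∃ ρ, ∀ {N : ℕ} {U : RegOp (Fin N) d} {θ : ℝ} {a T : ℕ},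
      HasEncoding U (Real.sin θ) f a T → U ∈ Matrix.unitaryGroup (Fin N → Fin d) ℂ → ∀ k : ℕ,
        HasEncoding U (Real.sin ((2 * k + 1) * θ)) f a ((2 * k + 1) * T + k * ρ) := by
  obtain ⟨ρ, hρ⟩ := exists_circuitOp_flagRefl (Fin f) d
  refine ⟨2 * ρ, ?_⟩
  rintro N U θ a T ⟨M, hM, h⟩ hU k
  obtain ⟨r1, r2⟩ := hρ (Fin N) (Fin a)
  rw [Matrix.mem_unitaryGroup_iff', Matrix.star_eq_conjTranspose] at hU
  have hMu := hM.unitary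
  rw [Matrix.mem_unitaryGroup_iff', Matrix.star_eq_conjTranspose] at hMu
  refine ⟨_, ?_, h.amplify hMu hU k⟩
  have := (((((hM.mul r2).mul hM.star).mul r1).pow k).mul hM)
  have e : (2 * k + 1) * T + k * (2 * ρ) = k * (T + ρ + T + ρ) + T := by ring
  rw [e]
  exact this

lemma conjTranspose_addZeros_mul_self (σ κ : Type) [Fintype σ] [DecidableEq σ] [Fintype κ]
    [DecidableEq κ] : (addZeros σ κ d).conjTranspose * addZeros σ κ d = 1 := by
  ext x y
  rw [mul_addZeros_apply, Matrix.conjTranspose_apply, addZeros, Matrix.of_apply, Matrix.one_apply]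
  by_cases h : x = y
  · subst h; simp
  · rw [if_neg h, if_neg, star_zero]
    intro h'
    exact h (funext fun i => (congrFun h' (.inl i)).symm)

/-! ### Encodings of amplitude one -/

section Clean

variable {σ F Q : Type} [Fintype σ] [DecidableEq σ] [Fintype F] [DecidableEq F] [Fintype Q]
  [DecidableEq Q]

/-- The component of `M * J` in the range of `J` is `J * U`, which already has full norm. Nothing is
left for the orthogonal complement: the Gram matrix of the difference vanishes. -/
lemma Encodes.mul_addZeros {U : RegOp σ d} {M : RegOp (σ ⊕ (F ⊕ Q)) d} (h : Encodes U 1 M)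
    (hM : M.conjTranspose * M = 1) (hU : U.conjTranspose * U = 1) :
    M * addZeros σ (F ⊕ Q) d = addZeros σ (F ⊕ Q) d * U := by
  set J := addZeros σ (F ⊕ Q) d with hJ
  have hJJ : J.conjTranspose * J = 1 := conjTranspose_addZeros_mul_self σ (F ⊕ Q)
  have hP : J.conjTranspose * flagProj σ F Q d = J.conjTranspose := by
    have := congrArg Matrix.conjTranspose (flagProj_mul_addZeros (σ := σ) (F := F) (Q := Q) (d := d))
    rw [Matrix.conjTranspose_mul] at this
    convert this using 2
    rw [flagProj, Matrix.diagonal_conjTranspose]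
    congr 1
    funext z
    simp [apply_ite]
  have h1 : J.conjTranspose * (M * J) = U := by
    rw [← hP, Matrix.mul_assoc, ((encodes_iff U 1 M).1 h).1, Complex.ofReal_one, one_smul,
      ← Matrix.mul_assoc, hJJ, Matrix.one_mul]
  have h2 : J.conjTranspose * (M.conjTranspose * J) = U.conjTranspose := by
    rw [← h1]
    simp [Matrix.mul_assoc]
  rw [← sub_eq_zero, ← Matrix.conjTranspose_mul_self_eq_zero]
  have e1 : J.conjTranspose * (M.conjTranspose * (M * J)) = 1 := by
    rw [← Matrix.mul_assoc M.conjTranspose, hM, Matrix.one_mul, hJJ]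
  have e2 : J.conjTranspose * (M.conjTranspose * (J * U)) = 1 := by
    rw [← Matrix.mul_assoc M.conjTranspose, ← Matrix.mul_assoc, h2, hU]
  have e3 : J.conjTranspose * (J * U) = U := by rw [← Matrix.mul_assoc, hJJ, Matrix.one_mul]
  simp only [Matrix.conjTranspose_sub, Matrix.conjTranspose_mul, Matrix.sub_mul, Matrix.mul_sub,
    Matrix.mul_assoc, e1, e2, e3, h1, hU]
  simp

/-- An encoding with amplitude one acts exactly. -/
lemma Encodes.apply_of_unitary {U : RegOp σ d} {M : RegOp (σ ⊕ (F ⊕ Q)) d} (h : Encodes U 1 M)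
    (hM : M.conjTranspose * M = 1) (hU : U.conjTranspose * U = 1) (z w : σ ⊕ (F ⊕ Q) → Fin d)
    (hzw : (∀ k, z (.inr k) = 0) ∨ (∀ k, w (.inr k) = 0)) :
    M z w = if ∀ k, z (.inr k) = w (.inr k) then U (z ∘ Sum.inl) (w ∘ Sum.inl) else 0 := by
  have key : ∀ {U : RegOp σ d} {M : RegOp (σ ⊕ (F ⊕ Q)) d}, Encodes U 1 M →
      M.conjTranspose * M = 1 → U.conjTranspose * U = 1 → ∀ z w, (∀ k, w (.inr k) = 0) →
      M z w = if ∀ k, z (.inr k) = 0 then U (z ∘ Sum.inl) (w ∘ Sum.inl) else 0 := by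
    intro U M h hM hU z w hw
    have := congrFun (congrFun (h.mul_addZeros hM hU) z) (w ∘ Sum.inl)
    rwa [mul_addZeros_apply, addZeros_mul_apply, elim_comp_inl_zero hw] at this
  rcases hzw with hz | hw
  · have := key h.adj (by rw [Matrix.conjTranspose_conjTranspose]; exact mul_eq_one_comm.1 hM)
      (by rw [Matrix.conjTranspose_conjTranspose]; exact mul_eq_one_comm.1 hU) w z hz
    rw [Matrix.conjTranspose_apply] at this
    rw [← star_star (M z w), this]
    simp only [hz, eq_comm (a := (0 : Fin d))]
    split_ifs <;> simp
  · rw [key h hM hU z w hw]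
    simp only [hw]

end Clean

lemma conjTranspose_mul_self_of_mem {X : Type} [Fintype X] [DecidableEq X] {M : Matrix X X ℂ}
    (h : M ∈ Matrix.unitaryGroup X ℂ) : M.conjTranspose * M = 1 := by
  rwa [Matrix.mem_unitaryGroup_iff', Matrix.star_eq_conjTranspose] at h

/-- The flags of an encoding with amplitude one may be regarded as clean. -/
lemma HasEncoding.clean {N : ℕ} {U : RegOp (Fin N) d} {f a T : ℕ}
    (h : HasEncoding U 1 f a T) (hU : U ∈ Matrix.unitaryGroup (Fin N → Fin d) ℂ) :
    HasEncoding U 1 0 (f + a) T := by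
  obtain ⟨M, hM, h⟩ := h
  let e : Fin N ⊕ (Fin f ⊕ Fin a) ≃ Fin N ⊕ (Fin 0 ⊕ (Fin f ⊕ Fin a)) :=
    Equiv.sumCongr (Equiv.refl _) (Equiv.emptySum _ _).symm
  refine HasEncoding.of_encodes (σ := Fin N) (F := Fin 0) (Q := Fin f ⊕ Fin a) (U := U)
    (hM.embed e.toEmbedding) ?_ (Equiv.refl _) (by simp) (by simp) (fun _ _ => rfl)
  intro z w _ _ hq
  rw [embedOp_equiv_apply, h.apply_of_unitary (conjTranspose_mul_self_of_mem hM.unitary)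
    (conjTranspose_mul_self_of_mem hU) _ _ hq]
  change (if ∀ q, z (.inr (.inr q)) = w (.inr (.inr q)) then
    U (z ∘ Sum.inl) (w ∘ Sum.inl) else 0) = _
  split_ifs <;> simp

lemma HasEncoding.exists_implements {N : ℕ} {U : RegOp (Fin N) d} {f a T : ℕ}
    (h : HasEncoding U 1 f a T) (hU : U ∈ Matrix.unitaryGroup (Fin N → Fin d) ℂ) :
    ∃ C : QuditCircuit (Fin N ⊕ Fin (f + a)) d, C.Implements U ∧ C.depth = T := by
  obtain ⟨M, hM, h⟩ := h
  let e : Fin N ⊕ (Fin f ⊕ Fin a) ≃ Fin N ⊕ Fin (f + a) :=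
    Equiv.sumCongr (Equiv.refl _) finSumFinEquiv
  obtain ⟨C, hC, hT⟩ := (hM.embed e.toEmbedding).exists_circuit
  refine ⟨C, fun x y b => ?_, hT⟩
  rw [hC, embedOp_equiv_apply, h.apply_of_unitary (conjTranspose_mul_self_of_mem hM.unitary)
    (conjTranspose_mul_self_of_mem hU) _ _ (Or.inr fun k => rfl)]
  have : (∀ k : Fin f ⊕ Fin a, b (finSumFinEquiv k) = 0) ↔ b = fun _ => 0 := by
    rw [finSumFinEquiv.forall_congr_right (q := fun k => b k = 0), funext_iff]
  by_cases hb : b = fun _ => 0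
  · rw [if_pos hb]
    exact if_pos (this.2 hb)
  · rw [if_neg hb]
    exact if_neg (mt this.1 hb)

lemma exists_hasEncoding {N : ℕ} {U : RegOp (Fin N) d}
    (hU : U ∈ Matrix.unitaryGroup (Fin N → Fin d) ℂ) : ∃ T, HasEncoding U 1 0 0 T := by
  obtain ⟨T, hT⟩ := implementable_of_unitary (conjTranspose_mul_self_of_mem hU)
  let e : Fin N ≃ Fin N ⊕ (Fin 0 ⊕ Fin 0) := (Equiv.sumEmpty _ _).symm
  refine ⟨T, _, hT.embed e.toEmbedding, fun z w _ _ _ => ?_⟩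
  rw [embedOp_equiv_apply, if_pos (fun q => q.elim0)]
  simp only [Complex.ofReal_one, one_mul]
  rfl

/-! ### Merging encodings -/

section Merge

variable {σ₁ σ₂ κ₁ κ₂ G F₁ F₂ Q₁ Q₂ : Type}

/-- The register of a merged encoding: the auxiliary qudits `κ₁`, `κ₂` and their purifiers `G`
become flags. -/
abbrev MergeReg (σ₁ σ₂ κ₁ κ₂ G F₁ F₂ Q₁ Q₂ : Type) : Type :=
  (σ₁ ⊕ σ₂) ⊕ (((F₁ ⊕ F₂) ⊕ ((κ₁ ⊕ κ₂) ⊕ G)) ⊕ (Q₁ ⊕ Q₂))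

/-- The first register of a merged encoding. -/
def mergeLeft : (σ₁ ⊕ κ₁) ⊕ (F₁ ⊕ Q₁) ↪ MergeReg σ₁ σ₂ κ₁ κ₂ G F₁ F₂ Q₁ Q₂ :=
  ⟨Sum.elim (Sum.elim (fun i => .inl (.inl i)) fun i => .inr (.inl (.inr (.inl (.inl i)))))
    (Sum.elim (fun i => .inr (.inl (.inl (.inl i)))) fun i => .inr (.inr (.inl i))), by
    rintro ((a | a) | (a | a)) ((b | b) | (b | b)) h <;> simp_all⟩

/-- The second register of a merged encoding. -/
def mergeRight : (κ₂ ⊕ σ₂) ⊕ (F₂ ⊕ Q₂) ↪ MergeReg σ₁ σ₂ κ₁ κ₂ G F₁ F₂ Q₁ Q₂ :=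
  ⟨Sum.elim (Sum.elim (fun i => .inr (.inl (.inr (.inl (.inr i))))) fun i => .inl (.inr i))
    (Sum.elim (fun i => .inr (.inl (.inl (.inr i)))) fun i => .inr (.inr (.inr i))), by
    rintro ((a | a) | (a | a)) ((b | b) | (b | b)) h <;> simp_all⟩

/-- The auxiliary qudits of a merged encoding. -/
def mergeAux : (κ₁ ⊕ κ₂) ⊕ G ↪ MergeReg σ₁ σ₂ κ₁ κ₂ G F₁ F₂ Q₁ Q₂ :=
  ⟨fun i => .inr (.inl (.inr i)), fun _ _ h => by simpa using h⟩

lemma disjoint_mergeLeft_mergeRight : Disjoint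
    (Set.range (mergeLeft (σ₁ := σ₁) (σ₂ := σ₂) (κ₁ := κ₁) (κ₂ := κ₂) (G := G) (F₁ := F₁)
      (F₂ := F₂) (Q₁ := Q₁) (Q₂ := Q₂)))
    (Set.range (mergeRight (σ₁ := σ₁) (σ₂ := σ₂) (κ₁ := κ₁) (κ₂ := κ₂) (G := G) (F₁ := F₁)
      (F₂ := F₂) (Q₁ := Q₁) (Q₂ := Q₂))) := by
  rw [Set.disjoint_left]
  rintro _ ⟨i, rfl⟩ ⟨j, hj⟩
  rcases i with (i | i) | (i | i) <;> rcases j with (j | j) | (j | j) <;> cases hj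

lemma extend_mergeAux (k : (κ₁ ⊕ κ₂) ⊕ G → Fin d)
    (z : MergeReg σ₁ σ₂ κ₁ κ₂ G F₁ F₂ Q₁ Q₂ → Fin d) :
    Function.extend mergeAux k z = Sum.elim (z ∘ Sum.inl)
      (Sum.elim (Sum.elim (fun i => z (.inr (.inl (.inl i)))) k) fun i => z (.inr (.inr i))) := by
  funext i
  rcases i with i | (i | i) | i
  · rw [Function.extend_apply']
    · rfl
    · rintro ⟨j, hj⟩; cases hj
  · rw [Function.extend_apply']
    · rfl
    · rintro ⟨j, hj⟩; cases hj
  · exact mergeAux.injective.extend_apply k z i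
  · rw [Function.extend_apply']
    · rfl
    · rintro ⟨j, hj⟩; cases hj

variable [Fintype σ₁] [DecidableEq σ₁] [Fintype σ₂] [DecidableEq σ₂] [Fintype κ₁]
  [DecidableEq κ₁] [Fintype κ₂] [DecidableEq κ₂] [Fintype G] [DecidableEq G] [Fintype F₁]
  [DecidableEq F₁] [Fintype F₂] [DecidableEq F₂] [Fintype Q₁] [DecidableEq Q₁] [Fintype Q₂]
  [DecidableEq Q₂]

set_option synthInstance.maxHeartbeats 400000 in
set_option synthInstance.maxSize 1000 in
-- `V` prepares the auxiliary qudits, the two encodings run side by side, and `W.conjTranspose`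
-- rotates the state to be projected on to the zero state. The hypothesis `h` evaluates the
-- resulting matrix element; its condition on `Sum.inr` is there because neither encoding touches
-- the purifiers `G`.
lemma Encodes.merge {U₁ : RegOp (σ₁ ⊕ κ₁) d} {U₂ : RegOp (κ₂ ⊕ σ₂) d} {U : RegOp (σ₁ ⊕ σ₂) d}
    {s₁ s₂ t : ℝ} {E₁ : RegOp ((σ₁ ⊕ κ₁) ⊕ (F₁ ⊕ Q₁)) d} {E₂ : RegOp ((κ₂ ⊕ σ₂) ⊕ (F₂ ⊕ Q₂)) d}
    (h₁ : Encodes U₁ s₁ E₁) (h₂ : Encodes U₂ s₂ E₂) (V W : RegOp ((κ₁ ⊕ κ₂) ⊕ G) d)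
    (h : ∀ x y : σ₁ ⊕ σ₂ → Fin d, ∑ k : (κ₁ ⊕ κ₂) ⊕ G → Fin d, ∑ k' : (κ₁ ⊕ κ₂) ⊕ G → Fin d,
      star (W k fun _ => 0) * (if k ∘ Sum.inr = k' ∘ Sum.inr then
        U₁ (Sum.elim (x ∘ Sum.inl) (k ∘ Sum.inl ∘ Sum.inl))
          (Sum.elim (y ∘ Sum.inl) (k' ∘ Sum.inl ∘ Sum.inl)) *
        U₂ (Sum.elim (k ∘ Sum.inl ∘ Sum.inr) (x ∘ Sum.inr))
          (Sum.elim (k' ∘ Sum.inl ∘ Sum.inr) (y ∘ Sum.inr)) else 0) *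
        V k' (fun _ => 0) = t * U x y) :
    Encodes U (s₁ * s₂ * t) ((embedOp mergeAux W.conjTranspose : RegOp (MergeReg σ₁ σ₂ κ₁ κ₂ G F₁ F₂ Q₁ Q₂) d) *
      ((embedOp mergeLeft E₁ : RegOp (MergeReg σ₁ σ₂ κ₁ κ₂ G F₁ F₂ Q₁ Q₂) d) *
        (embedOp mergeRight E₂ : RegOp (MergeReg σ₁ σ₂ κ₁ κ₂ G F₁ F₂ Q₁ Q₂) d)) *
      (embedOp mergeAux V : RegOp (MergeReg σ₁ σ₂ κ₁ κ₂ G F₁ F₂ Q₁ Q₂) d)) := by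
  intro z w hz hw hq
  rw [mul_embedOp_apply]
  have hz' : z ∘ mergeAux = fun _ => 0 := funext fun i => hz (.inr i)
  have hw' : w ∘ mergeAux = fun _ => 0 := funext fun i => hw (.inr i)
  have hsplit : (∀ q, z (.inr (.inr q)) = w (.inr (.inr q))) ↔
      (∀ q, z (.inr (.inr (.inl q))) = w (.inr (.inr (.inl q)))) ∧
      (∀ q, z (.inr (.inr (.inr q))) = w (.inr (.inr (.inr q)))) := Sum.forall
  -- Between preparation and projection the disjoint encodings factorise, and the amplitudes `s₁`,
  -- `s₂` multiply.
  have hW : ∀ k k', ((embedOp mergeLeft E₁ : RegOp (MergeReg σ₁ σ₂ κ₁ κ₂ G F₁ F₂ Q₁ Q₂) d) *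
      (embedOp mergeRight E₂ : RegOp (MergeReg σ₁ σ₂ κ₁ κ₂ G F₁ F₂ Q₁ Q₂) d)) (Function.extend mergeAux k z) (Function.extend mergeAux k' w) =
      if ∀ q, z (.inr (.inr q)) = w (.inr (.inr q)) then s₁ * s₂ *
        (if k ∘ Sum.inr = k' ∘ Sum.inr then
          U₁ (Sum.elim ((z ∘ Sum.inl) ∘ Sum.inl) (k ∘ Sum.inl ∘ Sum.inl))
            (Sum.elim ((w ∘ Sum.inl) ∘ Sum.inl) (k' ∘ Sum.inl ∘ Sum.inl)) *
          U₂ (Sum.elim (k ∘ Sum.inl ∘ Sum.inr) ((z ∘ Sum.inl) ∘ Sum.inr))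
            (Sum.elim (k' ∘ Sum.inl ∘ Sum.inr) ((w ∘ Sum.inl) ∘ Sum.inr)) else 0) else 0 := by
    intro k k'
    rw [embedOp_mul_embedOp_apply _ _ disjoint_mergeLeft_mergeRight, extend_mergeAux,
      extend_mergeAux]
    have hG : (∀ i, i ∉ Set.range (mergeLeft (σ₁ := σ₁) (σ₂ := σ₂) (κ₁ := κ₁) (κ₂ := κ₂) (G := G)
          (F₁ := F₁) (F₂ := F₂) (Q₁ := Q₁) (Q₂ := Q₂)) → i ∉ Set.range mergeRight →
        (Sum.elim (z ∘ Sum.inl) (Sum.elim (Sum.elim (fun i => z (.inr (.inl (.inl i)))) k)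
          fun i => z (.inr (.inr i))) : _ → Fin d) i =
        (Sum.elim (w ∘ Sum.inl) (Sum.elim (Sum.elim (fun i => w (.inr (.inl (.inl i)))) k')
          fun i => w (.inr (.inr i))) : _ → Fin d) i) ↔ k ∘ Sum.inr = k' ∘ Sum.inr := by
      constructor
      · intro h'
        funext i
        refine h' (.inr (.inl (.inr (.inr i)))) ?_ ?_
        · rintro ⟨(j | j) | (j | j), hj⟩ <;> cases hj
        · rintro ⟨(j | j) | (j | j), hj⟩ <;> cases hj
      · rintro h' ((i | i) | (((i | i) | ((i | i) | i)) | (i | i))) hi1 hi2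
        · exact absurd ⟨.inl (.inl i), rfl⟩ hi1
        · exact absurd ⟨.inl (.inr i), rfl⟩ hi2
        · exact absurd ⟨.inr (.inl i), rfl⟩ hi1
        · exact absurd ⟨.inr (.inl i), rfl⟩ hi2
        · exact absurd ⟨.inl (.inr i), rfl⟩ hi1
        · exact absurd ⟨.inl (.inl i), rfl⟩ hi2
        · exact congrFun h' i
        · exact absurd ⟨.inr (.inr i), rfl⟩ hi1
        · exact absurd ⟨.inr (.inr i), rfl⟩ hi2
    simp only [hG]
    have hs1 : ∀ (z : MergeReg σ₁ σ₂ κ₁ κ₂ G F₁ F₂ Q₁ Q₂ → Fin d) (k : (κ₁ ⊕ κ₂) ⊕ G → Fin d),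
        ((Sum.elim (z ∘ Sum.inl) (Sum.elim (Sum.elim (fun i => z (.inr (.inl (.inl i)))) k)
          fun i => z (.inr (.inr i))) : _ → Fin d) ∘ mergeLeft) ∘ Sum.inl =
        Sum.elim ((z ∘ Sum.inl) ∘ Sum.inl) (k ∘ Sum.inl ∘ Sum.inl) := by
      intro z k
      funext i
      rcases i with i | i <;> rfl
    have hs2 : ∀ (z : MergeReg σ₁ σ₂ κ₁ κ₂ G F₁ F₂ Q₁ Q₂ → Fin d) (k : (κ₁ ⊕ κ₂) ⊕ G → Fin d),
        ((Sum.elim (z ∘ Sum.inl) (Sum.elim (Sum.elim (fun i => z (.inr (.inl (.inl i)))) k)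
          fun i => z (.inr (.inr i))) : _ → Fin d) ∘ mergeRight) ∘ Sum.inl =
        Sum.elim (k ∘ Sum.inl ∘ Sum.inr) ((z ∘ Sum.inl) ∘ Sum.inr) := by
      intro z k
      funext i
      rcases i with i | i <;> rfl
    have h₁' := h₁ ((Sum.elim (z ∘ Sum.inl) (Sum.elim (Sum.elim (fun i => z (.inr (.inl (.inl i)))) k)
        fun i => z (.inr (.inr i))) : MergeReg σ₁ σ₂ κ₁ κ₂ G F₁ F₂ Q₁ Q₂ → Fin d) ∘ mergeLeft)
      ((Sum.elim (w ∘ Sum.inl) (Sum.elim (Sum.elim (fun i => w (.inr (.inl (.inl i)))) k')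
        fun i => w (.inr (.inr i))) : MergeReg σ₁ σ₂ κ₁ κ₂ G F₁ F₂ Q₁ Q₂ → Fin d) ∘ mergeLeft)
      (fun f => hz (.inl (.inl f))) (fun f => hw (.inl (.inl f)))
      (hq.imp (fun h q => h (.inl q)) (fun h q => h (.inl q)))
    have h₂' := h₂ ((Sum.elim (z ∘ Sum.inl) (Sum.elim (Sum.elim (fun i => z (.inr (.inl (.inl i)))) k)
        fun i => z (.inr (.inr i))) : MergeReg σ₁ σ₂ κ₁ κ₂ G F₁ F₂ Q₁ Q₂ → Fin d) ∘ mergeRight)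
      ((Sum.elim (w ∘ Sum.inl) (Sum.elim (Sum.elim (fun i => w (.inr (.inl (.inl i)))) k')
        fun i => w (.inr (.inr i))) : MergeReg σ₁ σ₂ κ₁ κ₂ G F₁ F₂ Q₁ Q₂ → Fin d) ∘ mergeRight)
      (fun f => hz (.inl (.inr f))) (fun f => hw (.inl (.inr f)))
      (hq.imp (fun h q => h (.inr q)) (fun h q => h (.inr q)))
    rw [hs1, hs1] at h₁'
    rw [hs2, hs2] at h₂'
    rw [h₁'.trans (ite_decidable_irrel (p := ∀ q, z (.inr (.inr (.inl q))) = w (.inr (.inr (.inl q))))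
        _ inferInstance _ _),
      h₂'.trans (ite_decidable_irrel (p := ∀ q, z (.inr (.inr (.inr q))) = w (.inr (.inr (.inr q))))
        _ inferInstance _ _)]
    simp only [hsplit]
    by_cases hc : k ∘ Sum.inr = k' ∘ Sum.inr
    · by_cases ha : ∀ q, z (.inr (.inr (.inl q))) = w (.inr (.inr (.inl q)))
      · by_cases hb : ∀ q, z (.inr (.inr (.inr q))) = w (.inr (.inr (.inr q)))
        · rw [if_pos hc, if_pos ha, if_pos hb, if_pos ⟨ha, hb⟩, if_pos hc]
          ring
        · rw [if_pos hc, if_neg hb, mul_zero, if_neg fun h => hb h.2]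
      · rw [if_pos hc, if_neg ha, zero_mul, if_neg fun h => ha h.1]
    · rw [if_neg hc, if_neg hc]
      simp
  simp only [embedOp_mul_apply, hz', hw', hW, Matrix.conjTranspose_apply]
  by_cases hc : ∀ q, z (.inr (.inr q)) = w (.inr (.inr q))
  · simp only [if_pos hc]
    have := h (z ∘ Sum.inl) (w ∘ Sum.inl)
    rw [Finset.sum_comm] at this
    push_cast
    rw [mul_assoc, ← this, Finset.mul_sum]
    refine Finset.sum_congr rfl fun k' _ => ?_
    rw [Finset.sum_mul, Finset.mul_sum]
    refine Finset.sum_congr rfl fun k _ => ?_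
    ring
  · simp only [if_neg hc, mul_zero, zero_mul, Finset.sum_const_zero]

end Merge

end EncodingCircuits

/-! ### Dual vectors of a product family -/

section DualVector

variable {D : ℕ} {I J : Type} [Fintype I] [Fintype J]

/-- The Gram matrix of a family of vectors. -/
def gramMat (ρ : Fin D → I → ℂ) : Matrix (Fin D) (Fin D) ℂ :=
  Matrix.of fun a' a => ∑ i, star (ρ a' i) * ρ a i

/-- The vector of minimal norm whose overlap with `ρ a ⊗ μ b` is `δ a b`. -/
lemma exists_dualVector {ρ : Fin D → I → ℂ} {μ : Fin D → J → ℂ}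
    (hQ : IsUnit (gramMat ρ)) (hP : IsUnit (gramMat μ)) :
    ∃ φ : I → J → ℂ, (∀ a b, ∑ i, ∑ j, star (φ i j) * (ρ a i * μ b j) = if a = b then 1 else 0) ∧
      ∑ i, ∑ j, ‖φ i j‖ ^ 2 =
        (Matrix.trace ((gramMat ρ)⁻¹ * ((gramMat μ)⁻¹).transpose)).re := by
  set Q := gramMat ρ with hQdef
  set P := gramMat μ with hPdef
  -- For `φ` in the span of the `ρ a' ⊗ μ b'` with coefficients `star (Γ a' b')`, the overlap
  -- conditions read `Qᵀ * Γ * P = 1`.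
  set Γ : Matrix (Fin D) (Fin D) ℂ := Q.transpose⁻¹ * P⁻¹ with hΓ
  have hdetQ : IsUnit Q.transpose.det := by
    rw [Matrix.det_transpose]; exact (Matrix.isUnit_iff_isUnit_det Q).1 hQ
  have hdetP : IsUnit P.det := (Matrix.isUnit_iff_isUnit_det P).1 hP
  have hΓ1 : Q.transpose * Γ * P = 1 := by
    rw [hΓ, ← Matrix.mul_assoc, Matrix.mul_nonsing_inv _ hdetQ, Matrix.one_mul,
      Matrix.nonsing_inv_mul _ hdetP]
  let φ : I → J → ℂ := fun i j => ∑ a', ∑ b', star (Γ a' b') * (ρ a' i * μ b' j)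
  have hov : ∀ a b, ∑ i, ∑ j, star (φ i j) * (ρ a i * μ b j) = if a = b then 1 else 0 := by
    intro a b
    have h1 := congrFun (congrFun hΓ1 a) b
    rw [Matrix.one_apply] at h1
    rw [← h1, Matrix.mul_apply]
    have h2 : ∀ i j, star (φ i j) * (ρ a i * μ b j) = ∑ b', ∑ a',
        (star (ρ a' i) * ρ a i) * Γ a' b' * (star (μ b' j) * μ b j) := by
      intro i j
      simp only [φ, star_sum, star_mul', star_star, Finset.sum_mul]
      rw [Finset.sum_comm]
      refine Finset.sum_congr rfl fun b' _ => Finset.sum_congr rfl fun a' _ => ?_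
      ring
    simp only [h2]
    calc ∑ i, ∑ j, ∑ b', ∑ a', (star (ρ a' i) * ρ a i) * Γ a' b' * (star (μ b' j) * μ b j)
        = ∑ i, ∑ b', ∑ j, ∑ a', (star (ρ a' i) * ρ a i) * Γ a' b' * (star (μ b' j) * μ b j) :=
          Finset.sum_congr rfl fun i _ => Finset.sum_comm
      _ = ∑ b', ∑ i, ∑ j, ∑ a', (star (ρ a' i) * ρ a i) * Γ a' b' * (star (μ b' j) * μ b j) :=
          Finset.sum_comm
      _ = _ := by
          refine Finset.sum_congr rfl fun b' _ => ?_
          rw [Matrix.mul_apply, hPdef]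
          simp only [gramMat, Matrix.of_apply, Matrix.transpose_apply, hQdef, Finset.sum_mul,
            Finset.mul_sum]
          rw [Finset.sum_comm]
          conv_lhs => enter [2, j]; rw [Finset.sum_comm]
  refine ⟨φ, hov, ?_⟩
  -- Expanding only one of the two factors `φ` and inserting the overlaps leaves the diagonal of
  -- `Γ`.
  have hnorm : ((∑ i, ∑ j, ‖φ i j‖ ^ 2 : ℝ) : ℂ) = star (Matrix.trace Γ) := by
    have h1 : ∀ i j, ((‖φ i j‖ ^ 2 : ℝ) : ℂ) = ∑ a', ∑ b',
        star (Γ a' b') * (star (φ i j) * (ρ a' i * μ b' j)) := by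
      intro i j
      have : ((‖φ i j‖ ^ 2 : ℝ) : ℂ) = star (φ i j) * φ i j := by
        rw [Complex.star_def, mul_comm, Complex.mul_conj, Complex.normSq_eq_norm_sq]
      rw [this]
      conv_lhs => enter [2]; simp only [φ]
      rw [Finset.mul_sum]
      refine Finset.sum_congr rfl fun a' _ => ?_
      rw [Finset.mul_sum]
      refine Finset.sum_congr rfl fun b' _ => ?_
      ring
    rw [Complex.ofReal_sum]
    simp only [Complex.ofReal_sum, h1]
    calc ∑ i, ∑ j, ∑ a', ∑ b', star (Γ a' b') * (star (φ i j) * (ρ a' i * μ b' j))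
        = ∑ i, ∑ a', ∑ j, ∑ b', star (Γ a' b') * (star (φ i j) * (ρ a' i * μ b' j)) :=
          Finset.sum_congr rfl fun i _ => Finset.sum_comm
      _ = ∑ a', ∑ i, ∑ j, ∑ b', star (Γ a' b') * (star (φ i j) * (ρ a' i * μ b' j)) :=
          Finset.sum_comm
      _ = ∑ a', ∑ i, ∑ b', ∑ j, star (Γ a' b') * (star (φ i j) * (ρ a' i * μ b' j)) :=
          Finset.sum_congr rfl fun a' _ => Finset.sum_congr rfl fun i _ => Finset.sum_comm
      _ = ∑ a', ∑ b', ∑ i, ∑ j, star (Γ a' b') * (star (φ i j) * (ρ a' i * μ b' j)) :=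
          Finset.sum_congr rfl fun a' _ => Finset.sum_comm
      _ = ∑ a', ∑ b', star (Γ a' b') * (if a' = b' then 1 else 0) := by
          refine Finset.sum_congr rfl fun a' _ => Finset.sum_congr rfl fun b' _ => ?_
          rw [← hov]
          simp only [Finset.mul_sum]
      _ = _ := by
          simp [Matrix.trace, Matrix.diag]
  have hre := congrArg Complex.re hnorm
  rw [Complex.ofReal_re, Complex.star_def, Complex.conj_re] at hre
  rw [hre, hΓ, ← Matrix.transpose_nonsing_inv, ← Matrix.trace_transpose, Matrix.transpose_mul,
    Matrix.transpose_transpose, Matrix.trace_mul_comm]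

/-- Cauchy–Schwarz for `φ` and `Φ = ∑ a, ρ a ⊗ μ a`: the latter is a unit vector by `h1`, and the
overlap is a sum of `D` ones. -/
lemma card_le_of_overlap {ρ : Fin D → I → ℂ} {μ : Fin D → J → ℂ} {φ : I → J → ℂ}
    (hφ : ∀ a b, ∑ i, ∑ j, star (φ i j) * (ρ a i * μ b j) = if a = b then 1 else 0)
    (h1 : ∑ a', ∑ a, gramMat ρ a' a * gramMat μ a' a = 1) :
    (D : ℝ) ^ 2 ≤ ∑ i, ∑ j, ‖φ i j‖ ^ 2 := by
  let Φ : I → J → ℂ := fun i j => ∑ a, ρ a i * μ a j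
  have hΦ : ∑ i, ∑ j, ‖Φ i j‖ ^ 2 = (1 : ℝ) := by
    have h2 : ∀ i j, ((‖Φ i j‖ ^ 2 : ℝ) : ℂ) = ∑ a', ∑ a,
        (star (ρ a' i) * ρ a i) * (star (μ a' j) * μ a j) := by
      intro i j
      have : ((‖Φ i j‖ ^ 2 : ℝ) : ℂ) = star (Φ i j) * Φ i j := by
        rw [Complex.star_def, mul_comm, Complex.mul_conj, Complex.normSq_eq_norm_sq]
      rw [this]
      simp only [Φ, star_sum, star_mul', Finset.sum_mul, Finset.mul_sum]
      rw [Finset.sum_comm]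
      refine Finset.sum_congr rfl fun a' _ => Finset.sum_congr rfl fun a _ => ?_
      ring
    have h3 : ((∑ i, ∑ j, ‖Φ i j‖ ^ 2 : ℝ) : ℂ) = 1 := by
      rw [← h1, Complex.ofReal_sum]
      simp only [Complex.ofReal_sum, h2]
      calc ∑ i, ∑ j, ∑ a', ∑ a, (star (ρ a' i) * ρ a i) * (star (μ a' j) * μ a j)
          = ∑ i, ∑ a', ∑ j, ∑ a, (star (ρ a' i) * ρ a i) * (star (μ a' j) * μ a j) :=
            Finset.sum_congr rfl fun i _ => Finset.sum_comm
        _ = ∑ a', ∑ i, ∑ j, ∑ a, (star (ρ a' i) * ρ a i) * (star (μ a' j) * μ a j) :=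
            Finset.sum_comm
        _ = ∑ a', ∑ i, ∑ a, ∑ j, (star (ρ a' i) * ρ a i) * (star (μ a' j) * μ a j) :=
            Finset.sum_congr rfl fun a' _ => Finset.sum_congr rfl fun i _ => Finset.sum_comm
        _ = ∑ a', ∑ a, ∑ i, ∑ j, (star (ρ a' i) * ρ a i) * (star (μ a' j) * μ a j) :=
            Finset.sum_congr rfl fun a' _ => Finset.sum_comm
        _ = _ := by
            simp only [gramMat, Matrix.of_apply, Finset.sum_mul_sum]
    exact_mod_cast h3
  have hD : ∑ i, ∑ j, star (φ i j) * Φ i j = D := by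
    have h2 : ∀ i j, star (φ i j) * Φ i j = ∑ a, star (φ i j) * (ρ a i * μ a j) := fun i j => by
      simp only [Φ, Finset.mul_sum]
    simp only [h2]
    calc ∑ i, ∑ j, ∑ a, star (φ i j) * (ρ a i * μ a j)
        = ∑ i, ∑ a, ∑ j, star (φ i j) * (ρ a i * μ a j) :=
          Finset.sum_congr rfl fun i _ => Finset.sum_comm
      _ = ∑ a, ∑ i, ∑ j, star (φ i j) * (ρ a i * μ a j) := Finset.sum_comm
      _ = D := by simp only [hφ]; simp
  have hle : (D : ℝ) ≤ ∑ p : I × J, ‖φ p.1 p.2‖ * ‖Φ p.1 p.2‖ := by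
    have : ‖(D : ℂ)‖ = D := by simp
    rw [← this, ← hD, ← Fintype.sum_prod_type']
    refine (norm_sum_le _ _).trans (le_of_eq ?_)
    refine Finset.sum_congr rfl fun p _ => ?_
    rw [norm_mul, norm_star]
  have hcs := Finset.sum_mul_sq_le_sq_mul_sq (Finset.univ : Finset (I × J))
    (fun p => ‖φ p.1 p.2‖) (fun p => ‖Φ p.1 p.2‖)
  rw [Fintype.sum_prod_type (fun p : I × J => ‖φ p.1 p.2‖ ^ 2),
    Fintype.sum_prod_type (fun p : I × J => ‖Φ p.1 p.2‖ ^ 2), hΦ, mul_one] at hcs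
  refine le_trans ?_ hcs
  gcongr

end DualVector

/-! ### Splitting matrix-product operators -/

section MPO

variable {d D : ℕ} (A : Fin d → Fin d → Matrix (Fin D) (Fin D) ℂ) (l r : Fin D → ℂ)

lemma bondProd_add {n m : ℕ} (x y : Fin n ⊕ Fin m → Fin d) :
    bondProd A (x ∘ finSumFinEquiv.symm) (y ∘ finSumFinEquiv.symm) =
      bondProd A (x ∘ Sum.inl) (y ∘ Sum.inl) * bondProd A (x ∘ Sum.inr) (y ∘ Sum.inr) := by
  unfold bondProd
  rw [List.ofFn_add, List.prod_append]
  congr 3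
  · funext i
    change A (x (finSumFinEquiv.symm (Fin.castAdd m i))) (y (finSumFinEquiv.symm (Fin.castAdd m i)))
      = _
    rw [finSumFinEquiv_symm_apply_castAdd]
    rfl
  · funext i
    rw [Function.comp_apply, Function.comp_apply, finSumFinEquiv_symm_apply_natAdd]
    rfl

lemma mpo_add {n m : ℕ} (x y : Fin n ⊕ Fin m → Fin d) :
    mpo A l r (n + m) (x ∘ finSumFinEquiv.symm) (y ∘ finSumFinEquiv.symm) =
      Matrix.vecMul l (bondProd A (x ∘ Sum.inl) (y ∘ Sum.inl)) ⬝ᵥ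
        Matrix.mulVec (bondProd A (x ∘ Sum.inr) (y ∘ Sum.inr)) r := by
  unfold mpo
  rw [bondProd_add, ← Matrix.mulVec_mulVec, Matrix.dotProduct_mulVec]

lemma sum_sumArrow {α β γ : Type} [Fintype α] [DecidableEq α] [Fintype β] [DecidableEq β]
    [Fintype γ] {M : Type} [AddCommMonoid M] (f : (α ⊕ β → γ) → M) :
    ∑ k, f k = ∑ p, ∑ q, f (Sum.elim p q) := by
  rw [← Fintype.sum_prod_type', ← (Equiv.sumArrowEquivProdArrow α β γ).symm.sum_comp]
  rfl

/-- The vectors obtained from the left boundary and `m` sites acting on a purified state. -/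
def leftVec {m : ℕ} (S : Matrix (Fin m → Fin d) (Fin m → Fin d) ℂ) (a : Fin D)
    (i : (Fin m → Fin d) × (Fin m → Fin d)) : ℂ :=
  ∑ y, Matrix.vecMul l (bondProd A i.1 y) a * S y i.2

/-- The mirror image of `leftVec`. -/
def rightVec {m : ℕ} (S : Matrix (Fin m → Fin d) (Fin m → Fin d) ℂ) (a : Fin D)
    (i : (Fin m → Fin d) × (Fin m → Fin d)) : ℂ :=
  ∑ y, Matrix.mulVec (bondProd A i.1 y) r a * S y i.2

lemma gram_aux {m : ℕ} (S : Matrix (Fin m → Fin d) (Fin m → Fin d) ℂ)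
    (F G : (Fin m → Fin d) → (Fin m → Fin d) → ℂ) :
    ∑ i : (Fin m → Fin d) × (Fin m → Fin d), star (∑ y, F i.1 y * S y i.2) *
        (∑ y, G i.1 y * S y i.2) =
      ∑ x, ∑ y, ∑ y', (S * S.conjTranspose) y y' * star (F x y') * G x y := by
  rw [Fintype.sum_prod_type]
  refine Finset.sum_congr rfl fun x _ => ?_
  simp only [Matrix.mul_apply, Matrix.conjTranspose_apply, star_sum, star_mul', Finset.sum_mul,
    Finset.mul_sum]
  rw [Finset.sum_comm]
  refine Finset.sum_congr rfl fun y _ => ?_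
  rw [Finset.sum_comm]
  refine Finset.sum_congr rfl fun y' _ => Finset.sum_congr rfl fun g _ => ?_
  ring

lemma gramMat_leftVec {m : ℕ} (S : Matrix (Fin m → Fin d) (Fin m → Fin d) ℂ) :
    gramMat (leftVec A l S) = leftEnv A l (S * S.conjTranspose) := by
  ext a' a
  exact gram_aux S (fun x y => Matrix.vecMul l (bondProd A x y) a')
    (fun x y => Matrix.vecMul l (bondProd A x y) a)

lemma gramMat_rightVec {m : ℕ} (S : Matrix (Fin m → Fin d) (Fin m → Fin d) ℂ) :
    gramMat (rightVec A r S) = rightEnv A r (S * S.conjTranspose) := by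
  ext a' a
  exact gram_aux S (fun x y => Matrix.mulVec (bondProd A x y) r a')
    (fun x y => Matrix.mulVec (bondProd A x y) r a)

open scoped MatrixOrder in
-- Read as a vector in two registers, `S` is a purification of `σ`; its second index labels the
-- purifier.
lemma IsDensity.exists_sqrt {m : ℕ} {σ : Matrix (Fin m → Fin d) (Fin m → Fin d) ℂ}
    (h : IsDensity σ) : ∃ S : Matrix (Fin m → Fin d) (Fin m → Fin d) ℂ,
      S * S.conjTranspose = σ ∧ ∑ v, ∑ g, star (S v g) * S v g = 1 := by
  obtain ⟨B, hB⟩ := CStarAlgebra.nonneg_iff_eq_star_mul_self.mp h.1.nonneg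
  rw [Matrix.star_eq_conjTranspose] at hB
  refine ⟨B.conjTranspose, by rw [Matrix.conjTranspose_conjTranspose, hB], ?_⟩
  rw [← h.2, hB, Matrix.trace]
  refine Finset.sum_congr rfl fun v _ => ?_
  rw [Matrix.diag_apply, Matrix.mul_apply]
  refine Finset.sum_congr rfl fun g _ => ?_
  simp [mul_comm]

end MPO

/-! ### Environments of matrix-product unitaries -/

section Environments

lemma sum_env_aux {D : ℕ} {X Y U V : Type} [Fintype X] [Fintype Y] [Fintype U] [Fintype V]
    (τ : V → V → ℂ) (σ : Y → Y → ℂ) (R : U → V → Fin D → ℂ) (L : X → Y → Fin D → ℂ) :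
    ∑ a', ∑ a, (∑ u, ∑ v, ∑ v', τ v v' * (starRingEnd ℂ) (R u v' a') * R u v a) *
        (∑ x, ∑ y, ∑ y', σ y y' * (starRingEnd ℂ) (L x y' a') * L x y a) =
      ∑ v, ∑ v', ∑ y, ∑ y', τ v v' * σ y y' * ∑ x, ∑ u,
        star (L x y' ⬝ᵥ R u v') * (L x y ⬝ᵥ R u v) := by
  simp only [dotProduct, star_sum, star_mul', Finset.sum_mul, Finset.mul_sum]
  simp only [← Fintype.sum_prod_type']
  refine Fintype.sum_equiv
    { toFun := fun ⟨a', a, x, y, y', u, v, v'⟩ => (v, v', y, y', x, u, a, a')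
      invFun := fun ⟨v, v', y, y', x, u, a, a'⟩ => (a', a, x, y, y', u, v, v')
      left_inv := fun _ => rfl
      right_inv := fun _ => rfl } _ _ ?_
  rintro ⟨a', a, x, y, y', u, v, v'⟩
  simp only [Equiv.coe_fn_mk, Complex.star_def]
  ring

variable {d D : ℕ} [NeZero d] (A : Fin d → Fin d → Matrix (Fin D) (Fin D) ℂ) (l r : Fin D → ℂ)

/-- Contracting the two environments closes the doubled network of `m' + m` sites. Unitarity reduces
it to the product of the traces of `σ` and `τ`. -/
lemma sum_rightEnv_mul_leftEnv {m' m : ℕ}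
    {σ : Matrix (Fin m' → Fin d) (Fin m' → Fin d) ℂ} {τ : Matrix (Fin m → Fin d) (Fin m → Fin d) ℂ}
    (hσ : IsDensity σ) (hτ : IsDensity τ)
    (hU : mpo A l r (m' + m) ∈ Matrix.unitaryGroup (Fin (m' + m) → Fin d) ℂ) :
    ∑ a', ∑ a, rightEnv A r τ a' a * leftEnv A l σ a' a = 1 := by
  have hU' : ∀ y v y' v', ∑ x : Fin m' → Fin d, ∑ u : Fin m → Fin d,
      star (Matrix.vecMul l (bondProd A x y') ⬝ᵥ Matrix.mulVec (bondProd A u v') r) *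
        (Matrix.vecMul l (bondProd A x y) ⬝ᵥ Matrix.mulVec (bondProd A u v) r) =
      if y' = y ∧ v' = v then 1 else 0 := by
    intro y v y' v'
    have h := congrFun (congrFun (conjTranspose_mul_self_of_mem hU)
      (Sum.elim y' v' ∘ finSumFinEquiv.symm)) (Sum.elim y v ∘ finSumFinEquiv.symm)
    rw [Matrix.mul_apply, Matrix.one_apply,
      ← (Equiv.arrowCongr finSumFinEquiv (Equiv.refl (Fin d))).sum_comp, sum_sumArrow] at h
    have h2 : ∀ x u y v, mpo A l r (m' + m)
        ((Equiv.arrowCongr finSumFinEquiv (Equiv.refl (Fin d))) (Sum.elim x u))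
        (Sum.elim y v ∘ finSumFinEquiv.symm) =
        Matrix.vecMul l (bondProd A x y) ⬝ᵥ Matrix.mulVec (bondProd A u v) r := fun x u y v =>
      mpo_add A l r (Sum.elim x u) (Sum.elim y v)
    simp only [Matrix.conjTranspose_apply, h2] at h
    rw [h]
    congr 1
    rw [eq_iff_iff, finSumFinEquiv.symm.surjective.injective_comp_right.eq_iff]
    constructor
    · intro h
      exact ⟨by simpa using congrArg (· ∘ Sum.inl) h, by simpa using congrArg (· ∘ Sum.inr) h⟩
    · rintro ⟨rfl, rfl⟩; rfl
  have key : ∑ a', ∑ a, rightEnv A r τ a' a * leftEnv A l σ a' a =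
      ∑ v, ∑ v', ∑ y, ∑ y', τ v v' * σ y y' * ∑ x : Fin m' → Fin d, ∑ u : Fin m → Fin d,
      star (Matrix.vecMul l (bondProd A x y') ⬝ᵥ Matrix.mulVec (bondProd A u v') r) *
        (Matrix.vecMul l (bondProd A x y) ⬝ᵥ Matrix.mulVec (bondProd A u v) r) := by
    exact sum_env_aux τ σ (fun u v => Matrix.mulVec (bondProd A u v) r)
      (fun x y => Matrix.vecMul l (bondProd A x y))
  rw [key]
  simp only [hU']
  have h1 : ∀ v v' y y', τ v v' * σ y y' * (if y' = y ∧ v' = v then (1 : ℂ) else 0) =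
      if y = y' then (if v = v' then τ v v' * σ y y' else 0) else 0 := by
    intro v v' y y'
    split_ifs <;> simp_all
  simp only [h1, Finset.sum_ite_eq, Finset.mem_univ, if_true]
  rw [← mul_one (1 : ℂ)]
  nth_rewrite 1 [← hτ.2]
  rw [← hσ.2, Matrix.trace, Matrix.trace, Finset.sum_mul_sum]
  refine Finset.sum_congr rfl fun v _ => ?_
  rw [Finset.sum_comm]
  simp [Matrix.diag_apply]

lemma leftEnv_zero_eq (σ : Matrix (Fin 0 → Fin d) (Fin 0 → Fin d) ℂ) :
    leftEnv A l σ = Matrix.vecMulVec (fun a => σ default default * star (l a)) l := by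
  ext a' a
  rw [Matrix.vecMulVec_apply, leftEnv, Fintype.sum_unique, Fintype.sum_unique, Fintype.sum_unique]
  simp only [bondProd, List.ofFn_zero, List.prod_nil, Matrix.vecMul_one]
  congr 3 <;> exact Subsingleton.elim _ _

/-- Without sites the environment has rank at most one. This covers `m = 0`, which the definition of
`leftSet` admits but where unitarity is not assumed. -/
lemma card_le_one_of_leftEnv_zero {σ : Matrix (Fin 0 → Fin d) (Fin 0 → Fin d) ℂ}
    (h : IsUnit (leftEnv A l σ)) : D ≤ 1 := by
  have h1 := Matrix.rank_of_isUnit _ h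
  rw [leftEnv_zero_eq, Fintype.card_fin] at h1
  rw [← h1]
  exact Matrix.rank_vecMulVec_le _ _

variable {A l r}

lemma IsUniformBulkMPU.pos (hU : IsUniformBulkMPU A l r) : 0 < D := by
  rcases Nat.eq_zero_or_pos D with h | h
  · subst h
    have h1 := congrFun (congrFun (conjTranspose_mul_self_of_mem (hU 1 le_rfl)) 0) 0
    have h2 : mpo A l r 1 = 0 := by ext x y; simp [mpo, dotProduct]
    rw [h2] at h1
    simp at h1
  · exact h

/-- Only `N = 0` is new. For `D = 1` the squared Frobenius norm is `‖l 0 * r 0‖ ^ 2 * t ^ N`; it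
equals `d ^ N` at `N = 1` and `N = 2`, and comparing the two gives `‖l 0 * r 0‖ = 1`. -/
lemma IsUniformBulkMPU.mem_of_card_le_one (hU : IsUniformBulkMPU A l r) (hD : D ≤ 1) (N : ℕ) :
    mpo A l r N ∈ Matrix.unitaryGroup (Fin N → Fin d) ℂ := by
  rcases Nat.eq_zero_or_pos N with h | h
  · subst h
    have hD1 : D = 1 := le_antisymm hD hU.pos
    subst hD1
    have hsum : ∀ N, 1 ≤ N → ∑ x, ∑ y, ‖mpo A l r N x y‖ ^ 2 = (d : ℝ) ^ N := by
      intro N hN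
      have h1 := congrArg Matrix.trace (conjTranspose_mul_self_of_mem (hU N hN))
      rw [Matrix.trace_one, Matrix.trace] at h1
      simp only [Matrix.diag_apply, Matrix.mul_apply, Matrix.conjTranspose_apply,
        Complex.star_def, ← Complex.normSq_eq_conj_mul_self, Complex.normSq_eq_norm_sq] at h1
      rw [Finset.sum_comm] at h1
      rw [Fintype.card_fun, Fintype.card_fin, Fintype.card_fin] at h1
      exact_mod_cast h1
    set t : ℝ := ∑ i, ∑ j, ‖A i j 0 0‖ ^ 2 with ht
    have e1 : ∑ x, ∑ y, ‖mpo A l r 1 x y‖ ^ 2 = ‖l 0 * r 0‖ ^ 2 * t := by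
      rw [← (Equiv.funUnique (Fin 1) (Fin d)).symm.sum_comp, ht, Finset.mul_sum]
      refine Finset.sum_congr rfl fun i _ => ?_
      rw [← (Equiv.funUnique (Fin 1) (Fin d)).symm.sum_comp, Finset.mul_sum]
      refine Finset.sum_congr rfl fun j _ => ?_
      simp [mpo, bondProd, Matrix.mulVec, dotProduct, mul_pow]
      ring
    have e2 : ∑ x, ∑ y, ‖mpo A l r 2 x y‖ ^ 2 = ‖l 0 * r 0‖ ^ 2 * t ^ 2 := by
      have : ∀ f : (Fin 2 → Fin d) → ℝ, ∑ x, f x = ∑ i, ∑ j, f ![i, j] := by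
        intro f
        rw [← (finTwoArrowEquiv (Fin d)).symm.sum_comp, Fintype.sum_prod_type]
        rfl
      simp only [this]
      rw [ht, sq (∑ i, ∑ j, _), Finset.sum_mul_sum, Finset.mul_sum]
      refine Finset.sum_congr rfl fun i _ => ?_
      rw [Finset.mul_sum]
      refine Finset.sum_congr rfl fun i' _ => ?_
      rw [Finset.sum_mul_sum, Finset.mul_sum]
      refine Finset.sum_congr rfl fun j _ => ?_
      rw [Finset.mul_sum]
      refine Finset.sum_congr rfl fun j' _ => ?_
      simp [mpo, bondProd, Matrix.mulVec, dotProduct, mul_pow, Matrix.mul_apply]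
      ring
    have hd : (0 : ℝ) < d := by exact_mod_cast NeZero.pos d
    have f1 := e1.symm.trans (hsum 1 le_rfl)
    have f2 := e2.symm.trans (hsum 2 (by norm_num))
    have f3 : ‖l 0 * r 0‖ ^ 2 = 1 := by
      have : ‖l 0 * r 0‖ ^ 2 * (d : ℝ) ^ 2 = 1 * (d : ℝ) ^ 2 := by
        have : (‖l 0 * r 0‖ ^ 2 * t) ^ 2 = ‖l 0 * r 0‖ ^ 2 * (‖l 0 * r 0‖ ^ 2 * t ^ 2) := by ring
        rw [f1, f2] at this
        linarith
      exact mul_right_cancel₀ (by positivity) this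
    rw [Matrix.mem_unitaryGroup_iff', Matrix.star_eq_conjTranspose]
    ext x y
    rw [Subsingleton.elim x y, Matrix.one_apply_eq, Matrix.mul_apply, Fintype.sum_subsingleton _ y]
    rw [Matrix.conjTranspose_apply, Complex.star_def, ← Complex.normSq_eq_conj_mul_self,
      Complex.normSq_eq_norm_sq]
    have : mpo A l r 0 y y = l 0 * r 0 := by simp [mpo, bondProd, dotProduct]
    rw [this, f3]; simp
  · exact hU N h

end Environments

/-! ### Merging encodings of matrix-product unitaries -/

section MergeMPO

variable {d D : ℕ} [NeZero d] {A : Fin d → Fin d → Matrix (Fin D) (Fin D) ℂ} {l r : Fin D → ℂ}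

lemma sum_comm_pairs {α β γ δ M : Type} [Fintype α] [Fintype β] [Fintype γ] [Fintype δ]
    [AddCommMonoid M] (f : α → β → γ → δ → M) :
    ∑ a, ∑ b, ∑ c, ∑ e, f a b c e = ∑ c, ∑ e, ∑ a, ∑ b, f a b c e := by
  simp only [← Fintype.sum_prod_type']
  exact Fintype.sum_equiv
    { toFun := fun ⟨a, b, c, e⟩ => (c, e, a, b)
      invFun := fun ⟨c, e, a, b⟩ => (a, b, c, e)
      left_inv := fun _ => rfl
      right_inv := fun _ => rfl } _ _ fun _ => rfl

lemma sum_sumArrow_assoc {m m' : ℕ} {X : Type} [Fintype X] [DecidableEq X]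
    (F : ((Fin m ⊕ Fin m') ⊕ X → Fin d) → ℂ) : ∑ k, F k =
      ∑ g : X → Fin d, ∑ v : Fin m → Fin d, ∑ v' : Fin m' → Fin d,
        F (Sum.elim (Sum.elim v v') g) := by
  rw [sum_sumArrow, Finset.sum_comm]
  exact Finset.sum_congr rfl fun g _ => sum_sumArrow _

lemma sum_purified {m m' : ℕ}
    (F : (Fin m → Fin d) × (Fin m → Fin d) → (Fin m' → Fin d) × (Fin m' → Fin d) → ℂ) :
    ∑ k : (Fin m ⊕ Fin m') ⊕ (Fin m ⊕ Fin m') → Fin d,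
      F (k ∘ Sum.inl ∘ Sum.inl, k ∘ Sum.inr ∘ Sum.inl)
        (k ∘ Sum.inl ∘ Sum.inr, k ∘ Sum.inr ∘ Sum.inr) = ∑ i, ∑ j, F i j := by
  rw [sum_sumArrow_assoc, sum_sumArrow]
  simp only [← Fintype.sum_prod_type']
  exact Fintype.sum_equiv
    { toFun := fun ⟨g, g', u, u'⟩ => ((u, g), (u', g'))
      invFun := fun ⟨(u, g), (u', g')⟩ => (g, g', u, u')
      left_inv := fun _ => rfl
      right_inv := fun _ => rfl } _ _ fun _ => rfl

/-- The amplitude of the merged encoding. -/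
lemma merge_sum_eq {n₁ n₂ m m' : ℕ} (Sσ : Matrix (Fin m' → Fin d) (Fin m' → Fin d) ℂ)
    (Sτ : Matrix (Fin m → Fin d) (Fin m → Fin d) ℂ)
    {φ : (Fin m → Fin d) × (Fin m → Fin d) → (Fin m' → Fin d) × (Fin m' → Fin d) → ℂ}
    (hφ : ∀ a b, ∑ i, ∑ j, star (φ i j) * (rightVec A r Sτ a i * leftVec A l Sσ b j) =
      if a = b then 1 else 0)
    (x y : Fin n₁ ⊕ Fin n₂ → Fin d) :
    ∑ k : (Fin m ⊕ Fin m') ⊕ (Fin m ⊕ Fin m') → Fin d,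
      ∑ k' : (Fin m ⊕ Fin m') ⊕ (Fin m ⊕ Fin m') → Fin d,
      star (φ (k ∘ Sum.inl ∘ Sum.inl, k ∘ Sum.inr ∘ Sum.inl)
          (k ∘ Sum.inl ∘ Sum.inr, k ∘ Sum.inr ∘ Sum.inr)) * (if k ∘ Sum.inr = k' ∘ Sum.inr then
        mpo A l r (n₁ + m) (Sum.elim (x ∘ Sum.inl) (k ∘ Sum.inl ∘ Sum.inl) ∘ finSumFinEquiv.symm)
          (Sum.elim (y ∘ Sum.inl) (k' ∘ Sum.inl ∘ Sum.inl) ∘ finSumFinEquiv.symm) *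
        mpo A l r (m' + n₂) (Sum.elim (k ∘ Sum.inl ∘ Sum.inr) (x ∘ Sum.inr) ∘ finSumFinEquiv.symm)
          (Sum.elim (k' ∘ Sum.inl ∘ Sum.inr) (y ∘ Sum.inr) ∘ finSumFinEquiv.symm) else 0) *
        (Sτ (k' ∘ Sum.inl ∘ Sum.inl) (k' ∘ Sum.inr ∘ Sum.inl) *
          Sσ (k' ∘ Sum.inl ∘ Sum.inr) (k' ∘ Sum.inr ∘ Sum.inr)) =
      mpo A l r (n₁ + n₂) (x ∘ finSumFinEquiv.symm) (y ∘ finSumFinEquiv.symm) := by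
  set α := Matrix.vecMul l (bondProd A (x ∘ Sum.inl) (y ∘ Sum.inl)) with hα
  set β := Matrix.mulVec (bondProd A (x ∘ Sum.inr) (y ∘ Sum.inr)) r with hβ
  simp only [mpo_add]
  -- Summing over the inputs of the extra sites turns the purifications into `rightVec` and
  -- `leftVec`, with two independent open bonds `a` and `b`.
  have hinner : ∀ (u g : Fin m → Fin d) (u' g' : Fin m' → Fin d),
      ∑ v, ∑ v', (α ⬝ᵥ Matrix.mulVec (bondProd A u v) r) *
        (Matrix.vecMul l (bondProd A u' v') ⬝ᵥ β) * (Sτ v g * Sσ v' g') =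
      ∑ a, ∑ b, α a * β b * (rightVec A r Sτ a (u, g) * leftVec A l Sσ b (u', g')) := by
    intro u g u' g'
    simp only [dotProduct, rightVec, leftVec, Finset.sum_mul, Finset.mul_sum]
    simp only [← Fintype.sum_prod_type']
    refine Fintype.sum_equiv
      { toFun := fun ⟨v, v', b, a⟩ => (a, b, v', v)
        invFun := fun ⟨a, b, v', v⟩ => (v, v', b, a)
        left_inv := fun _ => rfl
        right_inv := fun _ => rfl } _ _ ?_
    rintro ⟨v, v', b, a⟩
    simp only [Equiv.coe_fn_mk]
    ring
  have hstep : ∀ k : (Fin m ⊕ Fin m') ⊕ (Fin m ⊕ Fin m') → Fin d,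
      ∑ k' : (Fin m ⊕ Fin m') ⊕ (Fin m ⊕ Fin m') → Fin d,
      star (φ (k ∘ Sum.inl ∘ Sum.inl, k ∘ Sum.inr ∘ Sum.inl)
          (k ∘ Sum.inl ∘ Sum.inr, k ∘ Sum.inr ∘ Sum.inr)) * (if k ∘ Sum.inr = k' ∘ Sum.inr then
        (α ⬝ᵥ Matrix.mulVec (bondProd A (k ∘ Sum.inl ∘ Sum.inl) (k' ∘ Sum.inl ∘ Sum.inl)) r) *
        (Matrix.vecMul l (bondProd A (k ∘ Sum.inl ∘ Sum.inr) (k' ∘ Sum.inl ∘ Sum.inr)) ⬝ᵥ β)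
          else 0) *
        (Sτ (k' ∘ Sum.inl ∘ Sum.inl) (k' ∘ Sum.inr ∘ Sum.inl) *
          Sσ (k' ∘ Sum.inl ∘ Sum.inr) (k' ∘ Sum.inr ∘ Sum.inr)) =
      star (φ (k ∘ Sum.inl ∘ Sum.inl, k ∘ Sum.inr ∘ Sum.inl)
          (k ∘ Sum.inl ∘ Sum.inr, k ∘ Sum.inr ∘ Sum.inr)) *
        ∑ a, ∑ b, α a * β b *
          (rightVec A r Sτ a (k ∘ Sum.inl ∘ Sum.inl, k ∘ Sum.inr ∘ Sum.inl) *
            leftVec A l Sσ b (k ∘ Sum.inl ∘ Sum.inr, k ∘ Sum.inr ∘ Sum.inr)) := by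
    intro k
    rw [← hinner, sum_sumArrow_assoc, Finset.sum_eq_single (k ∘ Sum.inr)]
    · simp only [Finset.mul_sum]
      refine Finset.sum_congr rfl fun v _ => Finset.sum_congr rfl fun v' _ => ?_
      rw [if_pos (show k ∘ Sum.inr = Sum.elim (Sum.elim v v') (k ∘ Sum.inr) ∘ Sum.inr from rfl),
        mul_assoc]
      rfl
    · intro g _ hg
      refine Finset.sum_eq_zero fun v _ => Finset.sum_eq_zero fun v' _ => ?_
      rw [if_neg (show ¬ k ∘ Sum.inr = Sum.elim (Sum.elim v v') g ∘ Sum.inr from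
        fun h => hg h.symm), mul_zero, zero_mul]
    · exact fun h => absurd (Finset.mem_univ _) h
  refine (Finset.sum_congr rfl fun k _ => hstep k).trans ?_
  rw [sum_purified fun i j => star (φ i j) *
    ∑ a, ∑ b, α a * β b * (rightVec A r Sτ a i * leftVec A l Sσ b j)]
  have hswap : ∑ i, ∑ j, star (φ i j) *
        ∑ a, ∑ b, α a * β b * (rightVec A r Sτ a i * leftVec A l Sσ b j) =
      ∑ a, ∑ b, α a * β b *
        ∑ i, ∑ j, star (φ i j) * (rightVec A r Sτ a i * leftVec A l Sσ b j) := by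
    simp only [Finset.mul_sum]
    rw [sum_comm_pairs]
    refine Finset.sum_congr rfl fun a _ => Finset.sum_congr rfl fun b _ =>
      Finset.sum_congr rfl fun i _ => Finset.sum_congr rfl fun j _ => ?_
    ring
  rw [hswap]
  -- The overlaps `δ a b` join the two open bonds, leaving `α ⬝ᵥ β`, the operator on the joined
  -- chain.
  simp only [hφ, mul_ite, mul_one, mul_zero, Finset.sum_ite_eq, Finset.mem_univ, if_true]
  rfl

set_option synthInstance.maxHeartbeats 400000 in
set_option synthInstance.maxSize 1000 in
-- `V` prepares the purifications of `τ` and `σ`, and `W` prepares `q⁻¹ • φ`, a unit vector since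
-- `‖φ‖² = q²`; this normalisation is the loss of amplitude. Both act on `2 * (m + m')` qudits, so
-- `c` does not depend on the lengths of the chains.
lemma exists_merge_cost {m m' : ℕ} {σ : Matrix (Fin m' → Fin d) (Fin m' → Fin d) ℂ}
    {τ : Matrix (Fin m → Fin d) (Fin m → Fin d) ℂ} (hσ : IsDensity σ) (hτ : IsDensity τ)
    (hP : IsUnit (leftEnv A l σ)) (hQ : IsUnit (rightEnv A r τ)) {q : ℝ} (hq : 0 < q)
    (hq2 : q ^ 2 = (Matrix.trace ((rightEnv A r τ)⁻¹ * ((leftEnv A l σ)⁻¹).transpose)).re) :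
    ∃ c, ∀ {n₁ n₂ f₁ f₂ a₁ a₂ T : ℕ} {s₁ s₂ : ℝ}, HasEncoding (mpo A l r (n₁ + m)) s₁ f₁ a₁ T →
      HasEncoding (mpo A l r (m' + n₂)) s₂ f₂ a₂ T →
      HasEncoding (mpo A l r (n₁ + n₂)) (s₁ * s₂ * q⁻¹) (f₁ + f₂ + 2 * (m + m')) (a₁ + a₂)
        (T + c) := by
  obtain ⟨Sσ, hSσ, hSσ1⟩ := hσ.exists_sqrt
  obtain ⟨Sτ, hSτ, hSτ1⟩ := hτ.exists_sqrt
  rw [← hSσ, ← gramMat_leftVec] at hP hq2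
  rw [← hSτ, ← gramMat_rightVec] at hQ hq2
  obtain ⟨φ, hφ, hφq⟩ := exists_dualVector hQ hP
  rw [← hq2] at hφq
  obtain ⟨TW, W, hW, hW0⟩ := exists_statePreparation
    (ι := (Fin m ⊕ Fin m') ⊕ (Fin m ⊕ Fin m')) (d := d) (fun _ => 0)
    (fun k => (q : ℂ)⁻¹ * φ (k ∘ Sum.inl ∘ Sum.inl, k ∘ Sum.inr ∘ Sum.inl)
          (k ∘ Sum.inl ∘ Sum.inr, k ∘ Sum.inr ∘ Sum.inr)) (by
      refine (sum_purified fun i j => star ((q : ℂ)⁻¹ * φ i j) * ((q : ℂ)⁻¹ * φ i j)).trans ?_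
      have h1 : ∀ i j, star ((q : ℂ)⁻¹ * φ i j) * ((q : ℂ)⁻¹ * φ i j) =
          (((q ^ 2)⁻¹ * ‖φ i j‖ ^ 2 : ℝ) : ℂ) := by
        intro i j
        rw [Complex.star_def, ← Complex.normSq_eq_conj_mul_self, Complex.normSq_eq_norm_sq,
          norm_mul, norm_inv, Complex.norm_real, Real.norm_of_nonneg hq.le, mul_pow, inv_pow]
      simp only [h1, ← Complex.ofReal_sum, ← Finset.mul_sum]
      rw [hφq, inv_mul_cancel₀ (by positivity), Complex.ofReal_one])
  obtain ⟨TV, V, hV, hV0⟩ := exists_statePreparation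
    (ι := (Fin m ⊕ Fin m') ⊕ (Fin m ⊕ Fin m')) (d := d) (fun _ => 0)
    (fun k => Sτ (k ∘ Sum.inl ∘ Sum.inl) (k ∘ Sum.inr ∘ Sum.inl) *
          Sσ (k ∘ Sum.inl ∘ Sum.inr) (k ∘ Sum.inr ∘ Sum.inr)) (by
      refine (sum_purified fun i j => star (Sτ i.1 i.2 * Sσ j.1 j.2) *
        (Sτ i.1 i.2 * Sσ j.1 j.2)).trans ?_
      have h1 : ∀ (i : (Fin m → Fin d) × (Fin m → Fin d)) (j : (Fin m' → Fin d) × (Fin m' → Fin d)),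
          star (Sτ i.1 i.2 * Sσ j.1 j.2) * (Sτ i.1 i.2 * Sσ j.1 j.2) =
          (star (Sτ i.1 i.2) * Sτ i.1 i.2) * (star (Sσ j.1 j.2) * Sσ j.1 j.2) := by
        intro i j; rw [star_mul']; ring
      simp only [h1, ← Finset.mul_sum, ← Finset.sum_mul]
      rw [Fintype.sum_prod_type, Fintype.sum_prod_type, hSσ1, hSτ1, mul_one])
  refine ⟨TV + TW, ?_⟩
  rintro n₁ n₂ f₁ f₂ a₁ a₂ T s₁ s₂ ⟨M₁, hM₁, h₁⟩ ⟨M₂, hM₂, h₂⟩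
  have h₁' := h₁.relabel finSumFinEquiv.symm (Equiv.refl _) (Equiv.refl _)
    (U' := fun x y => mpo A l r (n₁ + m) (x ∘ finSumFinEquiv.symm) (y ∘ finSumFinEquiv.symm))
    fun _ _ => rfl
  have h₂' := h₂.relabel finSumFinEquiv.symm (Equiv.refl _) (Equiv.refl _)
    (U' := fun x y => mpo A l r (m' + n₂) (x ∘ finSumFinEquiv.symm) (y ∘ finSumFinEquiv.symm))
    fun _ _ => rfl
  have hm := Encodes.merge h₁' h₂' V W (t := q⁻¹)
    (U := fun x y => mpo A l r (n₁ + n₂) (x ∘ finSumFinEquiv.symm) (y ∘ finSumFinEquiv.symm)) (by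
      intro x y
      rw [← merge_sum_eq Sσ Sτ hφ x y, Finset.mul_sum]
      refine Finset.sum_congr rfl fun k _ => ?_
      rw [Finset.mul_sum]
      refine Finset.sum_congr rfl fun k' _ => ?_
      rw [hW0, hV0, star_mul', star_inv₀, Complex.star_def, Complex.conj_ofReal,
        Complex.ofReal_inv]
      simp only [mul_assoc])
  refine HasEncoding.of_encodes ?_ hm finSumFinEquiv (by simp; ring) (by simp) fun x y => ?_
  · have hp := CircuitOp.par mergeLeft mergeRight (disjoint_mergeLeft_mergeRight
      (σ₁ := Fin n₁) (σ₂ := Fin n₂) (κ₁ := Fin m) (κ₂ := Fin m') (G := Fin m ⊕ Fin m')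
      (F₁ := Fin f₁) (F₂ := Fin f₂) (Q₁ := Fin a₁) (Q₂ := Fin a₂))
      (hM₁.embed (Equiv.sumCongr finSumFinEquiv.symm
        (Equiv.sumCongr (Equiv.refl _) (Equiv.refl _))).toEmbedding)
      (hM₂.embed (Equiv.sumCongr finSumFinEquiv.symm
        (Equiv.sumCongr (Equiv.refl _) (Equiv.refl _))).toEmbedding)
    have := ((hW.star.embed mergeAux).mul hp).mul (hV.embed mergeAux)
    refine this.mono ?_
    omega
  · congr 1 <;> funext i <;> simp

end MergeMPO

/-! ### The conditioning number -/

section Conditioning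

variable {d D : ℕ} [NeZero d] {A : Fin d → Fin d → Matrix (Fin D) (Fin D) ℂ} {l r : Fin D → ℂ}

/-- The dimension of the bond space is a lower bound on the conditioning number. -/
lemma IsUniformBulkMPU.card_sq_le (hU : IsUniformBulkMPU A l r) {m m' : ℕ}
    {σ : Matrix (Fin m' → Fin d) (Fin m' → Fin d) ℂ}
    {τ : Matrix (Fin m → Fin d) (Fin m → Fin d) ℂ} (hσ : IsDensity σ) (hτ : IsDensity τ)
    (hP : IsUnit (leftEnv A l σ)) (hQ : IsUnit (rightEnv A r τ)) :
    (D : ℝ) ^ 2 ≤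
      (Matrix.trace ((rightEnv A r τ)⁻¹ * ((leftEnv A l σ)⁻¹).transpose)).re := by
  have hmem : mpo A l r (m' + m) ∈ Matrix.unitaryGroup (Fin (m' + m) → Fin d) ℂ := by
    rcases Nat.eq_zero_or_pos m' with h | h
    · subst h
      exact hU.mem_of_card_le_one (card_le_one_of_leftEnv_zero A l hP) _
    · exact hU _ (by omega)
  have h1 := sum_rightEnv_mul_leftEnv A l r hσ hτ hmem
  obtain ⟨Sσ, hSσ, -⟩ := hσ.exists_sqrt
  obtain ⟨Sτ, hSτ, -⟩ := hτ.exists_sqrt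
  rw [← hSσ, ← gramMat_leftVec] at hP h1 ⊢
  rw [← hSτ, ← gramMat_rightVec] at hQ h1 ⊢
  obtain ⟨φ, hφ, hφq⟩ := exists_dualVector hQ hP
  rw [← hφq]
  exact card_le_of_overlap hφ h1

lemma IsUniformBulkMPU.le_of_mem_condValues (hU : IsUniformBulkMPU A l r) {q : ℝ}
    (hq : q ∈ condValues A l r) : (D : ℝ) ≤ q := by
  obtain ⟨P, ⟨hP, m', σ, hσ, rfl⟩, Q, ⟨hQ, m, τ, hτ, rfl⟩, rfl⟩ := hq
  exact Real.le_sqrt_of_sq_le (hU.card_sq_le hσ hτ hP.isUnit hQ.isUnit)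

lemma isDensity_maximallyMixed : IsDensity (((d : ℂ)⁻¹) •
    (1 : Matrix (Fin 1 → Fin d) (Fin 1 → Fin d) ℂ)) := by
  have hd : (d : ℂ) ≠ 0 := by exact_mod_cast NeZero.ne d
  constructor
  · refine Matrix.PosSemidef.one.smul ?_
    rw [← Complex.ofReal_natCast, ← Complex.ofReal_inv]
    exact Complex.zero_le_real.2 (by positivity)
  · rw [Matrix.trace_smul, Matrix.trace_one]
    simp [hd]

lemma injective_mulVec_of_rank {I : Type} [Fintype I] {B : Matrix I (Fin D) ℂ} (h : B.rank = D) :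
    Function.Injective B.mulVec := by
  rw [Matrix.mulVec_injective_iff, linearIndependent_iff_card_eq_finrank_span]
  rw [Fintype.card_fin, Set.finrank, ← Matrix.rank_eq_finrank_span_cols, h]

lemma posDef_gram {I : Type} [Fintype I] {B : Matrix I (Fin D) ℂ} (h : B.rank = D) {c : ℝ}
    (hc : 0 < c) : ((c : ℂ) • (B.conjTranspose * B)).PosDef := by
  refine (Matrix.PosDef.conjTranspose_mul_self B (injective_mulVec_of_rank h)).smul ?_
  exact_mod_cast hc

lemma leftEnv_maximallyMixed : leftEnv A l (((d : ℂ)⁻¹) •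
      (1 : Matrix (Fin 1 → Fin d) (Fin 1 → Fin d) ℂ)) =
    (((d : ℝ)⁻¹ : ℝ) : ℂ) • ((leftBoundaryTensor A l).conjTranspose * leftBoundaryTensor A l) := by
  ext a' a
  rw [Matrix.smul_apply, Matrix.mul_apply, Fintype.sum_prod_type]
  simp only [leftEnv, Matrix.smul_apply, Matrix.one_apply, smul_eq_mul, mul_ite, mul_one, mul_zero,
    ite_mul, zero_mul, Finset.sum_ite_eq, Finset.mem_univ, if_true]
  rw [Finset.mul_sum, ← (Equiv.funUnique (Fin 1) (Fin d)).symm.sum_comp]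
  refine Finset.sum_congr rfl fun i _ => ?_
  rw [Finset.mul_sum, ← (Equiv.funUnique (Fin 1) (Fin d)).symm.sum_comp]
  refine Finset.sum_congr rfl fun j _ => ?_
  simp [bondProd, leftBoundaryTensor, mul_assoc]

lemma rightEnv_maximallyMixed : rightEnv A r (((d : ℂ)⁻¹) •
      (1 : Matrix (Fin 1 → Fin d) (Fin 1 → Fin d) ℂ)) =
    (((d : ℝ)⁻¹ : ℝ) : ℂ) • ((rightBoundaryTensor A r).conjTranspose * rightBoundaryTensor A r) := by
  ext a' a
  rw [Matrix.smul_apply, Matrix.mul_apply, Fintype.sum_prod_type]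
  simp only [rightEnv, Matrix.smul_apply, Matrix.one_apply, smul_eq_mul, mul_ite, mul_one, mul_zero,
    ite_mul, zero_mul, Finset.sum_ite_eq, Finset.mem_univ, if_true]
  rw [Finset.mul_sum, ← (Equiv.funUnique (Fin 1) (Fin d)).symm.sum_comp]
  refine Finset.sum_congr rfl fun i _ => ?_
  rw [Finset.mul_sum, ← (Equiv.funUnique (Fin 1) (Fin d)).symm.sum_comp]
  refine Finset.sum_congr rfl fun j _ => ?_
  simp [bondProd, rightBoundaryTensor, mul_assoc]

/-- For the maximally mixed state of one site the environment is `d⁻¹ • (Bᴴ * B)` with `B` the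
boundary tensor, hence positive definite by full rank. -/
lemma condValues_nonempty (hA : FullRankBoundaries A l r) : (condValues A l r).Nonempty := by
  have hd : (0 : ℝ) < (d : ℝ)⁻¹ := inv_pos.2 (by exact_mod_cast NeZero.pos d)
  refine ⟨_, _, ⟨?_, 1, _, isDensity_maximallyMixed, rfl⟩, _,
    ⟨?_, 1, _, isDensity_maximallyMixed, rfl⟩, rfl⟩
  · rw [leftEnv_maximallyMixed]
    exact posDef_gram hA.1 hd
  · rw [rightEnv_maximallyMixed]
    exact posDef_gram hA.2 hd

lemma IsUniformBulkMPU.le_qUnif (hU : IsUniformBulkMPU A l r) (hA : FullRankBoundaries A l r) :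
    (D : ℝ) ≤ qUnif A l r :=
  le_csInf (condValues_nonempty hA) fun _ h => hU.le_of_mem_condValues h

/-- The boundary tensor has `d ^ 2` rows, too few for rank at least two if `d = 1`. Dilution needs
the second level of a qudit. -/
lemma FullRankBoundaries.two_le (hA : FullRankBoundaries A l r) (hD : 2 ≤ D) : 2 ≤ d := by
  by_contra h
  have h1 := Matrix.rank_le_card_height (leftBoundaryTensor A l)
  rw [hA.1, Fintype.card_prod, Fintype.card_fin] at h1
  have : d = 1 := by have := NeZero.pos d; omega
  subst this
  omega

/-- Merging encodings of matrix-product unitaries at a cost independent of their sizes, with an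
amplitude given by any element of `condValues`. -/
lemma IsUniformBulkMPU.exists_merge (hU : IsUniformBulkMPU A l r) {q : ℝ}
    (hq : q ∈ condValues A l r) : ∃ m m' g c : ℕ,
    ∀ {n₁ n₂ f₁ f₂ a₁ a₂ T : ℕ} {s₁ s₂ : ℝ}, HasEncoding (mpo A l r (n₁ + m)) s₁ f₁ a₁ T →
      HasEncoding (mpo A l r (m' + n₂)) s₂ f₂ a₂ T →
      HasEncoding (mpo A l r (n₁ + n₂)) (s₁ * s₂ * q⁻¹) (f₁ + f₂ + g) (a₁ + a₂) (T + c) := by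
  have hDq := hU.le_of_mem_condValues hq
  have hq0 : 0 < q := lt_of_lt_of_le (by exact_mod_cast hU.pos) hDq
  obtain ⟨P, ⟨hP, m', σ, hσ, rfl⟩, Q, ⟨hQ, m, τ, hτ, rfl⟩, rfl⟩ := hq
  obtain ⟨c, hc⟩ := exists_merge_cost hσ hτ hP.isUnit hQ.isUnit hq0
    (Real.sq_sqrt ((sq_nonneg _).trans (hU.card_sq_le hσ hτ hP.isUnit hQ.isUnit)))
  exact ⟨m, m', _, c, hc⟩

end Conditioning

/-! ### Two rounds of amplitude amplification -/

section Rounds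

lemma one_sub_sq_div_two_le_sin (x : ℝ) : 1 - (Real.pi / 2 - x) ^ 2 / 2 ≤ Real.sin x := by
  rw [← Real.cos_pi_div_two_sub]
  exact Real.one_sub_sq_div_two_le_cos

/-- The tightest use, in `exists_rounds`, is `k₁ = 2`, `k₂ = 3`, `q' = 4`, which requires `2π/7 ≈
0.8976`. -/
lemma sin_five_quarters_bound : (0.8997 : ℝ) ≤ Real.sin (5 / 4) ^ 2 ∧ 0 < Real.sin (5 / 4) := by
  have h := one_sub_sq_div_two_le_sin (5 / 4)
  have h1 := Real.pi_gt_d4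
  have h2 := Real.pi_lt_d4
  have h3 : (Real.pi / 2 - 5 / 4) ^ 2 ≤ 0.3208 ^ 2 := by
    apply pow_le_pow_left₀ <;> linarith
  have h4 : (0.94854 : ℝ) ≤ Real.sin (5 / 4) := by norm_num at h3 ⊢; linarith
  exact ⟨by nlinarith, by linarith⟩

/-- Used with `q' = 3` and `k₂ = 3`, where `3π/14 ≈ 0.673` is required. -/
lemma sin_one_bound : (0.69 : ℝ) ≤ Real.sin 1 ^ 2 ∧ 0 < Real.sin 1 := by
  have h := one_sub_sq_div_two_le_sin 1
  have h1 := Real.pi_gt_d4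
  have h2 := Real.pi_lt_d4
  have h3 : (Real.pi / 2 - 1) ^ 2 ≤ 0.5708 ^ 2 := by
    apply pow_le_pow_left₀ <;> linarith
  have h4 : (0.837 : ℝ) ≤ Real.sin 1 := by norm_num at h3 ⊢; linarith
  exact ⟨by nlinarith, by linarith⟩

/-- Numbers of amplification rounds for two successive merges of amplitude `q⁻¹`. -/
lemma exists_rounds {q : ℝ} (hq : 2 ≤ q) : ∃ (k₁ k₂ : ℕ) (θ q' : ℝ), 1 ≤ k₁ ∧ q < q' ∧
    (((2 * k₁ + 1) * (2 * k₂ + 1) : ℕ) : ℝ) ≤ 4 * q ^ 2 ∧ 0 ≤ Real.sin θ ∧ Real.sin θ ≤ q'⁻¹ ∧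
    0 < Real.sin ((2 * k₁ + 1) * θ) ∧
    Real.sin (Real.pi / (2 * (2 * k₂ + 1))) ≤ Real.sin ((2 * k₁ + 1) * θ) ^ 2 * q'⁻¹ := by
  have hpi := Real.pi_lt_d4
  have hpi0 := Real.pi_gt_d4
  -- The bound `sin x ≤ x` at both small angles leaves one inequality to be checked in each case.
  have main : ∀ (k₁ k₂ : ℕ) (θ q' : ℝ), 0 < q' → 0 ≤ θ → θ ≤ q'⁻¹ → q'⁻¹ ≤ 1 →
      q' * (Real.pi / (2 * (2 * k₂ + 1))) ≤ Real.sin ((2 * k₁ + 1) * θ) ^ 2 →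
      0 ≤ Real.sin θ ∧ Real.sin θ ≤ q'⁻¹ ∧
      Real.sin (Real.pi / (2 * (2 * k₂ + 1))) ≤ Real.sin ((2 * k₁ + 1) * θ) ^ 2 * q'⁻¹ := by
    intro k₁ k₂ θ q' h0 h1 h2 h3 h4
    refine ⟨Real.sin_nonneg_of_nonneg_of_le_pi h1 (by linarith), (Real.sin_le h1).trans h2, ?_⟩
    refine (Real.sin_le (by positivity)).trans ?_
    rw [← div_eq_mul_inv, le_div_iff₀ h0, mul_comm]
    exact h4
  obtain ⟨s1, s1'⟩ := sin_five_quarters_bound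
  obtain ⟨s2, s2'⟩ := sin_one_bound
  -- The inner angle `(2 * k₁ + 1) * θ` is set to `5/4` or `1`, short of `π/2`. For small `q` the
  -- call counts are `3 * 5 ≤ 4 * 2 ^ 2` and `3 * 7 ≤ 4 * 2.4 ^ 2`.
  rcases lt_or_ge q 2.4 with h | h
  · refine ⟨1, 2, 1 / 2.4, 2.4, le_rfl, h, by norm_num; nlinarith, ?_⟩
    have e : (2 * ((1 : ℕ) : ℝ) + 1) * (1 / 2.4) = 5 / 4 := by norm_num
    have := main 1 2 (1 / 2.4) 2.4 (by norm_num) (by norm_num) (by norm_num) (by norm_num)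
      (by rw [e]; push_cast; linarith)
    rw [e] at this ⊢
    exact ⟨this.1, this.2.1, s1', this.2.2⟩
  rcases lt_or_ge q 3 with h' | h'
  · refine ⟨1, 3, 1 / 3, 3, le_rfl, h', by norm_num; nlinarith, ?_⟩
    have e : (2 * ((1 : ℕ) : ℝ) + 1) * (1 / 3) = 1 := by norm_num
    have := main 1 3 (1 / 3) 3 (by norm_num) (by norm_num) (by norm_num) (by norm_num)
      (by rw [e]; push_cast; linarith)
    rw [e] at this ⊢
    exact ⟨this.1, this.2.1, s2', this.2.2⟩
  -- With `k₁ = ⌊q⌋ - 1`, `k₂ = ⌊q⌋` the product of the call counts is `4⌊q⌋² - 1`, and `q' = ⌊q⌋ +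
  -- 1` still exceeds `q`.
  · have hK : 3 ≤ ⌊q⌋₊ := Nat.le_floor (by exact_mod_cast h')
    obtain ⟨j, hj⟩ : ∃ j, ⌊q⌋₊ = j + 1 := ⟨⌊q⌋₊ - 1, by omega⟩
    have hj2 : (2 : ℝ) ≤ j := by exact_mod_cast (by omega : 2 ≤ j)
    have hle : (j : ℝ) + 1 ≤ q := by
      have := Nat.floor_le (by linarith : 0 ≤ q)
      rw [hj] at this; exact_mod_cast this
    have hlt : q < (j : ℝ) + 2 := by
      have := Nat.lt_floor_add_one q
      rw [hj] at this; push_cast at this; linarith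
    have hpos : (0 : ℝ) < 2 * j + 1 := by linarith
    have e : (2 * (j : ℝ) + 1) * (5 / (4 * (2 * j + 1))) = 5 / 4 := by field_simp
    refine ⟨j, j + 1, 5 / (4 * (2 * j + 1)), j + 2, by omega, hlt, by push_cast; nlinarith, ?_⟩
    have := main j (j + 1) (5 / (4 * (2 * j + 1))) (j + 2) (by linarith) (by positivity)
      (by rw [← one_div, div_le_div_iff₀ (by positivity) (by linarith)]; linarith)
      (inv_le_one_of_one_le₀ (by linarith))
      (by
        rw [e]
        push_cast
        rw [← mul_div_assoc, div_le_iff₀ (by positivity)]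
        nlinarith)
    rw [e] at this ⊢
    exact ⟨this.1, this.2.1, s1', this.2.2⟩

variable {d D : ℕ} [NeZero d] {A : Fin d → Fin d → Matrix (Fin D) (Fin D) ℂ} {l r : Fin D → ℂ}

/-- Four encodings are combined exactly, with a multiplicative increase of the depth of at most
`4 * qUnif ^ 2`. -/
lemma IsUniformBulkMPU.exists_quadruple (hU : IsUniformBulkMPU A l r)
    (hA : FullRankBoundaries A l r) (hD : 2 ≤ D) : ∃ m m' B G E : ℕ, 2 ≤ B ∧
    (B : ℝ) ≤ 4 * qUnif A l r ^ 2 ∧ ∀ {n₁ n₂ p₁ p₂ r₁ r₂ a₁ a₂ b₁ b₂ T : ℕ},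
      p₁ + p₂ = n₁ + m → r₁ + r₂ = m' + n₂ → 1 ≤ n₁ → 1 ≤ n₂ →
      HasEncoding (mpo A l r (p₁ + m)) 1 0 a₁ T → HasEncoding (mpo A l r (m' + p₂)) 1 0 a₂ T →
      HasEncoding (mpo A l r (r₁ + m)) 1 0 b₁ T → HasEncoding (mpo A l r (m' + r₂)) 1 0 b₂ T →
      HasEncoding (mpo A l r (n₁ + n₂)) 1 0 (G + (a₁ + a₂ + b₁ + b₂)) (B * T + E) := by
  have hd := hA.two_le hD
  have hq2 : 2 ≤ qUnif A l r := le_trans (by exact_mod_cast hD) (hU.le_qUnif hA)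
  obtain ⟨k₁, k₂, θ, q', hk₁, hqq', hB, hθ0, hθ1, hs0, hs1⟩ := exists_rounds hq2
  -- The infimum need not be attained; the slack `q'` admits an actual pair of environments.
  obtain ⟨q, hq, hlt⟩ := exists_lt_of_csInf_lt (condValues_nonempty hA) hqq'
  have hq0 : 0 < q := lt_of_lt_of_le (by exact_mod_cast hU.pos) (hU.le_of_mem_condValues hq)
  obtain ⟨m, m', g, c, hmerge⟩ := hU.exists_merge hq
  obtain ⟨ρ₁, hρ₁⟩ := exists_amplify_cost d (0 + 0 + g + 1)
  obtain ⟨ρ₂, hρ₂⟩ := exists_amplify_cost d ((0 + 0 + g + 1) + (0 + 0 + g + 1) + g + 1)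
  have hinv : q'⁻¹ ≤ q⁻¹ := inv_anti₀ hq0 hlt.le
  set s := Real.sin ((2 * k₁ + 1) * θ) with hs
  have hpair : ∀ {p₁ p₂ a₁ a₂ T : ℕ}, 1 ≤ p₁ + p₂ → HasEncoding (mpo A l r (p₁ + m)) 1 0 a₁ T →
      HasEncoding (mpo A l r (m' + p₂)) 1 0 a₂ T →
      HasEncoding (mpo A l r (p₁ + p₂)) s (0 + 0 + g + 1) (a₁ + a₂)
        ((2 * k₁ + 1) * (T + c + 1) + k₁ * ρ₁) := by
    intro p₁ p₂ a₁ a₂ T hp h₁ h₂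
    -- The merged amplitude `q⁻¹` is lowered to exactly `sin θ`, so the inner rounds end at the
    -- known amplitude `s`.
    have h := (hmerge h₁ h₂).dilute hd (t := Real.sin θ * q) (by positivity) (by
      rw [← le_div_iff₀ hq0, one_div]; exact hθ1.trans hinv)
    have e : Real.sin θ * q * (1 * 1 * q⁻¹) = Real.sin θ := by field_simp
    rw [e] at h
    exact hρ₁ h (hU _ hp) k₁
  refine ⟨m, m', (2 * k₂ + 1) * (2 * k₁ + 1), (0 + 0 + g + 1) + (0 + 0 + g + 1) + g + 1,
    (2 * k₂ + 1) * ((2 * k₁ + 1) * (c + 1) + k₁ * ρ₁ + c + 1) + k₂ * ρ₂, ?_, ?_, ?_⟩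
  · have h1 : 1 ≤ 2 * k₂ + 1 := by omega
    have h2 : 3 ≤ 2 * k₁ + 1 := by omega
    exact le_trans (by norm_num) (Nat.mul_le_mul h1 h2)
  · rw [mul_comm (2 * k₂ + 1)]; exact hB
  intro n₁ n₂ p₁ p₂ r₁ r₂ a₁ a₂ b₁ b₂ T hp hr hn₁ hn₂ h₁ h₂ h₃ h₄
  have h5 := hpair (by omega) h₁ h₂
  have h6 := hpair (by omega) h₃ h₄
  rw [hp] at h5
  rw [hr] at h6
  set ψ := Real.pi / (2 * (2 * (k₂ : ℝ) + 1)) with hψ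
  have hψ0 : 0 ≤ Real.sin ψ := by
    refine Real.sin_nonneg_of_nonneg_of_le_pi (by positivity) (div_le_self Real.pi_pos.le ?_)
    have : (0 : ℝ) ≤ k₂ := Nat.cast_nonneg _
    linarith
  -- The outer merge has amplitude `s ^ 2 * q⁻¹`. It is lowered to `sin ψ` with `(2 * k₂ + 1) * ψ =
  -- π / 2`, so that the outer rounds end at amplitude one.
  have h := (hmerge h5 h6).dilute hd (t := Real.sin ψ * q / s ^ 2) (by positivity) (by
      rw [div_le_one (by positivity), ← le_div_iff₀ hq0, div_eq_mul_inv]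
      refine hs1.trans ?_
      gcongr)
  have e : Real.sin ψ * q / s ^ 2 * (s * s * q⁻¹) = Real.sin ψ := by field_simp
  rw [e] at h
  have hψ1 : Real.sin ((2 * k₂ + 1) * ψ) = 1 := by
    have : (2 * (k₂ : ℝ) + 1) * ψ = Real.pi / 2 := by rw [hψ]; field_simp
    rw [this, Real.sin_pi_div_two]
  have h7 := hρ₂ h (hU _ (by omega)) k₂
  rw [hψ1] at h7
  -- The `G` flags become clean qudits, so the next level starts again with no flags.
  have h8 := h7.clean (hU _ (by omega))
  have e1 : (2 * k₂ + 1) * ((2 * k₁ + 1) * (T + c + 1) + k₁ * ρ₁ + c + 1) + k₂ * ρ₂ =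
    (2 * k₂ + 1) * (2 * k₁ + 1) * T +
      ((2 * k₂ + 1) * ((2 * k₁ + 1) * (c + 1) + k₁ * ρ₁ + c + 1) + k₂ * ρ₂) := by ring
  have e2 : a₁ + a₂ + (b₁ + b₂) = a₁ + a₂ + b₁ + b₂ := by ring
  rw [← e1, ← e2]
  exact h8

end Rounds

/-! ### Solving the recursion -/

section Recursion

/-- Divide and conquer with four parts: `P N a T` means that size `N` is solved with `a` units of
space and `T` units of time. -/
lemma exists_bound_of_recursion {P : ℕ → ℕ → ℕ → Prop}
    (hmono : ∀ {N a T T'}, P N a T → T ≤ T' → P N a T')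
    (hbase : ∀ N, 1 ≤ N → ∃ T, P N 0 T) {κ B G E : ℕ} {α : ℝ} (hα : 0 ≤ α) (hB : 2 ≤ B)
    (hBα : (B : ℝ) ≤ 4 ^ α)
    (hstep : ∀ N, 4 ≤ N → ∃ p₁ p₂ p₃ p₄ : ℕ, (∀ p ∈ [p₁, p₂, p₃, p₄], 1 ≤ p ∧ 4 * p ≤ N + 3 * κ) ∧
      ∀ {a₁ a₂ a₃ a₄ T}, P p₁ a₁ T → P p₂ a₂ T → P p₃ a₃ T → P p₄ a₄ T →
        P N (G + (a₁ + a₂ + a₃ + a₄)) (B * T + E)) :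
    ∃ c : ℝ, ∀ N : ℕ, 1 ≤ N → ∃ a T, P N a T ∧ (a : ℝ) ≤ c * N ∧ (T : ℝ) ≤ c * (N : ℝ) ^ α := by
  choose! t ht using hbase
  set M := (Finset.range (κ + 4)).sup t with hM
  set C : ℝ := M + E with hC
  have hC0 : 0 ≤ C := by positivity
  have hBr : (2 : ℝ) ≤ B := by exact_mod_cast hB
  -- The bound is strengthened to survive the induction. In the variable `N - κ` the overlaps
  -- disappear, as `4 * p ≤ N + 3 * κ` means `p - κ ≤ (N - κ) / 4`. The subtracted `G` and `E`
  -- absorb the additive overheads; for `E` this uses `B ≥ 2`.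
  have main : ∀ N : ℕ, 1 ≤ N → ∃ a T, P N a T ∧
      (a : ℝ) ≤ G * max ((N : ℝ) - κ) 1 - G ∧ (T : ℝ) ≤ C * max ((N : ℝ) - κ) 1 ^ α - E := by
    intro N
    induction N using Nat.strong_induction_on with
    | _ N ih =>
    intro hN
    -- From `κ + 4` on, the parts are strictly smaller than `N` and `(N - κ) / 4 ≥ 1`; the finitely
    -- many smaller sizes go into the constant `M`.
    rcases lt_or_ge N (κ + 4) with h | h
    · refine ⟨0, t N, ht N hN, ?_, ?_⟩
      · have : (G : ℝ) * 1 ≤ G * max ((N : ℝ) - κ) 1 := by gcongr; exact le_max_right _ _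
        push_cast; linarith
      · have h1 : t N ≤ M := Finset.le_sup (f := t) (Finset.mem_range.2 h)
        have h1' : (t N : ℝ) ≤ M := by exact_mod_cast h1
        have h2 : (1 : ℝ) ≤ max ((N : ℝ) - κ) 1 ^ α := Real.one_le_rpow (le_max_right _ _) hα
        have h3 : C * 1 ≤ C * max ((N : ℝ) - κ) 1 ^ α := by gcongr
        linarith
    · set X : ℝ := ((N : ℝ) - κ) / 4 with hX
      have hNκ : (κ : ℝ) + 4 ≤ N := by exact_mod_cast h
      have hX1 : 1 ≤ X := by rw [hX]; linarith
      have hmax : max ((N : ℝ) - κ) 1 = 4 * X := by rw [max_eq_left (by linarith), hX]; ring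
      have hT0 : ∀ {p : ℕ}, 1 ≤ p ∧ 4 * p ≤ N + 3 * κ → ∃ a T, P p a T ∧ (a : ℝ) ≤ G * X - G ∧
          (T : ℝ) ≤ C * X ^ α - E := by
        rintro p ⟨hp1, hp2⟩
        obtain ⟨a, T, h1, h2, h3⟩ := ih p (by omega) hp1
        have hp3 : (4 : ℝ) * p ≤ N + 3 * κ := by exact_mod_cast hp2
        have hle : max ((p : ℝ) - κ) 1 ≤ X := max_le (by rw [hX]; linarith) hX1
        refine ⟨a, T, h1, h2.trans ?_, h3.trans ?_⟩ <;> gcongr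
      obtain ⟨p₁, p₂, p₃, p₄, hp, hcomb⟩ := hstep N (by omega)
      obtain ⟨a₁, T₁, h1, ha₁, hT₁⟩ := hT0 (hp p₁ (by simp))
      obtain ⟨a₂, T₂, h2, ha₂, hT₂⟩ := hT0 (hp p₂ (by simp))
      obtain ⟨a₃, T₃, h3, ha₃, hT₃⟩ := hT0 (hp p₃ (by simp))
      obtain ⟨a₄, T₄, h4, ha₄, hT₄⟩ := hT0 (hp p₄ (by simp))
      have hpos : 0 ≤ C * X ^ α - E := (Nat.cast_nonneg T₁).trans hT₁
      refine ⟨_, _, hcomb (hmono h1 (Nat.le_floor hT₁)) (hmono h2 (Nat.le_floor hT₂))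
        (hmono h3 (Nat.le_floor hT₃)) (hmono h4 (Nat.le_floor hT₄)), ?_, ?_⟩
      · rw [hmax]
        push_cast
        have : (0 : ℝ) ≤ G := Nat.cast_nonneg _
        linarith
      · rw [hmax, Real.mul_rpow (by norm_num) (by linarith)]
        push_cast
        have hE : (0 : ℝ) ≤ E := Nat.cast_nonneg _
        have hXα : 0 ≤ X ^ α := by positivity
        calc (B : ℝ) * ⌊C * X ^ α - E⌋₊ + E ≤ B * (C * X ^ α - E) + E := by
              gcongr; exact Nat.floor_le hpos
          _ = B * (C * X ^ α) - (B - 1) * E := by ring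
          _ ≤ 4 ^ α * (C * X ^ α) - 1 * E := by
              gcongr; linarith
          _ = _ := by ring
  refine ⟨max G C, fun N hN => ?_⟩
  obtain ⟨a, T, h, ha, hT⟩ := main N hN
  have hN1 : (1 : ℝ) ≤ N := by exact_mod_cast hN
  have hle : max ((N : ℝ) - κ) 1 ≤ N := max_le (by linarith [Nat.cast_nonneg (α := ℝ) κ]) hN1
  have hE : (0 : ℝ) ≤ E := Nat.cast_nonneg _
  have hG : (0 : ℝ) ≤ G := Nat.cast_nonneg _
  refine ⟨a, T, h, ?_, ?_⟩
  · calc (a : ℝ) ≤ G * max ((N : ℝ) - κ) 1 := by linarith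
      _ ≤ max (G : ℝ) C * N := by gcongr; exact le_max_left _ _
  · calc (T : ℝ) ≤ C * max ((N : ℝ) - κ) 1 ^ α := by linarith
      _ ≤ max (G : ℝ) C * (N : ℝ) ^ α := by gcongr; exact le_max_right _ _

variable {d D : ℕ} [NeZero d] {A : Fin d → Fin d → Matrix (Fin D) (Fin D) ℂ} {l r : Fin D → ℂ}

lemma IsUniformBulkMPU.exists_depth_bound_of_two_le (hU : IsUniformBulkMPU A l r)
    (hA : FullRankBoundaries A l r) (hD : 2 ≤ D) : ∃ c : ℝ, ∀ N : ℕ, 1 ≤ N →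
      ∃ a T, HasEncoding (mpo A l r N) 1 0 a T ∧ (a : ℝ) ≤ c * N ∧
        (T : ℝ) ≤ c * (N : ℝ) ^ (1 + Real.logb 2 (qUnif A l r)) := by
  obtain ⟨m, m', B, G, E, hB2, hB, hcomb⟩ := hU.exists_quadruple hA hD
  have hq2 : 2 ≤ qUnif A l r := le_trans (by exact_mod_cast hD) (hU.le_qUnif hA)
  have hlog : 0 ≤ Real.logb 2 (qUnif A l r) := Real.logb_nonneg (by norm_num) (by linarith)
  have h4 : (4 : ℝ) ^ (1 + Real.logb 2 (qUnif A l r)) = 4 * qUnif A l r ^ 2 := by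
    rw [Real.rpow_add (by norm_num), Real.rpow_one]
    congr 1
    rw [show (4 : ℝ) = 2 ^ (2 : ℝ) by norm_num, ← Real.rpow_mul (by norm_num), mul_comm (2 : ℝ),
      Real.rpow_mul (by norm_num), Real.rpow_logb (by norm_num) (by norm_num) (by linarith)]
    norm_num
  refine exists_bound_of_recursion (P := fun N a T => HasEncoding (mpo A l r N) 1 0 a T)
    -- Two halvings, each adding at most `max m m'` sites and rounding up, give `4 * p ≤ N + 6 * max
    -- m m' + 3`.
    (κ := 2 * max m m' + 1) (G := G) (E := E) HasEncoding.mono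
    (fun N hN => exists_hasEncoding (hU N hN)) (by linarith) hB2 (h4 ▸ hB) ?_
  intro N hN
  set n₁ := (N + 1) / 2 with hn₁
  set n₂ := N / 2 with hn₂
  have hsplit : ∀ k, (k + 1) / 2 + k / 2 = k := fun k => by omega
  refine ⟨(n₁ + m + 1) / 2 + m, m' + (n₁ + m) / 2, (m' + n₂ + 1) / 2 + m, m' + (m' + n₂) / 2,
    ?_, ?_⟩
  · intro p hp
    simp only [List.mem_cons, List.not_mem_nil, or_false] at hp
    have h1 := le_max_left m m'
    have h2 := le_max_right m m'
    omega
  · intro a₁ a₂ a₃ a₄ T h1 h2 h3 h4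
    have := hcomb (n₁ := n₁) (n₂ := n₂) (hsplit _) (hsplit _) (by omega) (by omega) h1 h2 h3 h4
    rwa [hsplit] at this

lemma isDensity_one : IsDensity (1 : Matrix (Fin 0 → Fin d) (Fin 0 → Fin d) ℂ) :=
  ⟨Matrix.PosSemidef.one, by simp [Matrix.trace_one]⟩

/-- A one-dimensional bond carries no information. With environments on zero sites,
`sum_rightEnv_mul_leftEnv` says that `q = 1`, so merging needs neither extra sites nor
amplification, and sites can be attached one at a time. Dilution is avoided, as `d = 1` is possible
here. -/
lemma IsUniformBulkMPU.exists_depth_bound_of_le_one (hU : IsUniformBulkMPU A l r) (hD : D ≤ 1) :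
    ∃ c : ℕ, ∀ N : ℕ, 1 ≤ N → HasEncoding (mpo A l r N) 1 0 0 (c * N) := by
  obtain rfl : D = 1 := le_antisymm hD hU.pos
  have h1 := sum_rightEnv_mul_leftEnv A l r isDensity_one isDensity_one
    (hU.mem_of_card_le_one hD (0 + 0))
  simp only [Finset.univ_unique, Finset.sum_singleton] at h1
  have hunit : ∀ {M : Matrix (Fin 1) (Fin 1) ℂ}, M default default ≠ 0 → IsUnit M := by
    intro M hM
    rw [Matrix.isUnit_iff_isUnit_det, Matrix.det_unique]
    exact hM.isUnit
  obtain ⟨c, hc⟩ := exists_merge_cost (A := A) (l := l) (r := r) (q := 1) isDensity_one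
    isDensity_one (hunit (right_ne_zero_of_mul_eq_one h1)) (hunit (left_ne_zero_of_mul_eq_one h1))
    one_pos (by
      rw [Matrix.inv_subsingleton, Matrix.inv_subsingleton, Matrix.diagonal_transpose,
        Matrix.diagonal_mul_diagonal, Matrix.trace_diagonal, Finset.univ_unique,
        Finset.sum_singleton, Ring.inverse_eq_inv', ← mul_inv, h1]
      simp)
  obtain ⟨T, hT⟩ := exists_hasEncoding (hU 1 le_rfl)
  refine ⟨T + c, fun N hN => ?_⟩
  induction N, hN using Nat.le_induction with
  | base => exact hT.mono (by omega)
  | succ N hN ih =>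
    have h := hc (n₁ := N) (n₂ := 1) ih (hT.mono (T' := (T + c) * N) (by nlinarith))
    simp only [mul_one, inv_one, add_zero, mul_zero] at h
    exact h.mono (by rw [mul_add]; omega)

end Recursion

/-! ### Assembly of the bounds -/

theorem theorem1 {d D : ℕ} [NeZero d] (A : Fin d → Fin d → Matrix (Fin D) (Fin D) ℂ)
    (l r : Fin D → ℂ) (hU : IsUniformBulkMPU A l r) (hA : FullRankBoundaries A l r) :
    -- polynomial depth, linearly many auxiliary qudits
    (∃ (p : Polynomial ℕ) (c : ℕ), ∀ N : ℕ, 1 ≤ N →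
      ∃ (a : ℕ) (C : QuditCircuit (Fin N ⊕ Fin a) d),
        C.Implements (mpo A l r N) ∧ C.depth ≤ p.eval N ∧ a ≤ c * N) ∧
    -- the refined bound on the depth; the infimum is over a nonempty set
    (condValues A l r).Nonempty ∧
    (∃ c : ℝ, ∀ N : ℕ, 1 ≤ N →
      ∃ (a : ℕ) (C : QuditCircuit (Fin N ⊕ Fin a) d),
        C.Implements (mpo A l r N) ∧
        (C.depth : ℝ) ≤ c * (N : ℝ) ^ (1 + Real.logb 2 (qUnif A l r)) ∧
        (a : ℝ) ≤ c * (N : ℝ)) := by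
  set α := 1 + Real.logb 2 (qUnif A l r) with hα
  have hq1 : 1 ≤ qUnif A l r := le_trans (by exact_mod_cast hU.pos) (hU.le_qUnif hA)
  have hα1 : 1 ≤ α := by
    have := Real.logb_nonneg (b := 2) (by norm_num) hq1
    linarith
  have hbound : ∃ c : ℝ, ∀ N : ℕ, 1 ≤ N → ∃ a T, HasEncoding (mpo A l r N) 1 0 a T ∧
      (a : ℝ) ≤ c * N ∧ (T : ℝ) ≤ c * (N : ℝ) ^ α := by
    rcases Nat.lt_or_ge D 2 with hD | hD
    · obtain ⟨c, hc⟩ := hU.exists_depth_bound_of_le_one (by omega)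
      refine ⟨c, fun N hN => ⟨0, c * N, hc N hN, by push_cast; positivity, ?_⟩⟩
      push_cast
      gcongr
      exact Real.self_le_rpow_of_one_le (by exact_mod_cast hN) hα1
    · exact hU.exists_depth_bound_of_two_le hA hD
  obtain ⟨c, hc⟩ := hbound
  have hcirc : ∀ N : ℕ, 1 ≤ N → ∃ (a : ℕ) (C : QuditCircuit (Fin N ⊕ Fin a) d),
      C.Implements (mpo A l r N) ∧ (C.depth : ℝ) ≤ c * (N : ℝ) ^ α ∧ (a : ℝ) ≤ c * (N : ℝ) := by
    intro N hN
    obtain ⟨a, T, h, ha, hT⟩ := hc N hN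
    obtain ⟨C, hC, hCT⟩ := h.exists_implements (hU N hN)
    exact ⟨_, C, hC, by rwa [hCT], by rwa [zero_add]⟩
  -- The polynomial bound is the refined one with constant and exponent rounded up.
  refine ⟨⟨Polynomial.C ⌈c⌉₊ * Polynomial.X ^ ⌈α⌉₊, ⌈c⌉₊, fun N hN => ?_⟩,
    condValues_nonempty hA, c, hcirc⟩
  obtain ⟨a, C, hC, hT, ha⟩ := hcirc N hN
  have hN1 : (1 : ℝ) ≤ N := by exact_mod_cast hN
  refine ⟨a, C, hC, ?_, ?_⟩
  · rw [Polynomial.eval_mul, Polynomial.eval_C, Polynomial.eval_pow, Polynomial.eval_X]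
    have : (C.depth : ℝ) ≤ ⌈c⌉₊ * (N : ℝ) ^ ⌈α⌉₊ := by
      refine hT.trans ?_
      rw [← Real.rpow_natCast]
      gcongr
      · exact Nat.le_ceil c
      · exact Nat.le_ceil α
    exact_mod_cast this
  · have : (a : ℝ) ≤ ⌈c⌉₊ * (N : ℝ) := ha.trans (by gcongr; exact Nat.le_ceil c)
    exact_mod_cast this
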